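/- Let $n\ge 2$ and let $F:\mathbb R^n\to[0,\infty)$ be even and positively $1$-homogeneous, with $F\in C^2(\mathbb R^n\setminus\{0\})$ and $\nabla^2 F^2(\xi)$ positive definite for every $\xi\neq 0$. Let $F_\circ(x)=\sup\{\xi\cdot x: F(\xi)\le 1\}$ be its polar. Set $X_1(t)=(1-\log t)^{-1}$ for $0<t\le 1$, $X_1(0)=0$, and $X_2=X_1\circ X_1$. For a bounded domain $\Omega\subset\mathbb R^n$ (nonempty, open and connected) put $R_\Omega=\sup_{x\in\Omega}F_\circ(x)$ and $$I_{F,dx}[u]=\int_\Omega F(\nabla u)^n\,dx-\Big(\frac{n-1}{n}\Big)^n\int_\Omega \frac{|u|^n}{F_\circ^n}\,X_1^n\Big(\frac{F_\circ}{R_\Omega}\Big)dx .$$ There is a smallest constant $\sigma_F\ge 1$ such that, for every bounded domain $\Omega$ and every $u\in C_c^1(\Omega)$, with $v=X_1^{1-1/n}(F_\circ/R_\Omega)\,u$, $$\int_\Omega F(\nabla v)^n X_1^{1-n}\Big(\frac{F_\circ}{R_\Omega}\Big)dx\le 2^{n-1}\sigma_F^n\, I_{F,dx}[u].$$ Let $\kappa_n=\frac2n\big(\frac{n}{n-1}\big)^{n-2}$,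 let $\tilde\beta=\max_{|x|=1}|\nabla F_\circ(x)|$, let $\omega_n$ be the Lebesgue measure of the unit ball of $\mathbb R^n$, and let $\alpha>0$ be any constant such that $\alpha|\xi|\le F(\xi)$ for all $\xi\in\mathbb R^n$. Define $$C_{n,F}=\frac1n\,\omega_n^{-1/n}\Big[\alpha^{-1}2^{\frac{n-1}{n}}\sigma_F+\tilde\beta\,\frac{n+1}{n}\,n^{2/n}\kappa_n^{1/n}\Big].$$ Then for every bounded domain $\Omega$ and every $u\in W_0^{1,n}(\Omega)$ (the closure of $C_c^\infty(\Omega)$ in $W^{1,n}(\Omega)$) both integrals in $I_{F,dx}[u]$ are finite, $I_{F,dx}[u]\ge 0$, and for every real $q>n$ the function $u\,X_2^{2/n}(F_\circ/R_\Omega)$ belongs to $L^q(\Omega)$ with $$\Big\|u\,X_2^{\frac2n}\Big(\frac{F_\circ}{R_\Omega}\Big)\Big\|_{L^q(\Omega)}\le C_{n,F}\Big[1+\frac{q(n-1)}{n}\Big]^{1-\frac1n+\frac1q}|\Omega|^{\frac1q}\,\big(I_{F,dx}[u]\big)^{\frac1n}.$$ -/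

import Mathlib

open MeasureTheory Filter Topology

noncomputable section

namespace FinslerLeray

/-- `n`-dimensional Euclidean space. -/
abbrev E (n : ℕ) : Type := EuclideanSpace ℝ (Fin n)

/-- An even, positively `1`-homogeneous function `F : ℝⁿ → [0, ∞)` that is `C²` away from the origin
and such that the Hessian of `F²` is positive definite at every nonzero point. -/
structure IsStronglyConvexFinsler {n : ℕ} (F : E n → ℝ) : Prop where
  nonneg : ∀ ξ, 0 ≤ F ξ
  even : ∀ ξ, F (-ξ) = F ξ
  homogeneous : ∀ t : ℝ, 0 < t → ∀ ξ, F (t • ξ) = t * F ξ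
  contDiffOn : ContDiffOn ℝ 2 F {0}ᶜ
  hessian_posDef : ∀ ξ, ξ ≠ 0 → ∀ η, η ≠ 0 →
    0 < fderiv ℝ (fderiv ℝ (fun y => F y ^ 2)) ξ η η

/-- The polar function `F_∘(x) = sup { ξ · x : F(ξ) ≤ 1 }`. -/
def polar {n : ℕ} (F : E n → ℝ) (x : E n) : ℝ :=
  sSup ((fun ξ => inner ℝ ξ x) '' {ξ | F ξ ≤ 1})

/-- `R_Ω = sup_{x ∈ Ω} F_∘(x)`. -/
def radius {n : ℕ} (F : E n → ℝ) (Ω : Set (E n)) : ℝ := sSup (polar F '' Ω)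

/-- `X₁(t) = (1 - log t)⁻¹` for `0 < t ≤ 1`, and `X₁(0) = 0`. -/
def X₁ (t : ℝ) : ℝ := if t = 0 then 0 else (1 - Real.log t)⁻¹

/-- `X₂ = X₁ ∘ X₁`. -/
def X₂ (t : ℝ) : ℝ := X₁ (X₁ t)

/-- A bounded domain: a nonempty, connected, open, bounded set. -/
structure IsBoundedDomain {n : ℕ} (Ω : Set (E n)) : Prop where
  isOpen : IsOpen Ω
  isConnected : IsConnected Ω
  isBounded : Bornology.IsBounded Ω

/-- `φ ∈ C_c^k(Ω)`. -/
structure IsTest {n : ℕ} (k : WithTop ℕ∞) (Ω : Set (E n)) (φ : E n → ℝ) : Prop where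
  contDiff : ContDiff ℝ k φ
  hasCompactSupport : HasCompactSupport φ
  tsupport_subset : tsupport φ ⊆ Ω

/-- `G` is the weak (distributional) gradient of `u` on `Ω`. -/
structure HasWeakGradient {n : ℕ} (Ω : Set (E n)) (u : E n → ℝ) (G : E n → E n) : Prop where
  locallyIntegrableOn : LocallyIntegrableOn u Ω
  locallyIntegrableOn_grad : LocallyIntegrableOn G Ω
  integral_eq : ∀ φ : E n → ℝ, IsTest ((⊤ : ℕ∞) : WithTop ℕ∞) Ω φ →
    ∫ x in Ω, u x • gradient φ x = -∫ x in Ω, φ x • G x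

/-- `u ∈ W₀^{1,n}(Ω)` with weak gradient `G`: `u` and `G` are in `Lⁿ(Ω)` and `u` is a limit, in
the norm of `W^{1,n}(Ω)`, of functions in `C_c^∞(Ω)`. -/
structure MemW₀ {n : ℕ} (Ω : Set (E n)) (u : E n → ℝ) (G : E n → E n) : Prop where
  memLp : MemLp u n (volume.restrict Ω)
  memLp_grad : MemLp G n (volume.restrict Ω)
  hasWeakGradient : HasWeakGradient Ω u G
  exists_approx : ∃ φ : ℕ → E n → ℝ,
    (∀ k, IsTest ((⊤ : ℕ∞) : WithTop ℕ∞) Ω (φ k)) ∧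
    Tendsto (fun k => eLpNorm (fun x => φ k x - u x) n (volume.restrict Ω)) atTop (𝓝 0) ∧
    Tendsto (fun k => eLpNorm (fun x => gradient (φ k) x - G x) n (volume.restrict Ω))
      atTop (𝓝 0)

/-- The Leray potential term `|u|ⁿ F_∘⁻ⁿ X₁ⁿ(F_∘ / R_Ω)`. -/
def lerayTerm {n : ℕ} (F : E n → ℝ) (Ω : Set (E n)) (u : E n → ℝ) (x : E n) : ℝ :=
  |u x| ^ n / polar F x ^ n * X₁ (polar F x / radius F Ω) ^ n

/-- The Leray difference `I_{F,dx}[u]` of a function `u` with gradient `G`. -/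
def lerayDiff {n : ℕ} (F : E n → ℝ) (Ω : Set (E n)) (u : E n → ℝ) (G : E n → E n) : ℝ :=
  (∫ x in Ω, F (G x) ^ n) -
    (((n : ℝ) - 1) / n) ^ n * ∫ x in Ω, lerayTerm F Ω u x

/-- The ground state substitution `v = X₁^{1 - 1/n}(F_∘ / R_Ω) u`. -/
def groundState {n : ℕ} (F : E n → ℝ) (Ω : Set (E n)) (u : E n → ℝ) (x : E n) : ℝ :=
  X₁ (polar F x / radius F Ω) ^ (1 - 1 / (n : ℝ)) * u x

/-- `σ ≥ 1` is an admissible constant in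
`∫_Ω Fⁿ(∇v) X₁^{1-n}(F_∘ / R_Ω) dx ≤ 2^{n-1} σⁿ I_{F,dx}[u]`, `v = X₁^{1-1/n}(F_∘ / R_Ω) u`,
simultaneously for all bounded domains `Ω` and all `u ∈ C_c^1(Ω)`. -/
def IsLinkConst {n : ℕ} (F : E n → ℝ) (σ : ℝ) : Prop :=
  1 ≤ σ ∧ ∀ Ω : Set (E n), IsBoundedDomain Ω → ∀ u : E n → ℝ, IsTest 1 Ω u →
    ∫ x in Ω, F (gradient (groundState F Ω u) x) ^ n *
        X₁ (polar F x / radius F Ω) ^ (1 - (n : ℝ)) ≤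
      2 ^ (n - 1) * σ ^ n * lerayDiff F Ω u (gradient u)

/-- The constant `σ_F`: the smallest admissible constant (it is part of the theorem that the
infimum is attained, in particular that an admissible constant exists). -/
def sigma {n : ℕ} (F : E n → ℝ) : ℝ := sInf {σ | IsLinkConst F σ}

/-- `κ_n = (2 / n) (n / (n - 1))^{n - 2}`, for `n ≥ 2`. -/
def kappa (n : ℕ) : ℝ := 2 / (n : ℝ) * ((n : ℝ) / ((n : ℝ) - 1)) ^ (n - 2)

/-- `β̃ = max_{|x| = 1} |∇F_∘(x)|`. -/
def betaTilde {n : ℕ} (F : E n → ℝ) : ℝ :=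
  sSup ((fun x => ‖gradient (polar F) x‖) '' Metric.sphere 0 1)

/-- The Lebesgue measure of the unit ball of `ℝⁿ`. -/
def omega (n : ℕ) : ℝ := volume.real (Metric.ball (0 : E n) 1)

/-- The constant `C_{n,F}`, for a given lower bound `α |ξ| ≤ F(ξ)`. -/
def constC {n : ℕ} (F : E n → ℝ) (α : ℝ) : ℝ :=
  1 / (n : ℝ) * omega n ^ (-(1 / (n : ℝ))) *
    (α⁻¹ * 2 ^ (((n : ℝ) - 1) / n) * sigma F +
      betaTilde F * (((n : ℝ) + 1) / n) * (n : ℝ) ^ (2 / (n : ℝ)) * kappa n ^ (1 / (n : ℝ)))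

/-- The weighted function `u X₂^{2/n}(F_∘ / R_Ω)`. -/
def weighted {n : ℕ} (F : E n → ℝ) (Ω : Set (E n)) (u : E n → ℝ) (x : E n) : ℝ :=
  u x * X₂ (polar F x / radius F Ω) ^ (2 / (n : ℝ))

end FinslerLeray

end

open FinslerLeray

/-! ### Strong convexity of F² and norm properties of F. -/

namespace FinslerLeray

namespace IsStronglyConvexFinsler

variable {n : ℕ} {F : E n → ℝ}

/-! Write c = (n-1)/n, X = X₁(F_∘/R_Ω), τ = X₂(F_∘/R_Ω), ρ = X/F_∘ and I for the Leray difference.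
The proof rests on two lower bounds for I[u], first for u ∈ C_c¹(Ω).

The field x/F_∘ⁿ is divergence free off the origin. Hence, for κ = cX(1 + θτ), the radial derivative
of κ^{n-1}|u|ⁿ divided by F_∘ⁿ integrates to zero; no term survives at the origin because X vanishes
there (`integral_fluxDeriv`). This null term is added to F(∇u)ⁿ. With θ = 1/(n-1), the inequality
|x·∇u| ≤ F_∘ F(∇u) and the tangent line of tⁿ give I ≥ (n²κ_n)⁻¹ ∫ τ²(|u|ρ)ⁿ (`improved_leray`).
With θ = 0, the uniform convexity of Fⁿ (`exists_pow_expansion`) gives I ≥ c₀ ∫ F(a)ⁿ, where a = ∇u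
+ cuρ∇F_∘ = X^{-(1-1/n)}∇v (`exists_link_bound`). So admissible link constants exist; they form a
closed set, hence the least one is attained.

For w = uτ^{2/n}, the gradient is τ^{2/n} times a plus a bounded multiple of uρ∇F_∘. The first piece
is controlled by the link inequality, the second by the logarithmic remainder, whose weight τ² is
the n-th power of τ^{2/n}. This gives ‖∇w‖_n ≤ (bracket of C_{n,F}) I^{1/n}. The remaining factor
comes from a Sobolev inequality with explicit dependence on q: a Riesz potential bound, Young's
inequality for the kernel, and the extremality of the ball (`eLpNorm_le_eLpNorm_gradient`).

By the Leray inequality, u ↦ ρu is bounded from the gradient norm to Lⁿ. Thus I passes to the limit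
along an approximating sequence, and the L^q bound follows by Fatou. -/

theorem map_zero (hF : IsStronglyConvexFinsler F) : F 0 = 0 := by
  have h := hF.homogeneous 2 two_pos 0
  rw [smul_zero] at h
  linarith

theorem map_smul (hF : IsStronglyConvexFinsler F) (t : ℝ) (ξ : E n) : F (t • ξ) = |t| * F ξ := by
  rcases lt_trichotomy t 0 with ht | rfl | ht
  · rw [abs_of_neg ht, ← hF.homogeneous (-t) (by linarith) ξ, neg_smul, hF.even]
  · simp [hF.map_zero]
  · rw [abs_of_pos ht, hF.homogeneous t ht]

theorem contDiffOn_sq (hF : IsStronglyConvexFinsler F) :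
    ContDiffOn ℝ 2 (fun y => F y ^ 2) {0}ᶜ := hF.contDiffOn.pow 2

theorem contDiffAt_sq (hF : IsStronglyConvexFinsler F) {ξ : E n} (hξ : ξ ≠ 0) :
    ContDiffAt ℝ 2 (fun y => F y ^ 2) ξ :=
  hF.contDiffOn_sq.contDiffAt (isOpen_compl_singleton.mem_nhds hξ)

theorem hasDerivAt_sq_line (hF : IsStronglyConvexFinsler F) {x d : E n} {t : ℝ}
    (h : x + t • d ≠ 0) :
    HasDerivAt (fun s : ℝ => F (x + s • d) ^ 2)
      (fderiv ℝ (fun y => F y ^ 2) (x + t • d) d) t := by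
  have h1 : HasFDerivAt (fun y => F y ^ 2) (fderiv ℝ (fun y => F y ^ 2) (x + t • d)) (x + t • d) :=
    ((hF.contDiffAt_sq h).differentiableAt (by norm_num)).hasFDerivAt
  have h2 : HasDerivAt (fun s : ℝ => x + s • d) d t := by
    simpa using ((hasDerivAt_id t).smul_const d).const_add x
  exact h1.comp_hasDerivAt t h2

theorem hasDerivAt_fderiv_sq_line (hF : IsStronglyConvexFinsler F) {x d : E n} {t : ℝ}
    (h : x + t • d ≠ 0) :
    HasDerivAt (fun s : ℝ => fderiv ℝ (fun y => F y ^ 2) (x + s • d) d)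
      (fderiv ℝ (fderiv ℝ (fun y => F y ^ 2)) (x + t • d) d d) t := by
  have h0 : ContDiffAt ℝ 1 (fderiv ℝ (fun y => F y ^ 2)) (x + t • d) :=
    (hF.contDiffAt_sq h).fderiv_right (by norm_num)
  have h1 := (h0.differentiableAt (by norm_num)).hasFDerivAt
  have h2 : HasDerivAt (fun s : ℝ => x + s • d) d t := by
    simpa using ((hasDerivAt_id t).smul_const d).const_add x
  have h3 : HasDerivAt (fun s : ℝ => fderiv ℝ (fun y => F y ^ 2) (x + s • d))
      (fderiv ℝ (fderiv ℝ (fun y => F y ^ 2)) (x + t • d) d) t := h1.comp_hasDerivAt t h2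
  have h4 := h3.clm_apply (hasDerivAt_const t d)
  rwa [_root_.map_zero, add_zero] at h4

/-- Euler's identity for the Hessian of `F²`. -/
theorem hessian_apply_self (hF : IsStronglyConvexFinsler F) {ξ : E n} (hξ : ξ ≠ 0) :
    fderiv ℝ (fderiv ℝ (fun y => F y ^ 2)) ξ ξ ξ = 2 * F ξ ^ 2 := by
  have hne : ∀ t : ℝ, 0 < t → (0 : E n) + t • ξ ≠ 0 := fun t ht => by simp [ht.ne', hξ]
  have h1 : ∀ t : ℝ, 0 < t →
      fderiv ℝ (fun y => F y ^ 2) ((0 : E n) + t • ξ) ξ = 2 * t * F ξ ^ 2 := by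
    intro t ht
    have ha := hF.hasDerivAt_sq_line (hne t ht)
    have hb : HasDerivAt (fun s : ℝ => F ((0 : E n) + s • ξ) ^ 2) (2 * t * F ξ ^ 2) t := by
      have : (fun s : ℝ => F ((0 : E n) + s • ξ) ^ 2) = fun s => s ^ 2 * F ξ ^ 2 := by
        ext s; rw [zero_add, hF.map_smul, mul_pow, sq_abs]
      rw [this]
      simpa using ((hasDerivAt_id t).pow 2).mul_const (F ξ ^ 2)
    exact ha.unique hb
  have ha := hF.hasDerivAt_fderiv_sq_line (hne 1 one_pos)
  have hb : HasDerivAt (fun s : ℝ => fderiv ℝ (fun y => F y ^ 2) ((0 : E n) + s • ξ) ξ)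
      (2 * F ξ ^ 2) 1 := by
    have : HasDerivAt (fun s : ℝ => 2 * s * F ξ ^ 2) (2 * F ξ ^ 2) 1 := by
      simpa using ((hasDerivAt_id (1 : ℝ)).const_mul 2).mul_const (F ξ ^ 2)
    refine this.congr_of_eventuallyEq ?_
    filter_upwards [lt_mem_nhds (zero_lt_one' ℝ)] with s hs using h1 s hs
  simpa using ha.unique hb

/-- By Euler's identity 2F(ξ)² is a value of the positive definite Hessian. -/
theorem pos (hF : IsStronglyConvexFinsler F) {ξ : E n} (hξ : ξ ≠ 0) : 0 < F ξ := by
  have h := hF.hessian_posDef ξ hξ ξ hξ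
  rw [hF.hessian_apply_self hξ] at h
  have := hF.nonneg ξ
  rcases this.lt_or_eq with h' | h'
  · exact h'
  · rw [← h'] at h; norm_num at h

theorem fderiv_sq_smul (hF : IsStronglyConvexFinsler F) {c : ℝ} (hc : c ≠ 0) (ξ : E n) :
    fderiv ℝ (fun y => F y ^ 2) (c • ξ) = c • fderiv ℝ (fun y => F y ^ 2) ξ := by
  have h := fderiv_comp_smul (𝕜 := ℝ) (f := fun y => F y ^ 2) (x := ξ) c
  have h2 : (fun y : E n => F (c • y) ^ 2) = fun y => c ^ 2 • F y ^ 2 := by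
    ext y; rw [hF.map_smul, mul_pow, sq_abs, smul_eq_mul]
  have h3 : fderiv ℝ (fun y : E n => F (c • y) ^ 2) ξ = c ^ 2 • fderiv ℝ (fun y => F y ^ 2) ξ := by
    rw [h2]
    exact congrFun (fderiv_const_smul_field (𝕜 := ℝ) (f := fun y => F y ^ 2) (c ^ 2)) ξ
  have h4 : c • fderiv ℝ (fun y => F y ^ 2) (c • ξ) = c ^ 2 • fderiv ℝ (fun y => F y ^ 2) ξ :=
    h.symm.trans h3
  rw [pow_two, mul_smul] at h4
  exact smul_right_injective _ hc h4

/-- Degree-zero homogeneity of the Hessian reduces uniform positivity to compactness of the unit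
sphere. -/
theorem hessian_smul (hF : IsStronglyConvexFinsler F) {c : ℝ} (hc : c ≠ 0) (ξ : E n) :
    fderiv ℝ (fderiv ℝ (fun y => F y ^ 2)) (c • ξ) =
      fderiv ℝ (fderiv ℝ (fun y => F y ^ 2)) ξ := by
  have h := fderiv_comp_smul (𝕜 := ℝ) (f := fderiv ℝ (fun y => F y ^ 2)) (x := ξ) c
  have h2 : (fun y : E n => fderiv ℝ (fun y => F y ^ 2) (c • y)) =
      fun y => c • fderiv ℝ (fun y => F y ^ 2) y := by
    ext1 y; exact hF.fderiv_sq_smul hc y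
  have h3 : fderiv ℝ (fun y : E n => fderiv ℝ (fun y => F y ^ 2) (c • y)) ξ =
      c • fderiv ℝ (fderiv ℝ (fun y => F y ^ 2)) ξ := by
    rw [h2]
    exact congrFun (fderiv_const_smul_field (𝕜 := ℝ) (f := fderiv ℝ (fun y => F y ^ 2)) c) ξ
  exact smul_right_injective _ hc (h.symm.trans h3)

/-- The Hessian of `F²` is uniformly positive definite. -/
theorem exists_hessian_lower_bound (hF : IsStronglyConvexFinsler F) :
    ∃ ε : ℝ, 0 < ε ∧ ∀ ξ : E n, ξ ≠ 0 → ∀ η : E n,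
      2 * ε * ‖η‖ ^ 2 ≤ fderiv ℝ (fderiv ℝ (fun y => F y ^ 2)) ξ η η := by
  set A := fderiv ℝ (fderiv ℝ (fun y => F y ^ 2)) with hA
  have hcont : ContinuousOn (fun p : E n × E n => A p.1 p.2 p.2)
      (Metric.sphere 0 1 ×ˢ Metric.sphere 0 1) := by
    have h1 : ContinuousOn A {0}ᶜ := by
      intro ξ hξ
      have h0 : ContDiffAt ℝ 1 (fderiv ℝ (fun y => F y ^ 2)) ξ :=
        (hF.contDiffAt_sq hξ).fderiv_right (by norm_num)
      have h1 : ContDiffAt ℝ 0 A ξ := h0.fderiv_right (by norm_num)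
      exact h1.continuousAt.continuousWithinAt
    have h2 : ContinuousOn (fun p : E n × E n => A p.1)
        (Metric.sphere 0 1 ×ˢ Metric.sphere 0 1) := by
      refine h1.comp continuousOn_fst ?_
      rintro ⟨a, b⟩ ⟨ha, -⟩
      exact ne_zero_of_mem_unit_sphere (⟨a, ha⟩ : Metric.sphere (0 : E n) 1)
    exact (h2.clm_apply continuousOn_snd).clm_apply continuousOn_snd
  have hK : IsCompact ((Metric.sphere 0 1 : Set (E n)) ×ˢ (Metric.sphere 0 1 : Set (E n))) :=
    (isCompact_sphere 0 1).prod (isCompact_sphere 0 1)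
  have hpos : ∀ p ∈ (Metric.sphere 0 1 : Set (E n)) ×ˢ (Metric.sphere 0 1 : Set (E n)),
      0 < A p.1 p.2 p.2 := by
    rintro ⟨a, b⟩ ⟨ha, hb⟩
    exact hF.hessian_posDef a (ne_zero_of_mem_unit_sphere (⟨a, ha⟩ : Metric.sphere (0 : E n) 1))
      b (ne_zero_of_mem_unit_sphere (⟨b, hb⟩ : Metric.sphere (0 : E n) 1))
  obtain ⟨ε, hε, hle⟩ := hK.exists_forall_le' hcont hpos
  refine ⟨ε / 2, by positivity, fun ξ hξ η => ?_⟩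
  rcases eq_or_ne η 0 with rfl | hη
  · simp
  have hξ' : ‖ξ‖ ≠ 0 := norm_ne_zero_iff.2 hξ
  have hη' : ‖η‖ ≠ 0 := norm_ne_zero_iff.2 hη
  have h1 := hle (‖ξ‖⁻¹ • ξ, ‖η‖⁻¹ • η)
    ⟨by simp [norm_smul, hξ'], by simp [norm_smul, hη']⟩
  have h2 : A (‖ξ‖⁻¹ • ξ) = A ξ := hF.hessian_smul (inv_ne_zero hξ') ξ
  simp only [h2, _root_.map_smul, smul_apply, smul_eq_mul] at h1
  have h3 : ‖η‖⁻¹ * (‖η‖⁻¹ * A ξ η η) = A ξ η η / ‖η‖ ^ 2 := by field_simp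
  rw [h3, le_div_iff₀ (by positivity)] at h1
  linarith

/-- `F²` is strongly convex. -/
theorem exists_strongConvex (hF : IsStronglyConvexFinsler F) :
    ∃ ε : ℝ, 0 < ε ∧ (∀ ξ, ε * ‖ξ‖ ^ 2 ≤ F ξ ^ 2) ∧ ∀ x y : E n, ∀ s t : ℝ, 0 ≤ s → 0 ≤ t →
      s + t = 1 → F (s • x + t • y) ^ 2 + ε * (s * t) * ‖x - y‖ ^ 2 ≤
        s * F x ^ 2 + t * F y ^ 2 := by
  obtain ⟨ε, hε, hess⟩ := hF.exists_hessian_lower_bound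
  have hlow : ∀ ξ, ε * ‖ξ‖ ^ 2 ≤ F ξ ^ 2 := by
    intro ξ
    rcases eq_or_ne ξ 0 with rfl | hξ
    · simp [hF.map_zero]
    · have := hess ξ hξ ξ
      rw [hF.hessian_apply_self hξ] at this
      linarith
  refine ⟨ε, hε, hlow, fun x y s t hs ht hst => ?_⟩
  -- If the line through x and y avoids the origin, F² is C² along it and the second derivative test
  -- applies. Otherwise x and y are multiples of x - y, and homogeneity reduces the claim to `hlow`.
  by_cases hline : ∀ r : ℝ, y + r • (x - y) ≠ 0
  · set d := x - y with hd
    have hconv : ConvexOn ℝ Set.univ (fun r : ℝ => F (y + r • d) ^ 2 - ε * ‖d‖ ^ 2 * r ^ 2) := by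
      have hd1 : ∀ r, HasDerivAt (fun r : ℝ => F (y + r • d) ^ 2 - ε * ‖d‖ ^ 2 * r ^ 2)
          (fderiv ℝ (fun y => F y ^ 2) (y + r • d) d - ε * ‖d‖ ^ 2 * (2 * r)) r := by
        intro r
        have := ((hasDerivAt_id r).pow 2).const_mul (ε * ‖d‖ ^ 2)
        exact (hF.hasDerivAt_sq_line (hline r)).sub (this.congr_deriv (by simp))
      have hd2 : ∀ r, HasDerivAt
          (fun r => fderiv ℝ (fun y => F y ^ 2) (y + r • d) d - ε * ‖d‖ ^ 2 * (2 * r))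
          (fderiv ℝ (fderiv ℝ (fun y => F y ^ 2)) (y + r • d) d d - ε * ‖d‖ ^ 2 * 2) r := by
        intro r
        have := ((hasDerivAt_id r).const_mul 2).const_mul (ε * ‖d‖ ^ 2)
        exact (hF.hasDerivAt_fderiv_sq_line (hline r)).sub (this.congr_deriv (by simp))
      have e1 : deriv (fun r : ℝ => F (y + r • d) ^ 2 - ε * ‖d‖ ^ 2 * r ^ 2) =
        fun r => fderiv ℝ (fun y => F y ^ 2) (y + r • d) d - ε * ‖d‖ ^ 2 * (2 * r) :=
        funext fun r => (hd1 r).deriv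
      refine convexOn_univ_of_deriv2_nonneg (fun r => (hd1 r).differentiableAt) ?_ ?_
      · rw [e1]; exact fun r => (hd2 r).differentiableAt
      · intro r
        rw [Function.iterate_succ, Function.iterate_one, Function.comp, e1, (hd2 r).deriv]
        have := hess _ (hline r) d
        linarith
    have h := hconv.2 (Set.mem_univ 1) (Set.mem_univ 0) hs ht hst
    have e1 : y + (s • (1 : ℝ) + t • (0 : ℝ)) • d = s • x + t • y := by
      have : t = 1 - s := by linarith
      subst this
      rw [hd]; simp only [smul_eq_mul, mul_one, mul_zero, add_zero]; module
    have e2 : y + (1 : ℝ) • d = x := by rw [hd]; module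
    have e3 : y + (0 : ℝ) • d = y := by module
    simp only at h
    rw [e1, e2, e3] at h
    simp only [smul_eq_mul] at h
    have : t = 1 - s := by linarith
    subst this
    nlinarith
  · push Not at hline
    obtain ⟨r, hr⟩ := hline
    set d := x - y with hd
    have hy : y = (-r) • d := by
      rw [neg_smul]; exact eq_neg_of_add_eq_zero_left hr
    have hx : x = (1 - r) • d := by
      have h0 : x = d + y := by rw [hd]; abel
      have h1 : d + (-r) • d = (1 - r) • d := by module
      rw [← h1, ← hy]; exact h0
    have h1 : s • x + t • y = (s * (1 - r) + t * (-r)) • d := by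
      rw [hx, hy]; module
    have := hlow d
    have hx2 : F x ^ 2 = (1 - r) ^ 2 * F d ^ 2 := by
      have := congrArg (fun z => F z ^ 2) hx
      simpa only [hF.map_smul, mul_pow, sq_abs] using this
    have hy2 : F y ^ 2 = (-r) ^ 2 * F d ^ 2 := by
      have := congrArg (fun z => F z ^ 2) hy
      simpa only [hF.map_smul, mul_pow, sq_abs] using this
    rw [h1, hx2, hy2, hF.map_smul, mul_pow, sq_abs]
    have : t = 1 - s := by linarith
    subst this
    nlinarith [mul_le_mul_of_nonneg_left (hlow d) (mul_nonneg hs ht)]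

/-- Convexity of F² at the normalized vectors x/F(x) and y/F(y), with weights proportional to F(x)
and F(y): their combination is (x + y)/(F(x) + F(y)). -/
theorem add_le (hF : IsStronglyConvexFinsler F) (x y : E n) : F (x + y) ≤ F x + F y := by
  rcases eq_or_ne x 0 with rfl | hx
  · simp [hF.map_zero]
  rcases eq_or_ne y 0 with rfl | hy
  · simp [hF.map_zero]
  have ha := hF.pos hx
  have hb := hF.pos hy
  obtain ⟨ε, hε, -, h⟩ := hF.exists_strongConvex
  set a := F x
  set b := F y
  have h1 := h (a⁻¹ • x) (b⁻¹ • y) (a / (a + b)) (b / (a + b)) (by positivity) (by positivity)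
    (by field_simp)
  have e : (a / (a + b)) • a⁻¹ • x + (b / (a + b)) • b⁻¹ • y = (a + b)⁻¹ • (x + y) := by
    rw [smul_smul, smul_smul, smul_add]
    congr 2 <;> field_simp
  rw [e, hF.map_smul, hF.map_smul, hF.map_smul, abs_of_pos (by positivity),
    abs_of_pos (by positivity), abs_of_pos (by positivity)] at h1
  have e2 : a⁻¹ * F x = 1 := inv_mul_cancel₀ ha.ne'
  have e3 : b⁻¹ * F y = 1 := inv_mul_cancel₀ hb.ne'
  have e4 : a / (a + b) + b / (a + b) = 1 := by field_simp
  have e5 : 0 ≤ ε * (a / (a + b) * (b / (a + b))) * ‖a⁻¹ • x - b⁻¹ • y‖ ^ 2 := by positivity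
  rw [e2, e3] at h1
  have h2 : ((a + b)⁻¹ * F (x + y)) ^ 2 ≤ 1 := by linarith
  have h3 : (a + b)⁻¹ * F (x + y) ≤ 1 := by
    have := hF.nonneg (x + y)
    exact (sq_le_one_iff₀ (by positivity)).1 h2
  rw [inv_mul_le_iff₀ (by positivity)] at h3
  linarith

theorem exists_upper_bound (hF : IsStronglyConvexFinsler F) :
    ∃ C : ℝ, 0 < C ∧ ∀ ξ, F ξ ≤ C * ‖ξ‖ := by
  have hc : ContinuousOn F (Metric.sphere 0 1) := hF.contDiffOn.continuousOn.mono fun x hx =>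
    ne_zero_of_mem_unit_sphere (⟨x, hx⟩ : Metric.sphere (0 : E n) 1)
  obtain ⟨C, hC⟩ := (isCompact_sphere (0 : E n) 1).exists_bound_of_continuousOn hc
  refine ⟨max C 1, by positivity, fun ξ => ?_⟩
  rcases eq_or_ne ξ 0 with rfl | hξ
  · simp [hF.map_zero]
  have hξ' : 0 < ‖ξ‖ := norm_pos_iff.2 hξ
  have h := (le_abs_self _).trans (hC (‖ξ‖⁻¹ • ξ) (by simp [norm_smul, hξ'.ne']))
  rw [hF.homogeneous _ (by positivity), inv_mul_le_iff₀ hξ'] at h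
  calc F ξ ≤ ‖ξ‖ * C := h
    _ ≤ max C 1 * ‖ξ‖ := by rw [mul_comm]; gcongr; exact le_max_left _ _

theorem sub_le (hF : IsStronglyConvexFinsler F) (x y : E n) : |F x - F y| ≤ F (x - y) := by
  have h1 := hF.add_le (x - y) y
  have h2 := hF.add_le (y - x) x
  have h3 := hF.even (x - y)
  rw [neg_sub] at h3
  rw [sub_add_cancel] at h1 h2
  rw [abs_le]; constructor <;> linarith

theorem continuous (hF : IsStronglyConvexFinsler F) : Continuous F := by
  obtain ⟨C, hC, h⟩ := hF.exists_upper_bound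
  have : LipschitzWith ⟨C, hC.le⟩ F := LipschitzWith.of_dist_le_mul fun x y => by
    rw [Real.dist_eq, dist_eq_norm]
    exact (hF.sub_le x y).trans (h _)
  exact this.continuous

theorem exists_lower_bound (hF : IsStronglyConvexFinsler F) :
    ∃ c : ℝ, 0 < c ∧ ∀ ξ, c * ‖ξ‖ ≤ F ξ := by
  obtain ⟨ε, hε, h, -⟩ := hF.exists_strongConvex
  refine ⟨√ε, Real.sqrt_pos.2 hε, fun ξ => ?_⟩
  refine le_of_sq_le_sq ?_ (hF.nonneg ξ)
  rw [mul_pow, Real.sq_sqrt hε.le]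
  exact h ξ

/-- A Clarkson type inequality in the form of a first order expansion with remainder. -/
theorem exists_pow_expansion (hF : IsStronglyConvexFinsler F) (hn : 2 ≤ n) :
    ∃ c : ℝ, 0 < c ∧ ∀ a b ζ : E n, (∀ y, inner ℝ ζ y ≤ F y) → inner ℝ ζ b = F b →
      F b ^ n + n * F b ^ (n - 1) * inner ℝ ζ a + c * F a ^ n ≤ F (b + a) ^ n := by
  obtain ⟨ε, hε, -, h⟩ := hF.exists_strongConvex
  obtain ⟨C, hC, hup⟩ := hF.exists_upper_bound
  have hn0 : (0 : ℝ) < n := by positivity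
  set s : ℝ := n / 2 with hs
  have hs1 : 1 ≤ s := by
    rw [hs, le_div_iff₀ two_pos]; exact_mod_cast (by omega)
  have hpow : ∀ x, F x ^ n = (F x ^ 2) ^ s := by
    intro x
    rw [← Real.rpow_natCast, ← Real.rpow_natCast, ← Real.rpow_mul (hF.nonneg x)]
    congr 1; rw [hs]; push_cast; ring
  -- The 4 comes from the midpoint weights 1/2 · 1/2, and C from F(a) ≤ C|a|. The final factor 2
  -- undoes the averaging of F(b + a)ⁿ and F(b)ⁿ.
  set c := ε / (4 * C ^ 2) with hc
  have hc0 : 0 < c := by positivity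
  refine ⟨2 * c ^ s, by positivity, fun a b ζ hζ hζb => ?_⟩
  have key := h (b + a) b (1 / 2) (1 / 2) (by norm_num) (by norm_num) (by norm_num)
  have em : (1 / 2 : ℝ) • (b + a) + (1 / 2 : ℝ) • b = b + (1 / 2 : ℝ) • a := by module
  rw [em, add_sub_cancel_left] at key
  set m := b + (1 / 2 : ℝ) • a with hm
  have hca : c * F a ^ 2 ≤ ε * (1 / 2 * (1 / 2)) * ‖a‖ ^ 2 := by
    have : F a ^ 2 ≤ (C * ‖a‖) ^ 2 := pow_le_pow_left₀ (hF.nonneg a) (hup a) 2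
    calc c * F a ^ 2 ≤ c * (C * ‖a‖) ^ 2 := by gcongr
      _ = _ := by rw [hc]; field_simp; ring
  have hmean : F m ^ 2 + c * F a ^ 2 ≤ 1 / 2 * F (b + a) ^ 2 + 1 / 2 * F b ^ 2 := by linarith
  -- The quadratic midpoint inequality is raised to the power s = n/2 ≥ 1: superadditivity on the
  -- smaller side, Jensen on the larger.
  have hsup : (F m ^ 2) ^ s + (c * F a ^ 2) ^ s ≤ (F m ^ 2 + c * F a ^ 2) ^ s := by
    have := NNReal.add_rpow_le_rpow_add ⟨F m ^ 2, by positivity⟩ ⟨c * F a ^ 2, by positivity⟩ hs1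
    exact_mod_cast this
  have hjen : (1 / 2 * F (b + a) ^ 2 + 1 / 2 * F b ^ 2) ^ s ≤
      1 / 2 * (F (b + a) ^ 2) ^ s + 1 / 2 * (F b ^ 2) ^ s := by
    have := (convexOn_rpow hs1).2 (Set.mem_Ici.2 (sq_nonneg (F (b + a))))
      (Set.mem_Ici.2 (sq_nonneg (F b))) (one_half_pos (α := ℝ)).le (one_half_pos (α := ℝ)).le
      (by norm_num)
    simpa only [smul_eq_mul] using this
  have hmono : (F m ^ 2 + c * F a ^ 2) ^ s ≤ (1 / 2 * F (b + a) ^ 2 + 1 / 2 * F b ^ 2) ^ s :=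
    Real.rpow_le_rpow (by positivity) hmean (by positivity)
  rw [Real.mul_rpow hc0.le (by positivity), ← hpow, ← hpow] at hsup
  rw [← hpow, ← hpow] at hjen
  -- ζ supports F at b, so F(m) ≥ F(b) + ⟨ζ, a⟩/2; the tangent line of tⁿ at F(b) does the rest.
  have htan : F b ^ n + n * F b ^ (n - 1) * (1 / 2 * inner ℝ ζ a) ≤ F m ^ n := by
    have h1 : F b + 1 / 2 * inner ℝ ζ a ≤ F m := by
      have := hζ m
      rw [hm, inner_add_right, hζb, inner_smul_right] at this
      rw [hm]; linarith
    have h2 : F b ^ n + n * F b ^ (n - 1) * (F m - F b) ≤ F m ^ n := by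
      rcases (hF.nonneg b).eq_or_lt with h0 | h0
      · rw [← h0, zero_pow (by omega), zero_pow (by omega)]
        have := pow_nonneg (hF.nonneg m) n
        linarith
      · have hB := one_add_mul_le_pow (a := F m / F b - 1)
          (by have := div_nonneg (hF.nonneg m) h0.le; linarith) n
        have hB' := mul_le_mul_of_nonneg_left hB (pow_nonneg h0.le n)
        rw [add_sub_cancel, div_pow, mul_div_cancel₀ _ (by positivity)] at hB'
        have : F b ^ n * (1 + n * (F m / F b - 1)) = F b ^ n + n * F b ^ (n - 1) * (F m - F b) := by
          obtain ⟨k, rfl⟩ : ∃ k, n = k + 1 := ⟨n - 1, by omega⟩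
          rw [Nat.add_sub_cancel]; field_simp; ring
        linarith
    have h3 : n * F b ^ (n - 1) * (1 / 2 * inner ℝ ζ a) ≤ n * F b ^ (n - 1) * (F m - F b) := by
      have := hF.nonneg b
      gcongr; linarith
    linarith
  linarith

end IsStronglyConvexFinsler

end FinslerLeray

/-! ### The polar function and its gradient. -/

namespace FinslerLeray

namespace IsStronglyConvexFinsler

variable {n : ℕ} {F : E n → ℝ}

theorem isCompact_unitBall (hF : IsStronglyConvexFinsler F) : IsCompact {ξ | F ξ ≤ 1} := by
  obtain ⟨c, hc, h⟩ := hF.exists_lower_bound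
  refine Metric.isCompact_of_isClosed_isBounded (isClosed_le hF.continuous continuous_const) ?_
  refine (Metric.isBounded_closedBall (x := (0 : E n)) (r := c⁻¹)).subset fun ξ hξ => ?_
  rw [mem_closedBall_zero_iff, ← one_div, le_div_iff₀ hc, mul_comm]
  exact (h ξ).trans hξ

theorem exists_maximizer (hF : IsStronglyConvexFinsler F) (x : E n) :
    ∃ ξ, F ξ ≤ 1 ∧ inner ℝ ξ x = polar F x ∧ ∀ η, F η ≤ 1 → inner ℝ η x ≤ polar F x := by
  have hc : Continuous (fun ξ : E n => inner ℝ ξ x) := by fun_prop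
  obtain ⟨ξ, hξ, hmax⟩ := hF.isCompact_unitBall.exists_isMaxOn
    ⟨0, by simp [hF.map_zero]⟩ hc.continuousOn
  have hg : IsGreatest ((fun ξ => inner ℝ ξ x) '' {ξ | F ξ ≤ 1}) (inner ℝ ξ x) :=
    ⟨⟨ξ, hξ, rfl⟩, by rintro _ ⟨η, hη, rfl⟩; exact hmax hη⟩
  have he : polar F x = inner ℝ ξ x := hg.csSup_eq
  exact ⟨ξ, hξ, he.symm, fun η hη => by rw [he]; exact hmax hη⟩

theorem inner_le_polar (hF : IsStronglyConvexFinsler F) {ξ : E n} (hξ : F ξ ≤ 1) (x : E n) :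
    inner ℝ ξ x ≤ polar F x := by
  obtain ⟨-, -, -, h⟩ := hF.exists_maximizer x
  exact h ξ hξ

theorem polar_nonneg (hF : IsStronglyConvexFinsler F) (x : E n) : 0 ≤ polar F x := by
  simpa using hF.inner_le_polar (ξ := 0) (by simp [hF.map_zero]) x

theorem inner_le_polar_mul (hF : IsStronglyConvexFinsler F) (ξ x : E n) :
    inner ℝ ξ x ≤ polar F x * F ξ := by
  rcases eq_or_ne ξ 0 with rfl | hξ
  · simp [hF.map_zero]
  have hp := hF.pos hξ
  have h := hF.inner_le_polar (ξ := (F ξ)⁻¹ • ξ)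
    (by rw [hF.homogeneous _ (by positivity), inv_mul_cancel₀ hp.ne']) x
  rw [inner_smul_left, RCLike.conj_to_real, inv_mul_le_iff₀ hp] at h
  linarith

theorem abs_inner_le_polar_mul (hF : IsStronglyConvexFinsler F) (ξ x : E n) :
    |inner ℝ ξ x| ≤ polar F x * F ξ := by
  rw [abs_le]
  have h1 := hF.inner_le_polar_mul ξ x
  have h2 := hF.inner_le_polar_mul (-ξ) x
  rw [hF.even, inner_neg_left] at h2
  exact ⟨by linarith, h1⟩

theorem polar_zero (hF : IsStronglyConvexFinsler F) : polar F 0 = 0 := by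
  obtain ⟨ξ, -, h, -⟩ := hF.exists_maximizer 0
  rw [← h, inner_zero_right]

theorem polar_smul (hF : IsStronglyConvexFinsler F) {t : ℝ} (ht : 0 ≤ t) (x : E n) :
    polar F (t • x) = t * polar F x := by
  obtain ⟨ξ, hξ, h, h'⟩ := hF.exists_maximizer x
  obtain ⟨η, hη, k, k'⟩ := hF.exists_maximizer (t • x)
  apply le_antisymm
  · rw [← k, inner_smul_right]
    exact mul_le_mul_of_nonneg_left (h' η hη) ht
  · rw [← h, ← inner_smul_right]
    exact k' ξ hξ

theorem exists_polar_lower (hF : IsStronglyConvexFinsler F) :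
    ∃ c : ℝ, 0 < c ∧ ∀ x, c * ‖x‖ ≤ polar F x := by
  obtain ⟨C, hC, h⟩ := hF.exists_upper_bound
  refine ⟨C⁻¹, inv_pos.2 hC, fun x => ?_⟩
  rcases eq_or_ne x 0 with rfl | hx
  · simp [hF.polar_zero]
  have hx' : 0 < ‖x‖ := norm_pos_iff.2 hx
  have h1 := hF.inner_le_polar_mul x x
  rw [real_inner_self_eq_norm_sq] at h1
  rw [inv_mul_le_iff₀ hC]
  have h2 := mul_le_mul_of_nonneg_left (h x) (hF.polar_nonneg x)
  nlinarith

theorem polar_pos (hF : IsStronglyConvexFinsler F) {x : E n} (hx : x ≠ 0) : 0 < polar F x := by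
  obtain ⟨c, hc, h⟩ := hF.exists_polar_lower
  have : 0 < ‖x‖ := norm_pos_iff.2 hx
  exact lt_of_lt_of_le (by positivity) (h x)

theorem exists_polar_lipschitz (hF : IsStronglyConvexFinsler F) :
    ∃ C : ℝ, 0 < C ∧ (∀ ξ, F ξ ≤ 1 → ‖ξ‖ ≤ C) ∧ ∀ x y, polar F x - polar F y ≤ C * ‖x - y‖ := by
  obtain ⟨c, hc, h⟩ := hF.exists_lower_bound
  have hb : ∀ ξ, F ξ ≤ 1 → ‖ξ‖ ≤ c⁻¹ := fun ξ hξ => by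
    rw [← one_div, le_div_iff₀ hc, mul_comm]
    exact (h ξ).trans hξ
  refine ⟨c⁻¹, inv_pos.2 hc, hb, fun x y => ?_⟩
  obtain ⟨ξ, hξ, hx, -⟩ := hF.exists_maximizer x
  have h1 := hF.inner_le_polar hξ y
  calc polar F x - polar F y ≤ inner ℝ ξ (x - y) := by rw [inner_sub_right, hx]; linarith
    _ ≤ ‖ξ‖ * ‖x - y‖ := real_inner_le_norm _ _
    _ ≤ c⁻¹ * ‖x - y‖ := by gcongr; exact hb ξ hξ

theorem polar_le (hF : IsStronglyConvexFinsler F) :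
    ∃ C : ℝ, 0 < C ∧ ∀ x, polar F x ≤ C * ‖x‖ := by
  obtain ⟨C, hC, -, h⟩ := hF.exists_polar_lipschitz
  refine ⟨C, hC, fun x => ?_⟩
  simpa [hF.polar_zero] using h x 0

theorem continuous_polar (hF : IsStronglyConvexFinsler F) : Continuous (polar F) := by
  obtain ⟨C, hC, -, h⟩ := hF.exists_polar_lipschitz
  have : LipschitzWith C.toNNReal (polar F) := LipschitzWith.of_dist_le_mul fun x y => by
    rw [Real.dist_eq, dist_eq_norm, abs_le]
    have h1 := h x y
    have h2 := h y x
    rw [norm_sub_rev] at h2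
    rw [Real.coe_toNNReal _ hC.le]
    exact ⟨by linarith, h1⟩
  exact this.continuous

/-- Quantitative dependence of the maximizer on the point. -/
theorem exists_maximizer_modulus (hF : IsStronglyConvexFinsler F) :
    ∃ K : ℝ, 0 < K ∧ ∀ x y ξ η : E n, F ξ ≤ 1 → F η ≤ 1 → inner ℝ ξ x = polar F x →
      inner ℝ η y = polar F y → polar F x * ‖η - ξ‖ ^ 2 ≤ K * ‖y - x‖ := by
  obtain ⟨ε, hε, -, hs⟩ := hF.exists_strongConvex
  obtain ⟨C, hC, hb, hl⟩ := hF.exists_polar_lipschitz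
  refine ⟨8 * C / ε, by positivity, fun x y ξ η hξ hη hx hy => ?_⟩
  have h1 := hs η ξ (1 / 2) (1 / 2) (by norm_num) (by norm_num) (by norm_num)
  have hξ2 : F ξ ^ 2 ≤ 1 := pow_le_one₀ (hF.nonneg ξ) hξ
  have hη2 : F η ^ 2 ≤ 1 := pow_le_one₀ (hF.nonneg η) hη
  set m := (1 / 2 : ℝ) • η + (1 / 2 : ℝ) • ξ with hm
  -- Strong convexity gives F(m)² ≤ 1 - (ε/4)|η - ξ|², and F(m) ≤ (1 + F(m)²)/2. So a midpoint of
  -- distant maximizers lies well inside the unit ball of F.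
  have h2 : F m ≤ 1 - ε / 8 * ‖η - ξ‖ ^ 2 := by
    nlinarith [sq_nonneg (F m - 1)]
  have h3 := hF.inner_le_polar_mul m x
  have h4 : inner ℝ m x = 1 / 2 * inner ℝ η x + 1 / 2 * polar F x := by
    rw [hm, inner_add_left, inner_smul_left, inner_smul_left, hx]; simp
  have h5 : inner ℝ η x = polar F y - inner ℝ η (y - x) := by
    rw [inner_sub_right, hy]; ring
  have h6 : inner ℝ η (y - x) ≤ C * ‖y - x‖ := (real_inner_le_norm _ _).trans (by
    gcongr; exact hb η hη)
  have h7 := hl x y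
  rw [norm_sub_rev] at h7
  have h8 := mul_le_mul_of_nonneg_left h2 (hF.polar_nonneg x)
  have h9 : polar F x * (ε / 8 * ‖η - ξ‖ ^ 2) ≤ C * ‖y - x‖ := by nlinarith
  rw [div_mul_eq_mul_div, le_div_iff₀ hε]
  nlinarith

/-- Envelope argument: if η is a maximizer at y, then F_∘(y) - F_∘(x) lies between ⟨ξ, y - x⟩ and
⟨η, y - x⟩, and `exists_maximizer_modulus` forces η → ξ as y → x. -/
theorem hasGradientAt_polar_of_maximizer (hF : IsStronglyConvexFinsler F) {x ξ : E n} (hx : x ≠ 0)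
    (hξ : F ξ ≤ 1) (hξx : inner ℝ ξ x = polar F x) : HasGradientAt (polar F) ξ x := by
  obtain ⟨K, hK, hmod⟩ := hF.exists_maximizer_modulus
  have hp := hF.polar_pos hx
  rw [hasGradientAt_iff_isLittleO, Asymptotics.isLittleO_iff]
  intro δ hδ
  have hnhds : ∀ᶠ y in 𝓝 x, K * ‖y - x‖ < polar F x * δ ^ 2 := by
    have hc : Continuous fun y : E n => K * ‖y - x‖ := by fun_prop
    refine hc.continuousAt.eventually_lt continuousAt_const ?_
    simp only [sub_self, norm_zero, mul_zero]
    positivity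
  filter_upwards [hnhds] with y hy
  obtain ⟨η, hη, hηy, -⟩ := hF.exists_maximizer y
  have h1 := hmod x y ξ η hξ hη hξx hηy
  have h2 : ‖η - ξ‖ ≤ δ := by
    refine le_of_sq_le_sq ?_ hδ.le
    exact le_of_mul_le_mul_left (h1.trans hy.le) hp
  have h3 : inner ℝ ξ y ≤ polar F y := hF.inner_le_polar hξ y
  have h4 : inner ℝ η x ≤ polar F x := hF.inner_le_polar hη x
  have h5 : inner ℝ (η - ξ) (y - x) ≤ δ * ‖y - x‖ := (real_inner_le_norm _ _).trans (by gcongr)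
  rw [inner_sub_left, inner_sub_right, inner_sub_right] at h5
  rw [Real.norm_eq_abs, abs_le, inner_sub_right]
  have : 0 ≤ δ * ‖y - x‖ := by positivity
  constructor <;> linarith

theorem gradient_polar_spec (hF : IsStronglyConvexFinsler F) {x : E n} (hx : x ≠ 0) :
    HasGradientAt (polar F) (gradient (polar F) x) x ∧ F (gradient (polar F) x) ≤ 1 ∧
      inner ℝ (gradient (polar F) x) x = polar F x := by
  obtain ⟨ξ, hξ, hξx, -⟩ := hF.exists_maximizer x
  have h := hF.hasGradientAt_polar_of_maximizer hx hξ hξx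
  rw [h.gradient]
  exact ⟨h, hξ, hξx⟩

theorem hasGradientAt_polar (hF : IsStronglyConvexFinsler F) {x : E n} (hx : x ≠ 0) :
    HasGradientAt (polar F) (gradient (polar F) x) x := (hF.gradient_polar_spec hx).1

theorem inner_gradient_polar (hF : IsStronglyConvexFinsler F) {x : E n} (hx : x ≠ 0) :
    inner ℝ (gradient (polar F) x) x = polar F x := (hF.gradient_polar_spec hx).2.2

theorem map_gradient_polar (hF : IsStronglyConvexFinsler F) {x : E n} (hx : x ≠ 0) :
    F (gradient (polar F) x) = 1 := by
  obtain ⟨-, h1, h2⟩ := hF.gradient_polar_spec hx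
  refine le_antisymm h1 ?_
  have := hF.inner_le_polar_mul (gradient (polar F) x) x
  rw [h2] at this
  have hp := hF.polar_pos hx
  exact le_of_mul_le_mul_left (by linarith) hp

/-- A maximizer at x is also one at x/|x|, so ∇F_∘ is 0-homogeneous and the unit sphere suffices. -/
theorem norm_gradient_polar_le (hF : IsStronglyConvexFinsler F) {x : E n} (hx : x ≠ 0) :
    ‖gradient (polar F) x‖ ≤ betaTilde F := by
  obtain ⟨C, hC, hb, -⟩ := hF.exists_polar_lipschitz
  have hx' : 0 < ‖x‖ := norm_pos_iff.2 hx
  set y := ‖x‖⁻¹ • x with hy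
  have hy1 : ‖y‖ = 1 := by simp [hy, norm_smul, hx'.ne']
  have hy0 : y ≠ 0 := by rw [← norm_ne_zero_iff, hy1]; exact one_ne_zero
  obtain ⟨-, a1, a2⟩ := hF.gradient_polar_spec hx
  have h1 : gradient (polar F) y = gradient (polar F) x := by
    refine (hF.hasGradientAt_polar_of_maximizer hy0 a1 ?_).gradient
    rw [hy, inner_smul_right, a2, hF.polar_smul (by positivity)]
  rw [← h1]
  refine le_csSup ⟨C, ?_⟩ ⟨y, by simpa using hy1, rfl⟩
  rintro _ ⟨z, hz, rfl⟩
  have hz0 : z ≠ 0 := ne_zero_of_mem_unit_sphere (⟨z, hz⟩ : Metric.sphere (0 : E n) 1)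
  exact hb _ (hF.gradient_polar_spec hz0).2.1

theorem betaTilde_nonneg (F : E n → ℝ) : 0 ≤ betaTilde F := by
  apply Real.sSup_nonneg
  rintro _ ⟨x, -, rfl⟩
  exact norm_nonneg _

end IsStronglyConvexFinsler

theorem IsStronglyConvexFinsler.polar_le_radius {n : ℕ} {F : E n → ℝ}
    (hF : IsStronglyConvexFinsler F) {Ω : Set (E n)} (hΩ : IsBoundedDomain Ω) {x : E n}
    (hx : x ∈ Ω) : polar F x ≤ radius F Ω := by
  obtain ⟨C, hC, h⟩ := hF.polar_le
  obtain ⟨M, hM⟩ := hΩ.isBounded.exists_norm_le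
  refine le_csSup ⟨C * M, ?_⟩ ⟨x, hx, rfl⟩
  rintro _ ⟨y, hy, rfl⟩
  exact (h y).trans (by gcongr; exact hM y hy)

theorem IsBoundedDomain.exists_ne_zero {n : ℕ} (hn : 2 ≤ n) {Ω : Set (E n)}
    (hΩ : IsBoundedDomain Ω) : ∃ x ∈ Ω, x ≠ 0 := by
  have : Nonempty (Fin n) := ⟨⟨0, by omega⟩⟩
  by_contra! h
  have hs : Ω ⊆ {0} := fun x hx => h x hx
  have h1 : volume Ω = 0 := measure_mono_null hs (measure_singleton _)
  exact (hΩ.isOpen.measure_pos volume hΩ.isConnected.nonempty).ne' h1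

theorem IsStronglyConvexFinsler.radius_pos {n : ℕ} {F : E n → ℝ} (hn : 2 ≤ n)
    (hF : IsStronglyConvexFinsler F) {Ω : Set (E n)} (hΩ : IsBoundedDomain Ω) :
    0 < radius F Ω := by
  obtain ⟨x, hx, hx0⟩ := hΩ.exists_ne_zero hn
  exact (hF.polar_pos hx0).trans_le (hF.polar_le_radius hΩ hx)

end FinslerLeray

namespace FinslerLeray

/-! ### The functions `X₁` and `X₂` -/

theorem X₁_zero : X₁ 0 = 0 := if_pos rfl

theorem X₁_of_ne_zero {t : ℝ} (ht : t ≠ 0) : X₁ t = (1 - Real.log t)⁻¹ := if_neg ht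

theorem X₁_pos {t : ℝ} (ht : 0 < t) (ht1 : t ≤ 1) : 0 < X₁ t := by
  rw [X₁_of_ne_zero ht.ne']
  have := Real.log_nonpos ht.le ht1
  exact inv_pos.2 (by linarith)

theorem X₁_nonneg {t : ℝ} (ht : 0 ≤ t) (ht1 : t ≤ 1) : 0 ≤ X₁ t := by
  rcases ht.eq_or_lt with rfl | h
  · exact X₁_zero.ge
  · exact (X₁_pos h ht1).le

theorem X₁_le_one {t : ℝ} (ht : 0 ≤ t) (ht1 : t ≤ 1) : X₁ t ≤ 1 := by
  rcases ht.eq_or_lt with rfl | h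
  · rw [X₁_zero]; exact zero_le_one
  · rw [X₁_of_ne_zero h.ne']
    have := Real.log_nonpos h.le ht1
    exact inv_le_one_of_one_le₀ (by linarith)

theorem X₂_pos {t : ℝ} (ht : 0 < t) (ht1 : t ≤ 1) : 0 < X₂ t :=
  X₁_pos (X₁_pos ht ht1) (X₁_le_one ht.le ht1)

theorem X₂_nonneg {t : ℝ} (ht : 0 ≤ t) (ht1 : t ≤ 1) : 0 ≤ X₂ t :=
  X₁_nonneg (X₁_nonneg ht ht1) (X₁_le_one ht ht1)

theorem X₂_le_one {t : ℝ} (ht : 0 ≤ t) (ht1 : t ≤ 1) : X₂ t ≤ 1 :=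
  X₁_le_one (X₁_nonneg ht ht1) (X₁_le_one ht ht1)

theorem hasDerivAt_X₁ {t : ℝ} (ht : 0 < t) (ht1 : t ≤ 1) : HasDerivAt X₁ (X₁ t ^ 2 / t) t := by
  have hl := Real.log_nonpos ht.le ht1
  have h1 : HasDerivAt (fun s => (1 - Real.log s)⁻¹) (-(-t⁻¹) / (1 - Real.log t) ^ 2) t :=
    ((Real.hasDerivAt_log ht.ne').const_sub 1).fun_inv (by linarith)
  have h2 : HasDerivAt X₁ (-(-t⁻¹) / (1 - Real.log t) ^ 2) t := by
    refine h1.congr_of_eventuallyEq ?_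
    filter_upwards [lt_mem_nhds ht] with s hs using X₁_of_ne_zero hs.ne'
  convert h2 using 1
  rw [X₁_of_ne_zero ht.ne', neg_neg, inv_pow]
  field_simp

theorem hasDerivAt_X₂ {t : ℝ} (ht : 0 < t) (ht1 : t ≤ 1) :
    HasDerivAt X₂ (X₂ t ^ 2 * X₁ t / t) t := by
  have hp := X₁_pos ht ht1
  have h := (hasDerivAt_X₁ hp (X₁_le_one ht.le ht1)).comp t (hasDerivAt_X₁ ht ht1)
  refine h.congr_deriv ?_
  rw [X₂]; field_simp

theorem continuousAt_X₁_zero : ContinuousAt X₁ 0 := by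
  have h1 : Tendsto (fun s => (1 - Real.log s)⁻¹) (𝓝[≠] 0) (𝓝 0) := by
    refine Tendsto.inv_tendsto_atTop ?_
    have := tendsto_neg_atBot_atTop.comp Real.tendsto_log_nhdsNE_zero
    exact (tendsto_atTop_add_const_left _ 1 this).congr fun s => by simp [sub_eq_add_neg]
  rw [continuousAt_iff_punctured_nhds, X₁_zero]
  refine h1.congr' ?_
  filter_upwards [self_mem_nhdsWithin] with s hs using (X₁_of_ne_zero hs).symm

theorem continuousAt_X₁ {t : ℝ} (ht : 0 ≤ t) (ht1 : t ≤ 1) : ContinuousAt X₁ t := by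
  rcases ht.eq_or_lt with rfl | h
  · exact continuousAt_X₁_zero
  · exact (hasDerivAt_X₁ h ht1).continuousAt

theorem continuousAt_X₂ {t : ℝ} (ht : 0 ≤ t) (ht1 : t ≤ 1) : ContinuousAt X₂ t :=
  (continuousAt_X₁ (X₁_nonneg ht ht1) (X₁_le_one ht ht1)).comp (continuousAt_X₁ ht ht1)

theorem measurable_X₁ : Measurable X₁ :=
  Measurable.ite (measurableSet_singleton 0) measurable_const
    (measurable_const.sub Real.measurable_log).inv

theorem measurable_X₂ : Measurable X₂ := measurable_X₁.comp measurable_X₁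

/-- Used to trade the factor |x| in x·∇u for one more power of X₁, which makes the flux integrable.
-/
theorem le_X₁ {t : ℝ} (ht : 0 < t) (ht1 : t ≤ 1) : t ≤ X₁ t := by
  rw [X₁_of_ne_zero ht.ne']
  have h1 := Real.log_le_sub_one_of_pos (inv_pos.2 ht)
  rw [Real.log_inv] at h1
  have h2 := Real.log_nonpos ht.le ht1
  rw [← one_div, le_div_iff₀ (by linarith)]
  calc t * (1 - Real.log t) ≤ t * t⁻¹ := by gcongr; linarith
    _ = 1 := mul_inv_cancel₀ ht.ne'

/-- `t ↦ X₁(t) / t` is nonincreasing on `(0, 1]`. -/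
theorem X₁_div_le {s t : ℝ} (hs : 0 < s) (hst : s ≤ t) (ht1 : t ≤ 1) : X₁ t / t ≤ X₁ s / s := by
  have ht : 0 < t := hs.trans_le hst
  have ls := Real.log_nonpos hs.le (hst.trans ht1)
  have lt := Real.log_nonpos ht.le ht1
  rw [X₁_of_ne_zero hs.ne', X₁_of_ne_zero ht.ne', inv_eq_one_div, inv_eq_one_div, div_div, div_div]
  -- What remains is that t(1 - log t) increases on (0, 1], obtained from log(t/s) ≤ t/s - 1.
  refine one_div_le_one_div_of_le (mul_pos (by linarith) hs) ?_
  have h1 := Real.log_le_sub_one_of_pos (div_pos ht hs)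
  rw [Real.log_div ht.ne' hs.ne'] at h1
  have h2 := mul_le_mul_of_nonneg_left h1 hs.le
  have h3 : s * (t / s - 1) = t - s := by field_simp
  rw [h3] at h2
  nlinarith [mul_nonneg (sub_nonneg.2 hst) (neg_nonneg.2 lt)]

/-! ### Polar coordinates -/

section Polar

variable {n : ℕ}

theorem integral_comp_polar [Nontrivial (E n)] (g : E n → ℝ) :
    ∫ x, g x = ∫ p : Metric.sphere (0 : E n) 1 × Set.Ioi (0 : ℝ), g (p.2.1 • p.1.1)
      ∂((volume : Measure (E n)).toSphere.prod (Measure.volumeIoiPow (n - 1))) := by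
  have h := (volume : Measure (E n)).measurePreserving_homeomorphUnitSphereProd.integral_comp
    (Homeomorph.measurableEmbedding _)
    (fun p : Metric.sphere (0 : E n) 1 × Set.Ioi (0 : ℝ) => g (p.2.1 • p.1.1))
  rw [finrank_euclideanSpace_fin] at h
  rw [← h]
  have h2 : ∀ x : ({0}ᶜ : Set (E n)), g ((homeomorphUnitSphereProd (E n) x).2.1 •
      (homeomorphUnitSphereProd (E n) x).1.1) = g x := by
    intro x
    have hx : ‖(x : E n)‖ ≠ 0 := norm_ne_zero_iff.2 x.2
    simp [smul_smul, hx]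
  simp_rw [h2]
  rw [integral_subtype_comap (measurableSet_singleton _).compl g, restrict_compl_singleton]

theorem lintegral_comp_polar [Nontrivial (E n)] (g : E n → ENNReal) :
    ∫⁻ x, g x = ∫⁻ p : Metric.sphere (0 : E n) 1 × Set.Ioi (0 : ℝ), g (p.2.1 • p.1.1)
      ∂((volume : Measure (E n)).toSphere.prod (Measure.volumeIoiPow (n - 1))) := by
  have h := (volume : Measure (E n)).measurePreserving_homeomorphUnitSphereProd.lintegral_comp_emb
    (Homeomorph.measurableEmbedding _)
    (fun p : Metric.sphere (0 : E n) 1 × Set.Ioi (0 : ℝ) => g (p.2.1 • p.1.1))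
  rw [finrank_euclideanSpace_fin] at h
  rw [← h]
  have h2 : ∀ x : ({0}ᶜ : Set (E n)), g ((homeomorphUnitSphereProd (E n) x).2.1 •
      (homeomorphUnitSphereProd (E n) x).1.1) = g x := by
    intro x
    have hx : ‖(x : E n)‖ ≠ 0 := norm_ne_zero_iff.2 x.2
    simp [smul_smul, hx]
  simp_rw [h2]
  rw [lintegral_subtype_comap (measurableSet_singleton _).compl g, restrict_compl_singleton]

theorem lintegral_volumeIoiPow (k : ℕ) {g : ℝ → ENNReal} (hg : Measurable g) :
    ∫⁻ r, g r.1 ∂(Measure.volumeIoiPow k) =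
      ∫⁻ r in Set.Ioi (0 : ℝ), ENNReal.ofReal (r ^ k) * g r := by
  have h := lintegral_withDensity_eq_lintegral_mul
    (Measure.comap (Subtype.val : Set.Ioi (0 : ℝ) → ℝ) volume)
    (f := fun r => ENNReal.ofReal (r.1 ^ k)) (by fun_prop) (g := fun r => g r.1) (by fun_prop)
  rw [Measure.volumeIoiPow, h]
  exact lintegral_subtype_comap measurableSet_Ioi fun a => ENNReal.ofReal (a ^ k) * g a

theorem integral_volumeIoiPow (k : ℕ) (g : ℝ → ℝ) :
    ∫ r, g r.1 ∂(Measure.volumeIoiPow k) = ∫ r in Set.Ioi (0 : ℝ), r ^ k * g r := by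
  simp only [Measure.volumeIoiPow, ENNReal.ofReal]
  rw [integral_withDensity_eq_integral_smul
    ((measurable_subtype_coe.pow_const _).real_toNNReal),
    integral_subtype_comap measurableSet_Ioi fun a ↦ Real.toNNReal (a ^ k) • g a]
  refine setIntegral_congr_fun measurableSet_Ioi fun x hx ↦ ?_
  simp only [NNReal.smul_def, Real.coe_toNNReal _ (pow_nonneg (Set.mem_Ioi.1 hx).le _), smul_eq_mul]

theorem lintegral_eq_polar [Nontrivial (E n)] {g : E n → ENNReal} (hg : Measurable g) :
    ∫⁻ x, g x = ∫⁻ ω : Metric.sphere (0 : E n) 1, ∫⁻ r in Set.Ioi (0 : ℝ),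
      ENNReal.ofReal (r ^ (n - 1)) * g (r • ω.1) ∂volume
      ∂((volume : Measure (E n)).toSphere) := by
  rw [lintegral_comp_polar, lintegral_prod]
  · refine lintegral_congr fun ω => ?_
    exact lintegral_volumeIoiPow (n - 1) (g := fun r => g (r • ω.1)) (by fun_prop)
  · exact Measurable.aemeasurable (by fun_prop)

/-- The radial derivative of a function vanishing at the origin integrates to zero against the
scale invariant weight `F_∘⁻ⁿ`. -/
theorem IsStronglyConvexFinsler.integral_radialDeriv_eq_zero {F : E n → ℝ} (hn : 2 ≤ n)
    (hF : IsStronglyConvexFinsler F) {f D : E n → ℝ} (hcont : ContinuousAt f 0)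
    (hcs : HasCompactSupport f) (h0 : f 0 = 0)
    (hD : ∀ x, x ≠ 0 → HasDerivAt (fun r : ℝ => f (r • x)) (D x) 1) :
    ∫ x, D x / polar F x ^ n = 0 := by
  have : Nonempty (Fin n) := ⟨⟨0, by omega⟩⟩
  have : Nontrivial (E n) := inferInstance
  rw [integral_comp_polar]
  -- A non-integrable integrand has integral 0 by convention, so integrability is not assumed; the
  -- same remark applies on each ray below.
  by_cases hint : Integrable (fun p : Metric.sphere (0 : E n) 1 × Set.Ioi (0 : ℝ) =>
      D (p.2.1 • p.1.1) / polar F (p.2.1 • p.1.1) ^ n)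
      ((volume : Measure (E n)).toSphere.prod (Measure.volumeIoiPow (n - 1)))
  swap
  · exact integral_undef hint
  rw [integral_prod _ hint]
  refine integral_eq_zero_of_ae (Eventually.of_forall fun ω => ?_)
  have hω : (ω : E n) ≠ 0 := ne_zero_of_mem_unit_sphere ω
  have hω1 : ‖(ω : E n)‖ = 1 := norm_eq_of_mem_sphere ω
  simp only [Pi.zero_apply]
  rw [integral_volumeIoiPow (n - 1) fun r => D (r • ω.1) / polar F (r • ω.1) ^ n]
  -- The Jacobian r^{n-1} against F_∘(rω)⁻ⁿ = r⁻ⁿF_∘(ω)⁻ⁿ leaves D(rω)/r, which is exactly d/dr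
  -- f(rω). The ray integral is then f at infinity minus f(0), both zero.
  have hinner : ∀ r ∈ Set.Ioi (0 : ℝ), r ^ (n - 1) * (D (r • ω.1) / polar F (r • ω.1) ^ n) =
      (polar F ω.1 ^ n)⁻¹ * (D (r • ω.1) / r) := by
    intro r hr
    have hr0 : (0 : ℝ) < r := hr
    have hp := hF.polar_pos hω
    rw [hF.polar_smul hr0.le, mul_pow]
    obtain ⟨k, rfl⟩ : ∃ k, n = k + 1 := ⟨n - 1, by omega⟩
    rw [Nat.add_sub_cancel]
    field_simp
    ring
  rw [setIntegral_congr_fun measurableSet_Ioi hinner, integral_const_mul]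
  by_cases hi : IntegrableOn (fun r : ℝ => D (r • ω.1) / r) (Set.Ioi 0)
  swap
  · rw [integral_undef hi, mul_zero]
  have hderiv : ∀ r ∈ Set.Ioi (0 : ℝ), HasDerivAt (fun s : ℝ => f (s • ω.1)) (D (r • ω.1) / r) r := by
    intro r hr
    have hr0 : (0 : ℝ) < r := hr
    have h1 := hD (r • ω.1) (smul_ne_zero hr0.ne' hω)
    have h2 : HasDerivAt (fun s : ℝ => s / r) (1 / r) r := (hasDerivAt_id r).div_const r
    have h3 := HasDerivAt.comp r (h₂ := fun r_1 : ℝ => f (r_1 • r • ω.1)) (h := fun s => s / r)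
      (h₂' := D (r • ω.1)) (by simpa [div_self hr0.ne'] using h1) h2
    have h4 : (fun s : ℝ => f (s • ω.1)) = (fun r_1 : ℝ => f (r_1 • r • ω.1)) ∘ fun s => s / r := by
      ext s
      simp only [Function.comp, smul_smul, div_mul_cancel₀ _ hr0.ne']
    rw [h4, div_eq_mul_one_div]
    exact h3
  have hlim : Tendsto (fun s : ℝ => f (s • ω.1)) atTop (𝓝 0) := by
    obtain ⟨M, hM⟩ := hcs.isCompact.isBounded.exists_norm_le
    refine tendsto_const_nhds.congr' ?_
    filter_upwards [eventually_gt_atTop (max M 0)] with s hs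
    have : s • ω.1 ∉ tsupport f := fun h => by
      have := hM _ h
      rw [norm_smul, hω1, mul_one, Real.norm_eq_abs] at this
      have h1 := le_max_left M 0
      have h2 := le_abs_self s
      linarith
    exact (image_eq_zero_of_notMem_tsupport this).symm
  have hc0 : ContinuousWithinAt (fun s : ℝ => f (s • ω.1)) (Set.Ici 0) 0 := by
    refine ContinuousAt.continuousWithinAt ?_
    refine ContinuousAt.comp (g := f) (f := fun s : ℝ => s • ω.1) ?_ (by fun_prop)
    rwa [zero_smul]
  rw [integral_Ioi_of_hasDerivAt_of_tendsto hc0 hderiv hi hlim, zero_smul, h0, sub_zero, mul_zero]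

end Polar

/-! ### The Leray weight -/

section Weight

variable {n : ℕ} {F : E n → ℝ} {Ω : Set (E n)}

/-- The Leray weight `X₁(F_∘ / R_Ω) / F_∘`. -/
noncomputable def lerayWeight (F : E n → ℝ) (Ω : Set (E n)) (x : E n) : ℝ :=
  X₁ (polar F x / radius F Ω) / polar F x

theorem lerayTerm_eq (u : E n → ℝ) (x : E n) :
    lerayTerm F Ω u x = (|u x| * lerayWeight F Ω x) ^ n := by
  rw [lerayTerm, lerayWeight, mul_pow, div_pow]; ring

theorem measurable_lerayWeight (hF : IsStronglyConvexFinsler F) :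
    Measurable (lerayWeight F Ω) :=
  (measurable_X₁.comp (hF.continuous_polar.measurable.div_const _)).div
    hF.continuous_polar.measurable

theorem ratio_mem (hn : 2 ≤ n) (hF : IsStronglyConvexFinsler F) (hΩ : IsBoundedDomain Ω) {x : E n}
    (hx : x ∈ Ω) : 0 ≤ polar F x / radius F Ω ∧ polar F x / radius F Ω ≤ 1 :=
  ⟨div_nonneg (hF.polar_nonneg x) (hF.radius_pos hn hΩ).le,
    (div_le_one (hF.radius_pos hn hΩ)).2 (hF.polar_le_radius hΩ hx)⟩

theorem ratio_pos (hn : 2 ≤ n) (hF : IsStronglyConvexFinsler F) (hΩ : IsBoundedDomain Ω) {x : E n}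
    (hx : x ≠ 0) : 0 < polar F x / radius F Ω :=
  div_pos (hF.polar_pos hx) (hF.radius_pos hn hΩ)

theorem lerayWeight_nonneg (hn : 2 ≤ n) (hF : IsStronglyConvexFinsler F) (hΩ : IsBoundedDomain Ω)
    {x : E n} (hx : x ∈ Ω) : 0 ≤ lerayWeight F Ω x :=
  div_nonneg (X₁_nonneg (ratio_mem hn hF hΩ hx).1 (ratio_mem hn hF hΩ hx).2) (hF.polar_nonneg x)

theorem integrableOn_X₁_radial (hn : 2 ≤ n) {c R : ℝ} (hc : 0 < c) (hR : 0 < R) :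
    IntegrableOn (fun x : E n => (X₁ (c * ‖x‖ / R) / (c * ‖x‖)) ^ n) (Metric.ball 0 (R / c)) := by
  have : Nonempty (Fin n) := ⟨⟨0, by omega⟩⟩
  have : Nontrivial (E n) := inferInstance
  rw [integrableOn_fun_norm_addHaar volume (f := fun y : ℝ => (X₁ (c * y / R) / (c * y)) ^ n),
    finrank_euclideanSpace_fin]
  obtain ⟨k, rfl⟩ : ∃ k, n = k + 2 := ⟨n - 2, by omega⟩
  refine IntegrableOn.mono_set (t := Set.Ioc 0 (R / c)) ?_ Set.Ioo_subset_Ioc_self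
  have hle : ∀ y, y ≤ R / c → c * y / R ≤ 1 := by
    intro y hy
    rw [le_div_iff₀ hc] at hy
    rw [div_le_one hR]; linarith
  -- In polar coordinates the integrand is a multiple of X₁ⁿ/r. Since r X₁' = X₁², it has the
  -- bounded antiderivative X₁^{n-1}/(n-1), up to that multiple.
  refine intervalIntegral.integrableOn_deriv_of_nonneg
    (g := fun y => (c ^ (k + 2))⁻¹ * X₁ (c * y / R) ^ (k + 1) / (k + 1)) ?_ ?_ ?_
  · intro y hy
    have h1 : ContinuousAt (fun y => X₁ (c * y / R)) y :=
      (continuousAt_X₁ (t := c * y / R) (by have := hy.1; positivity) (hle y hy.2)).comp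
        (f := fun y => c * y / R) (by fun_prop)
    exact ((continuousAt_const.mul (h1.pow _)).div_const _).continuousWithinAt
  · intro y hy
    have hy0 : 0 < y := hy.1
    have h1 := (hasDerivAt_X₁ (t := c * y / R) (by positivity) (hle y hy.2.le)).comp y
      (h := fun y => c * y / R) (((hasDerivAt_id y).const_mul c).div_const R)
    have h2 := ((h1.pow (k + 1)).const_mul (c ^ (k + 2))⁻¹).div_const ((k : ℝ) + 1)
    refine h2.congr_deriv ?_
    simp only [Function.comp, smul_eq_mul, mul_one, Nat.add_sub_cancel, Nat.add_succ_sub_one,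
      div_pow, mul_pow]
    push_cast
    field_simp
    ring
  · intro y hy
    have hy0 : 0 < y := hy.1
    have := X₁_nonneg (t := c * y / R) (by positivity) (hle y hy.2.le)
    simp only [smul_eq_mul]
    positivity

theorem integrableOn_lerayWeight_pow (hn : 2 ≤ n) (hF : IsStronglyConvexFinsler F)
    (hΩ : IsBoundedDomain Ω) : IntegrableOn (fun x => lerayWeight F Ω x ^ n) Ω := by
  obtain ⟨c, hc, hlow⟩ := hF.exists_polar_lower
  have hR := hF.radius_pos hn hΩ
  -- Halving c puts Ω strictly inside the open ball while still bounding F_∘ from below; `X₁_div_le`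
  -- then compares the two weights.
  have h1 := integrableOn_X₁_radial hn (half_pos hc) hR
  have hsub : Ω ⊆ Metric.ball 0 (radius F Ω / (c / 2)) := by
    intro x hx
    rw [mem_ball_zero_iff, lt_div_iff₀ (by positivity)]
    have a1 := hlow x
    have a2 := hF.polar_le_radius hΩ hx
    nlinarith [norm_nonneg x]
  refine Integrable.mono' (h1.mono_set hsub)
    ((measurable_lerayWeight hF).pow_const n).aestronglyMeasurable ?_
  filter_upwards [ae_restrict_mem hΩ.isOpen.measurableSet] with x hx
  rw [Real.norm_of_nonneg (pow_nonneg (lerayWeight_nonneg hn hF hΩ hx) n)]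
  refine pow_le_pow_left₀ (lerayWeight_nonneg hn hF hΩ hx) ?_ n
  -- At the origin both weights are 0, division by zero being 0.
  rcases eq_or_ne x 0 with rfl | hx0
  · simp [lerayWeight, hF.polar_zero]
  have hx' : 0 < ‖x‖ := norm_pos_iff.2 hx0
  have hp := hF.polar_pos hx0
  have h2 := X₁_div_le (s := c / 2 * ‖x‖ / radius F Ω) (t := polar F x / radius F Ω)
    (by positivity) (by gcongr; nlinarith [hlow x]) (ratio_mem hn hF hΩ hx).2
  have h3 := div_le_div_of_nonneg_right h2 hR.le
  rw [div_div, div_div, div_mul_cancel₀ _ hR.ne', div_mul_cancel₀ _ hR.ne'] at h3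
  exact h3

end Weight

end FinslerLeray

namespace FinslerLeray

/-! ### Calculus with gradients -/

section Gradient

variable {n : ℕ} {f g : E n → ℝ} {a b x : E n}

theorem _root_.HasDerivAt.comp_hasGradientAt {φ : ℝ → ℝ} {d : ℝ} (hφ : HasDerivAt φ d (f x))
    (hf : HasGradientAt f a x) : HasGradientAt (fun y => φ (f y)) (d • a) x := by
  rw [hasGradientAt_iff_hasFDerivAt] at hf ⊢
  rw [_root_.map_smul]
  exact hφ.comp_hasFDerivAt x hf

theorem _root_.HasGradientAt.mul' (hf : HasGradientAt f a x) (hg : HasGradientAt g b x) :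
    HasGradientAt (fun y => f y * g y) (f x • b + g x • a) x := by
  rw [hasGradientAt_iff_hasFDerivAt] at hf hg ⊢
  rw [map_add, _root_.map_smul, _root_.map_smul]
  exact hf.mul hg

theorem _root_.HasGradientAt.hasDerivAt_line (hf : HasGradientAt f a x) :
    HasDerivAt (fun r : ℝ => f (r • x)) (inner ℝ a x) 1 := by
  rw [hasGradientAt_iff_hasFDerivAt] at hf
  have h1 : HasDerivAt (fun r : ℝ => r • x) x 1 := by
    simpa using (hasDerivAt_id (1 : ℝ)).smul_const x
  have h2 : HasFDerivAt f (InnerProductSpace.toDual ℝ (E n) a) ((1 : ℝ) • x) := by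
    rwa [one_smul]
  exact h2.comp_hasDerivAt (1 : ℝ) h1

theorem hasDerivAt_abs_pow (k : ℕ) (s : ℝ) :
    HasDerivAt (fun s : ℝ => |s| ^ (k + 2)) ((k + 2) * (|s| ^ k * s)) s := by
  have h := hasDerivAt_abs_rpow s (p := k + 2) (by linarith [k.cast_nonneg (α := ℝ)])
  have e1 : (fun x : ℝ => |x| ^ ((k : ℝ) + 2)) = fun s => |s| ^ (k + 2) := by
    ext s; rw [← Real.rpow_natCast]; norm_num
  rw [e1, add_sub_cancel_right, Real.rpow_natCast] at h
  exact h.congr_deriv (by ring)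

theorem measurable_gradient (f : E n → ℝ) : Measurable (gradient f) :=
  ((InnerProductSpace.toDual ℝ (E n)).symm.continuous.measurable).comp (measurable_fderiv ℝ f)

theorem IsTest.continuous_gradient {m : WithTop ℕ∞} {Ω : Set (E n)} (hf : IsTest m Ω f)
    (hm : 1 ≤ m) : Continuous (gradient f) :=
  (InnerProductSpace.toDual ℝ (E n)).symm.continuous.comp
    (hf.contDiff.continuous_fderiv (by positivity))

theorem IsTest.hasGradientAt {m : WithTop ℕ∞} {Ω : Set (E n)} (hf : IsTest m Ω f)
    (hm : 1 ≤ m) (x : E n) : HasGradientAt f (gradient f x) x :=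
  (hf.contDiff.differentiable (by positivity) x).hasGradientAt

theorem gradient_eq_zero_of_notMem_tsupport (hx : x ∉ tsupport f) : gradient f x = 0 := by
  have : f =ᶠ[𝓝 x] fun _ => 0 := notMem_tsupport_iff_eventuallyEq.1 hx
  rw [this.gradient_eq, gradient_fun_const]

theorem IsTest.hasCompactSupport_gradient {m : WithTop ℕ∞} {Ω : Set (E n)} (hf : IsTest m Ω f) :
    HasCompactSupport (gradient f) :=
  HasCompactSupport.intro hf.hasCompactSupport fun _ hx => gradient_eq_zero_of_notMem_tsupport hx

theorem IsTest.mono {m m' : WithTop ℕ∞} {Ω : Set (E n)} (hf : IsTest m Ω f) (h : m' ≤ m) :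
    IsTest m' Ω f := ⟨hf.contDiff.of_le h, hf.hasCompactSupport, hf.tsupport_subset⟩

end Gradient

/-! ### Pointwise inequalities -/

theorem pow_tangent {a b : ℝ} (ha : 0 ≤ a) (hb : 0 ≤ b) (k : ℕ) :
    (k + 2) * a ^ (k + 1) * b - (k + 1) * a ^ (k + 2) ≤ b ^ (k + 2) := by
  rcases ha.eq_or_lt with rfl | ha
  · rw [zero_pow (by omega), zero_pow (by omega)]
    have := pow_nonneg hb (k + 2)
    linarith
  · have h := one_add_mul_le_pow (a := b / a - 1) (by have := div_nonneg hb ha.le; linarith) (k + 2)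
    have h' := mul_le_mul_of_nonneg_left h (pow_nonneg ha.le (k + 2))
    rw [add_sub_cancel, div_pow, mul_div_cancel₀ _ (by positivity)] at h'
    have : a ^ (k + 2) * (1 + ((k + 2 : ℕ) : ℝ) * (b / a - 1)) =
      (k + 2) * a ^ (k + 1) * b - (k + 1) * a ^ (k + 2) := by
      push_cast; field_simp; ring
    linarith

/-- Meant for P = F(∇u), h = F_∘, p = x·∇u, U = u. Then Pⁿ ≥ (|p|/h)ⁿ, and the n-th power is bounded
below by its tangent at κ|U|, which makes the bound linear in p. -/
theorem radial_young {P h p U κ : ℝ} (hh : 0 < h) (hκ : 0 ≤ κ) (hp : |p| ≤ h * P)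
    (k : ℕ) :
    -((k + 2) * κ ^ (k + 1) * (|U| ^ k * U) * p + (k + 1) * κ ^ (k + 2) * |U| ^ (k + 2)) /
      h ^ (k + 2) ≤ P ^ (k + 2) := by
  rw [div_le_iff₀ (by positivity), ← mul_pow]
  have h1 := pow_tangent (a := κ * |U|) (b := |p|) (by positivity) (abs_nonneg p) k
  have h2 : |p| ^ (k + 2) ≤ (P * h) ^ (k + 2) := pow_le_pow_left₀ (abs_nonneg p) (by linarith) _
  have h3 : -(|U| ^ k * U * p) ≤ |U| ^ (k + 1) * |p| := by
    refine (neg_le_abs _).trans ?_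
    rw [abs_mul, abs_mul, abs_pow, abs_abs, pow_succ]
  have h4 := mul_le_mul_of_nonneg_left h3 (show 0 ≤ ((k : ℝ) + 2) * κ ^ (k + 1) by positivity)
  rw [mul_pow, mul_pow] at h1
  nlinarith

/-- The right side is (n-1)κ^{n-2} r∂_rκ - (n-1)κⁿ for κ = cX(1 + θτ) and n = k + 2, by the rules
r∂_rX = X² and r∂_rτ = Xτ². It is what remains of the flux and Young terms once x·∇u has cancelled.
-/
theorem improved_hardy_algebra {X τ : ℝ} (hX : 0 ≤ X) (hτ : 0 ≤ τ) (hτ1 : τ ≤ 1) (k : ℕ)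
    {c θ : ℝ} (hc : c = (k + 1) / (k + 2)) (hθ : θ = 1 / (k + 1)) :
    X ^ (k + 2) * (c ^ (k + 2) + c ^ k / (2 * (k + 2)) * τ ^ 2) ≤
      (k + 1) * (c * X * (1 + θ * τ)) ^ k * (c * X ^ 2 * (1 + θ * τ + θ * τ ^ 2)) -
        (k + 1) * (c * X * (1 + θ * τ)) ^ (k + 2) := by
  have hk : (0 : ℝ) ≤ k := k.cast_nonneg
  have hc0 : 0 < c := by rw [hc]; positivity
  have hθ0 : 0 < θ := by rw [hθ]; positivity
  set g := 1 + θ * τ with hg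
  have hg1 : 1 ≤ g := by rw [hg]; nlinarith [mul_nonneg hθ0.le hτ]
  -- The choice θ = 1/(k+1) makes Bernoulli give exactly 1 + τ. Multiplied by 1 - cg = (1 -
  -- τ)/(k+2), the terms linear in τ cancel.
  have hgk' : 1 + τ ≤ g ^ (k + 1) := by
    have := one_add_mul_le_pow (a := θ * τ) (by nlinarith [mul_nonneg hθ0.le hτ]) (k + 1)
    have e : ((k + 1 : ℕ) : ℝ) * (θ * τ) = τ := by rw [hθ]; push_cast; field_simp
    rwa [e] at this
  have hgk1 : 1 ≤ g ^ k := one_le_pow₀ hg1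
  have e1 : (k + 1) * (c * X * g) ^ k * (c * X ^ 2 * (g + θ * τ ^ 2)) -
        (k + 1) * (c * X * g) ^ (k + 2) =
      X ^ (k + 2) * c ^ k * ((k + 1) * c * (g ^ (k + 1) * (1 - c * g) + θ * τ ^ 2 * g ^ k)) := by
    rw [mul_pow, mul_pow, mul_pow, mul_pow]; ring
  have e2 : X ^ (k + 2) * (c ^ (k + 2) + c ^ k / (2 * (k + 2)) * τ ^ 2) =
      X ^ (k + 2) * c ^ k * (c ^ 2 + τ ^ 2 / (2 * (k + 2))) := by ring
  rw [e1, e2]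
  refine mul_le_mul_of_nonneg_left ?_ (by positivity)
  have e3 : 1 - c * g = (1 - τ) / (k + 2) := by
    rw [hg, hc, hθ]; field_simp; ring
  have h1 : (1 + τ) * ((1 - τ) / (k + 2)) ≤ g ^ (k + 1) * (1 - c * g) := by
    rw [e3]
    exact mul_le_mul_of_nonneg_right hgk' (div_nonneg (by linarith) (by positivity))
  have h2 : θ * τ ^ 2 * 1 ≤ θ * τ ^ 2 * g ^ k := mul_le_mul_of_nonneg_left hgk1 (by positivity)
  calc c ^ 2 + τ ^ 2 / (2 * (k + 2)) ≤
        (k + 1) * c * ((1 + τ) * ((1 - τ) / (k + 2)) + θ * τ ^ 2 * 1) := by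
        have : (k + 1) * c * ((1 + τ) * ((1 - τ) / (k + 2)) + θ * τ ^ 2 * 1) =
          c ^ 2 + τ ^ 2 * ((k + 1) / (k + 2) ^ 2) := by
          rw [hc, hθ]; field_simp; ring
        rw [this, div_eq_mul_one_div]
        refine add_le_add_right (mul_le_mul_of_nonneg_left ?_ (sq_nonneg τ)) _
        rw [div_le_div_iff₀ (by positivity) (by positivity)]
        nlinarith
    _ ≤ _ := by gcongr

/-! ### The radial flux -/

section Flux

variable {n : ℕ} {F : E n → ℝ} {Ω : Set (E n)} {u : E n → ℝ} {x : E n}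

theorem ae_restrict_ne_zero (hn : 2 ≤ n) (Ω : Set (E n)) : ∀ᵐ x ∂(volume.restrict Ω), x ≠ 0 := by
  have : Nonempty (Fin n) := ⟨⟨0, by omega⟩⟩
  exact ae_restrict_of_ae (Measure.ae_ne volume 0)

theorem hasGradientAt_X₁_comp (hn : 2 ≤ n) (hF : IsStronglyConvexFinsler F)
    (hΩ : IsBoundedDomain Ω) (hx : x ∈ Ω) (hx0 : x ≠ 0) :
    HasGradientAt (fun y => X₁ (polar F y / radius F Ω))
      ((X₁ (polar F x / radius F Ω) ^ 2 / polar F x) • gradient (polar F) x) x := by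
  have hR := hF.radius_pos hn hΩ
  have h1 := (hasDerivAt_X₁ (ratio_pos hn hF hΩ hx0) (ratio_mem hn hF hΩ hx).2).comp (polar F x)
    (h := fun s => s / radius F Ω) ((hasDerivAt_id _).div_const _)
  refine (h1.congr_deriv ?_).comp_hasGradientAt (hF.hasGradientAt_polar hx0)
  field_simp

theorem hasGradientAt_X₂_comp (hn : 2 ≤ n) (hF : IsStronglyConvexFinsler F)
    (hΩ : IsBoundedDomain Ω) (hx : x ∈ Ω) (hx0 : x ≠ 0) :
    HasGradientAt (fun y => X₂ (polar F y / radius F Ω))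
      ((X₂ (polar F x / radius F Ω) ^ 2 * X₁ (polar F x / radius F Ω) / polar F x) •
        gradient (polar F) x) x := by
  have hR := hF.radius_pos hn hΩ
  have h1 := (hasDerivAt_X₂ (ratio_pos hn hF hΩ hx0) (ratio_mem hn hF hΩ hx).2).comp (polar F x)
    (h := fun s => s / radius F Ω) ((hasDerivAt_id _).div_const _)
  refine (h1.congr_deriv ?_).comp_hasGradientAt (hF.hasGradientAt_polar hx0)
  field_simp

/-- `κ = c X₁ (1 + θ X₂)` at `F_∘ / R_Ω`. -/
noncomputable def fluxCoeff (F : E n → ℝ) (Ω : Set (E n)) (c θ : ℝ) (x : E n) : ℝ :=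
  c * X₁ (polar F x / radius F Ω) * (1 + θ * X₂ (polar F x / radius F Ω))

/-- The radial derivative of `κ^{k+1} |u|^{k+2}`. -/
noncomputable def fluxDeriv (F : E n → ℝ) (Ω : Set (E n)) (c θ : ℝ) (k : ℕ) (u : E n → ℝ)
    (x : E n) : ℝ :=
  (k + 1) * fluxCoeff F Ω c θ x ^ k * (c * X₁ (polar F x / radius F Ω) ^ 2 *
      (1 + θ * X₂ (polar F x / radius F Ω) + θ * X₂ (polar F x / radius F Ω) ^ 2)) *
      |u x| ^ (k + 2) +
    (k + 2) * fluxCoeff F Ω c θ x ^ (k + 1) * (|u x| ^ k * u x) * inner ℝ (gradient u x) x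

/-- The derivative formulas for X₁ and X₂ need F_∘ ≤ R_Ω. This holds on the support of u, and off
the support the flux vanishes near x. -/
theorem hasDerivAt_flux (hn : 2 ≤ n) (hF : IsStronglyConvexFinsler F)
    (hΩ : IsBoundedDomain Ω) (hu : IsTest 1 Ω u) (hx0 : x ≠ 0) (c θ : ℝ) (k : ℕ) :
    HasDerivAt (fun r : ℝ => fluxCoeff F Ω c θ (r • x) ^ (k + 1) * |u (r • x)| ^ (k + 2))
      (fluxDeriv F Ω c θ k u x) 1 := by
  by_cases hx : x ∈ tsupport u
  · have hxΩ := hu.tsupport_subset hx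
    have hH := hF.polar_pos hx0
    have h1 := hasGradientAt_X₁_comp hn hF hΩ hxΩ hx0
    have h2 := hasGradientAt_X₂_comp hn hF hΩ hxΩ hx0
    set Ξ := gradient (polar F) x
    have h3 := HasDerivAt.comp_hasGradientAt (φ := fun s => 1 + θ * s)
      (((hasDerivAt_id _).const_mul θ).const_add 1) h2
    have h4 := HasDerivAt.comp_hasGradientAt (φ := fun s => c * s)
      ((hasDerivAt_id _).const_mul c) h1
    have h5 : HasGradientAt (fluxCoeff F Ω c θ) _ x := h4.mul' h3
    have h6 := HasDerivAt.comp_hasGradientAt (hasDerivAt_pow (k + 1) _) h5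
    have h7 := HasDerivAt.comp_hasGradientAt (hasDerivAt_abs_pow k _)
      (hu.hasGradientAt le_rfl x)
    refine (h6.mul' h7).hasDerivAt_line.congr_deriv ?_
    have e : inner ℝ Ξ x = polar F x := hF.inner_gradient_polar hx0
    simp only [inner_add_left, inner_smul_left, RCLike.conj_to_real, e, fluxDeriv]
    rw [Nat.add_sub_cancel]
    push_cast
    field_simp
    ring
  · have hz : u =ᶠ[𝓝 x] fun _ => 0 := notMem_tsupport_iff_eventuallyEq.1 hx
    have hd : fluxDeriv F Ω c θ k u x = 0 := by
      simp [fluxDeriv, image_eq_zero_of_notMem_tsupport hx]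
    rw [hd]
    have hc : Tendsto (fun r : ℝ => r • x) (𝓝 1) (𝓝 x) := by
      have : Continuous fun r : ℝ => r • x := by fun_prop
      simpa using this.tendsto 1
    refine (hasDerivAt_const (1 : ℝ) (0 : ℝ)).congr_of_eventuallyEq ?_
    filter_upwards [hc.eventually hz] with r hr
    simp [hr]

theorem integral_fluxDeriv (hn : 2 ≤ n) (hF : IsStronglyConvexFinsler F)
    (hΩ : IsBoundedDomain Ω) (hu : IsTest 1 Ω u) (c θ : ℝ) (k : ℕ) :
    ∫ x in Ω, fluxDeriv F Ω c θ k u x / polar F x ^ n = 0 := by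
  rw [setIntegral_eq_integral_of_forall_compl_eq_zero]
  · refine hF.integral_radialDeriv_eq_zero hn
      (f := fun x => fluxCoeff F Ω c θ x ^ (k + 1) * |u x| ^ (k + 2)) ?_ ?_ ?_ fun x hx =>
      hasDerivAt_flux hn hF hΩ hu hx c θ k
    · have hu0 : ContinuousAt u 0 := hu.contDiff.continuous.continuousAt
      have hH : ContinuousAt (fun x => polar F x / radius F Ω) 0 :=
        (hF.continuous_polar.div_const _).continuousAt
      have e0 : polar F 0 / radius F Ω = 0 := by rw [hF.polar_zero, zero_div]
      have h1 : ContinuousAt (fun x => X₁ (polar F x / radius F Ω)) 0 :=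
        ContinuousAt.comp (g := X₁) (by rw [e0]; exact continuousAt_X₁_zero) hH
      have h2 : ContinuousAt (fun x => X₂ (polar F x / radius F Ω)) 0 :=
        ContinuousAt.comp (g := X₂)
          (by rw [e0]; exact continuousAt_X₂ le_rfl zero_le_one) hH
      exact (((continuousAt_const.mul h1).mul (continuousAt_const.add
        (continuousAt_const.mul h2))).pow _).mul (hu0.abs.pow _)
    · refine HasCompactSupport.intro hu.hasCompactSupport fun x hx => ?_
      simp [image_eq_zero_of_notMem_tsupport hx]
    · simp [fluxCoeff, hF.polar_zero, X₁_zero]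
  · intro x hx
    have : x ∉ tsupport u := fun h => hx (hu.tsupport_subset h)
    simp [fluxDeriv, image_eq_zero_of_notMem_tsupport this]

theorem measurable_fluxDeriv (hF : IsStronglyConvexFinsler F) (hu : IsTest 1 Ω u) (c θ : ℝ)
    (k : ℕ) : Measurable (fluxDeriv F Ω c θ k u) := by
  have h1 : Measurable fun x => X₁ (polar F x / radius F Ω) :=
    measurable_X₁.comp (hF.continuous_polar.measurable.div_const _)
  have h2 : Measurable fun x => X₂ (polar F x / radius F Ω) :=
    measurable_X₂.comp (hF.continuous_polar.measurable.div_const _)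
  have h3 : Measurable u := hu.contDiff.continuous.measurable
  have h4 : Measurable fun x => inner ℝ (gradient u x) x := (measurable_gradient u).inner measurable_id
  have h5 : Measurable (fluxCoeff F Ω c θ) := by unfold fluxCoeff; fun_prop
  have h6 : Measurable fun x => |u x| := measurable_abs.comp h3
  unfold fluxDeriv
  fun_prop

/-- Both terms are dominated by a multiple of X₁ⁿ/F_∘ⁿ: the first has n explicit powers of X₁, the
second n - 1, with one more from |x| ≲ F_∘ ≤ R_Ω X₁. -/
theorem integrableOn_fluxDeriv (hn : 2 ≤ n) (hF : IsStronglyConvexFinsler F)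
    (hΩ : IsBoundedDomain Ω) (hu : IsTest 1 Ω u) {c θ : ℝ} (hc : 0 ≤ c) (hθ : 0 ≤ θ) {k : ℕ}
    (hk : n = k + 2) :
    IntegrableOn (fun x => fluxDeriv F Ω c θ k u x / polar F x ^ n) Ω := by
  obtain ⟨M, hM⟩ := hu.contDiff.continuous.bounded_above_of_compact_support hu.hasCompactSupport
  obtain ⟨L, hL⟩ := (hu.continuous_gradient le_rfl).bounded_above_of_compact_support
    hu.hasCompactSupport_gradient
  obtain ⟨b, hb, hlow⟩ := hF.exists_polar_lower
  have hM0 : 0 ≤ M := (norm_nonneg _).trans (hM 0)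
  have hL0 : 0 ≤ L := (norm_nonneg _).trans (hL 0)
  have hR := hF.radius_pos hn hΩ
  set A := (k + 1) * (c * (1 + θ)) ^ k * (c * (1 + θ + θ)) * M ^ (k + 2)
  set B := (k + 2) * (c * (1 + θ)) ^ (k + 1) * (M ^ k * M) * (L * b⁻¹ * radius F Ω)
  refine Integrable.mono' ((integrableOn_lerayWeight_pow hn hF hΩ).const_mul (A + B))
    ((measurable_fluxDeriv hF hu c θ k).div
      (hF.continuous_polar.measurable.pow_const n)).aestronglyMeasurable ?_
  filter_upwards [ae_restrict_mem hΩ.isOpen.measurableSet, ae_restrict_ne_zero hn Ω]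
    with x hx hx0
  have hH := hF.polar_pos hx0
  have ht := ratio_pos hn hF hΩ hx0
  have ht1 := (ratio_mem hn hF hΩ hx).2
  have hX := X₁_pos ht ht1
  have hτ := X₂_pos ht ht1
  have hτ1 := X₂_le_one ht.le ht1
  have htX := le_X₁ ht ht1
  have hux : |u x| ≤ M := hM x
  rw [lerayWeight, div_pow, ← mul_div_assoc, norm_div, norm_pow, Real.norm_of_nonneg hH.le]
  gcongr
  rw [fluxDeriv, fluxCoeff]
  set X := X₁ (polar F x / radius F Ω)
  set τ := X₂ (polar F x / radius F Ω)
  have hHX : polar F x ≤ radius F Ω * X := by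
    rw [div_le_iff₀ hR] at htX; linarith
  have hin : |inner ℝ (gradient u x) x| ≤ L * b⁻¹ * radius F Ω * X := by
    calc |inner ℝ (gradient u x) x| ≤ ‖gradient u x‖ * ‖x‖ := abs_real_inner_le_norm _ _
      _ ≤ L * (b⁻¹ * polar F x) := by
        gcongr
        · exact hL x
        · rw [← div_eq_inv_mul, le_div_iff₀ hb]; linarith [hlow x]
      _ ≤ L * (b⁻¹ * (radius F Ω * X)) := by gcongr
      _ = _ := by ring
  have hκ : c * X * (1 + θ * τ) ≤ c * (1 + θ) * X := by
    have : θ * τ ≤ θ := mul_le_of_le_one_right hθ hτ1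
    calc c * X * (1 + θ * τ) ≤ c * X * (1 + θ) := by gcongr
      _ = _ := by ring
  have hκ0 : 0 ≤ c * X * (1 + θ * τ) := by positivity
  rw [Real.norm_eq_abs]
  refine (abs_add_le _ _).trans ?_
  rw [add_mul A B]
  refine add_le_add ?_ ?_
  · rw [abs_of_nonneg (by positivity)]
    calc _ ≤ (k + 1) * (c * (1 + θ) * X) ^ k * (c * X ^ 2 * (1 + θ * 1 + θ * 1 ^ 2)) * M ^ (k + 2) := by
          gcongr
      _ = _ := by simp only [A, hk, mul_pow]; ring
  · rw [abs_mul, abs_mul, abs_mul, abs_mul,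
      abs_of_nonneg (by positivity : (0 : ℝ) ≤ (k : ℝ) + 2), abs_of_nonneg (pow_nonneg hκ0 _),
      abs_of_nonneg (pow_nonneg (abs_nonneg (u x)) k)]
    calc _ ≤ (k + 2) * (c * (1 + θ) * X) ^ (k + 1) * (M ^ k * M) * (L * b⁻¹ * radius F Ω * X) := by
          gcongr
      _ = _ := by simp only [B, hk, mul_pow]; ring

end Flux

end FinslerLeray

/-! ### Leray inequalities and the link constant for test functions. -/

namespace FinslerLeray

section Test

variable {n : ℕ} {F : E n → ℝ} {Ω : Set (E n)} {u : E n → ℝ} {x : E n}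

theorem integrableOn_map_gradient_pow (hn : 2 ≤ n) (hF : IsStronglyConvexFinsler F)
    (hu : IsTest 1 Ω u) : IntegrableOn (fun x => F (gradient u x) ^ n) Ω := by
  have hc : Continuous fun x => F (gradient u x) ^ n :=
    (hF.continuous.comp (hu.continuous_gradient le_rfl)).pow n
  refine (hc.integrable_of_hasCompactSupport ?_).integrableOn
  refine HasCompactSupport.intro hu.hasCompactSupport fun x hx => ?_
  rw [gradient_eq_zero_of_notMem_tsupport hx, hF.map_zero, zero_pow (by omega)]

theorem integrableOn_bounded_mul_weight (hn : 2 ≤ n) (hF : IsStronglyConvexFinsler F)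
    (hΩ : IsBoundedDomain Ω) (hu : IsTest 1 Ω u) {b : E n → ℝ} (hb : Measurable b)
    (hb1 : ∀ x ∈ Ω, |b x| ≤ 1) :
    IntegrableOn (fun x => b x * (|u x| * lerayWeight F Ω x) ^ n) Ω := by
  obtain ⟨M, hM⟩ := hu.contDiff.continuous.bounded_above_of_compact_support hu.hasCompactSupport
  refine Integrable.mono' ((integrableOn_lerayWeight_pow hn hF hΩ).const_mul (M ^ n))
    (hb.mul (((measurable_abs.comp hu.contDiff.continuous.measurable).mul
      (measurable_lerayWeight hF)).pow_const n)).aestronglyMeasurable ?_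
  filter_upwards [ae_restrict_mem hΩ.isOpen.measurableSet] with x hx
  have hρ := lerayWeight_nonneg hn hF hΩ hx
  have hux : |u x| ≤ M := hM x
  rw [norm_mul, Real.norm_eq_abs, Real.norm_of_nonneg (by positivity), mul_pow]
  calc |b x| * (|u x| ^ n * lerayWeight F Ω x ^ n) ≤ 1 * (M ^ n * lerayWeight F Ω x ^ n) := by
        gcongr; exact hb1 x hx
    _ = _ := one_mul _

theorem integrableOn_lerayTerm_of_isTest (hn : 2 ≤ n) (hF : IsStronglyConvexFinsler F)
    (hΩ : IsBoundedDomain Ω) (hu : IsTest 1 Ω u) : IntegrableOn (lerayTerm F Ω u) Ω := by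
  have h := integrableOn_bounded_mul_weight hn hF hΩ hu (b := fun _ => 1) measurable_const
    (by simp)
  refine h.congr (Eventually.of_forall fun x => ?_)
  simp only [one_mul, lerayTerm_eq]

/-- The Leray inequality with a logarithmic remainder term. -/
theorem improved_leray (hn : 2 ≤ n) (hF : IsStronglyConvexFinsler F)
    (hΩ : IsBoundedDomain Ω) (hu : IsTest 1 Ω u) :
    ((((n : ℝ) - 1) / n) ^ (n - 2) / (2 * n)) *
      ∫ x in Ω, X₂ (polar F x / radius F Ω) ^ 2 * (|u x| * lerayWeight F Ω x) ^ n ≤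
    lerayDiff F Ω u (gradient u) := by
  obtain ⟨k, hk⟩ : ∃ k, n = k + 2 := ⟨n - 2, by omega⟩
  have hkn : (n : ℝ) = k + 2 := by rw [hk]; push_cast; ring
  set c : ℝ := ((n : ℝ) - 1) / n with hc
  have hc' : c = (k + 1) / (k + 2) := by rw [hc, hkn]; ring
  have hc0 : 0 ≤ c := by rw [hc']; positivity
  set θ : ℝ := 1 / (k + 1) with hθ
  have hθ0 : 0 ≤ θ := by positivity
  have hi1 := integrableOn_map_gradient_pow hn hF hu
  have hi2 := integrableOn_fluxDeriv hn hF hΩ hu hc0 hθ0 hk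
  have hi3 := integrableOn_lerayTerm_of_isTest hn hF hΩ hu
  have hi4 := integrableOn_bounded_mul_weight hn hF hΩ hu
    (b := fun x => X₂ (polar F x / radius F Ω) ^ 2)
    ((measurable_X₂.comp (hF.continuous_polar.measurable.div_const _)).pow_const 2) (by
      intro x hx
      have h0 := ratio_mem hn hF hΩ hx
      rw [abs_of_nonneg (sq_nonneg _)]
      exact pow_le_one₀ (X₂_nonneg h0.1 h0.2) (X₂_le_one h0.1 h0.2))
  -- The flux term on the right has integral zero, so a pointwise comparison is enough.
  have key : ∫ x in Ω, (c ^ n * lerayTerm F Ω u x + c ^ (n - 2) / (2 * n) *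
      (X₂ (polar F x / radius F Ω) ^ 2 * (|u x| * lerayWeight F Ω x) ^ n)) ≤
      ∫ x in Ω, (F (gradient u x) ^ n + fluxDeriv F Ω c θ k u x / polar F x ^ n) := by
    refine integral_mono_ae ((hi3.const_mul _).add (hi4.const_mul _)) (hi1.add hi2) ?_
    filter_upwards [ae_restrict_mem hΩ.isOpen.measurableSet, ae_restrict_ne_zero hn Ω]
      with x hx hx0
    have hH := hF.polar_pos hx0
    have ht := ratio_pos hn hF hΩ hx0
    have ht1 := (ratio_mem hn hF hΩ hx).2
    have hX := X₁_pos ht ht1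
    have hτ := X₂_pos ht ht1
    have hκ : 0 ≤ fluxCoeff F Ω c θ x := by unfold fluxCoeff; positivity
    have h1 := radial_young (P := F (gradient u x)) (p := inner ℝ (gradient u x) x) (U := u x)
      hH hκ (hF.abs_inner_le_polar_mul _ _) k
    have h2 := improved_hardy_algebra hX.le hτ.le (X₂_le_one ht.le ht1) k hc' hθ
    have h3 := mul_le_mul_of_nonneg_right h2
      (show 0 ≤ |u x| ^ (k + 2) / polar F x ^ (k + 2) by positivity)
    have e : k + 2 - 2 = k := by omega
    simp only [lerayTerm_eq, fluxDeriv, lerayWeight, hk, e]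
    unfold fluxCoeff at h1 ⊢
    set X := X₁ (polar F x / radius F Ω)
    set τ := X₂ (polar F x / radius F Ω)
    set p := inner ℝ (gradient u x) x
    set H := polar F x
    calc _ = X ^ (k + 2) * (c ^ (k + 2) + c ^ k / (2 * (k + 2)) * τ ^ 2) *
          (|u x| ^ (k + 2) / H ^ (k + 2)) := by rw [mul_pow, div_pow]; push_cast; ring
      _ ≤ _ := h3
      -- The terms containing p = x·∇u cancel between the Young bound and the flux derivative.
      _ = -((k + 2) * (c * X * (1 + θ * τ)) ^ (k + 1) * (|u x| ^ k * u x) * p +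
            (k + 1) * (c * X * (1 + θ * τ)) ^ (k + 2) * |u x| ^ (k + 2)) / H ^ (k + 2) +
          ((k + 1) * (c * X * (1 + θ * τ)) ^ k * (c * X ^ 2 * (1 + θ * τ + θ * τ ^ 2)) *
            |u x| ^ (k + 2) +
          (k + 2) * (c * X * (1 + θ * τ)) ^ (k + 1) * (|u x| ^ k * u x) * p) / H ^ (k + 2) := by
          ring
      _ ≤ _ := by gcongr
  rw [integral_add (hi3.const_mul _) (hi4.const_mul _), integral_add hi1 hi2,
    integral_fluxDeriv hn hF hΩ hu, integral_const_mul, integral_const_mul, add_zero] at key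
  rw [lerayDiff]
  linarith

theorem lerayDiff_nonneg_of_isTest (hn : 2 ≤ n) (hF : IsStronglyConvexFinsler F)
    (hΩ : IsBoundedDomain Ω) (hu : IsTest 1 Ω u) : 0 ≤ lerayDiff F Ω u (gradient u) := by
  refine le_trans ?_ (improved_leray hn hF hΩ hu)
  have hn' : (2 : ℝ) ≤ n := by exact_mod_cast hn
  refine mul_nonneg (div_nonneg (pow_nonneg (div_nonneg (by linarith) (by linarith)) _)
    (by linarith)) (setIntegral_nonneg hΩ.isOpen.measurableSet fun x hx => ?_)
  have := lerayWeight_nonneg hn hF hΩ hx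
  positivity

/-- The vector field `X₁^{-(1 - 1/n)} ∇v`, where `v` is the ground state substitution. -/
noncomputable def linkField (F : E n → ℝ) (Ω : Set (E n)) (u : E n → ℝ) (x : E n) : E n :=
  gradient u x + (((n : ℝ) - 1) / n * u x * lerayWeight F Ω x) • gradient (polar F) x

theorem measurable_linkField (hF : IsStronglyConvexFinsler F) (hu : IsTest 1 Ω u) :
    Measurable (linkField F Ω u) :=
  (measurable_gradient u).add (((measurable_const.mul hu.contDiff.continuous.measurable).mul
    (measurable_lerayWeight hF)).smul (measurable_gradient _))

theorem gradient_groundState (hn : 2 ≤ n) (hF : IsStronglyConvexFinsler F)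
    (hΩ : IsBoundedDomain Ω) (hu : IsTest 1 Ω u) (hx : x ∈ Ω) (hx0 : x ≠ 0) :
    gradient (groundState F Ω u) x =
      X₁ (polar F x / radius F Ω) ^ (1 - 1 / (n : ℝ)) • linkField F Ω u x := by
  have hX := X₁_pos (ratio_pos hn hF hΩ hx0) (ratio_mem hn hF hΩ hx).2
  have hH := hF.polar_pos hx0
  have hn0 : (n : ℝ) ≠ 0 := by positivity
  have h1 := HasDerivAt.comp_hasGradientAt
    (Real.hasDerivAt_rpow_const (p := 1 - 1 / (n : ℝ)) (Or.inl hX.ne'))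
    (hasGradientAt_X₁_comp hn hF hΩ hx hx0)
  have h2 : HasGradientAt (groundState F Ω u) _ x := h1.mul' (hu.hasGradientAt le_rfl x)
  rw [h2.gradient, linkField, smul_add, smul_smul, smul_smul, smul_smul, lerayWeight,
    Real.rpow_sub_one hX.ne']
  congr 2
  field_simp

/-- The powers of X₁ cancel since (1 - 1/n)n + (1 - n) = 0; the link integral becomes an unweighted
one. -/
theorem map_gradient_groundState_pow (hn : 2 ≤ n) (hF : IsStronglyConvexFinsler F)
    (hΩ : IsBoundedDomain Ω) (hu : IsTest 1 Ω u) (hx : x ∈ Ω) (hx0 : x ≠ 0) :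
    F (gradient (groundState F Ω u) x) ^ n * X₁ (polar F x / radius F Ω) ^ (1 - (n : ℝ)) =
      F (linkField F Ω u x) ^ n := by
  have hX := X₁_pos (ratio_pos hn hF hΩ hx0) (ratio_mem hn hF hΩ hx).2
  have hn0 : (n : ℝ) ≠ 0 := by positivity
  rw [gradient_groundState hn hF hΩ hu hx hx0, hF.map_smul, abs_of_pos (Real.rpow_pos_of_pos hX _),
    mul_pow, ← Real.rpow_mul_natCast hX.le, mul_right_comm, ← Real.rpow_add hX]
  have : (1 - 1 / (n : ℝ)) * n + (1 - n) = 0 := by field_simp; ring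
  rw [this, Real.rpow_zero, one_mul]

/-- For s = sign U this identifies the first order term of the convexity expansion with minus the
flux derivative for θ = 0. -/
theorem link_algebra (k : ℕ) (c X s p U : ℝ) {H : ℝ} (hH : 0 < H) :
    ((k : ℝ) + 2) * (c * |U| * (X / H)) ^ (k + 1) * (-(s / H) * (p + c * U * X)) =
      -((((k : ℝ) + 2) * (c * X) ^ (k + 1) * (|U| ^ (k + 1) * s) * p +
        (((k : ℝ) + 2) * c) * c ^ (k + 1) * X ^ (k + 2) * ((|U| ^ (k + 1) * s) * U)) /
          H ^ (k + 2)) := by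
  rw [mul_pow, mul_pow, mul_pow, div_pow]
  field_simp
  ring

/-- The pointwise inequality behind the existence of an admissible link constant. -/
theorem exists_link_bound (hn : 2 ≤ n) (hF : IsStronglyConvexFinsler F) :
    ∃ c₀ : ℝ, 0 < c₀ ∧ ∀ (Ω : Set (E n)) (u : E n → ℝ), IsBoundedDomain Ω → IsTest 1 Ω u →
      IntegrableOn (fun x => F (linkField F Ω u x) ^ n) Ω ∧
      c₀ * ∫ x in Ω, F (linkField F Ω u x) ^ n ≤ lerayDiff F Ω u (gradient u) := by
  obtain ⟨c₀, hc₀, hexp⟩ := hF.exists_pow_expansion hn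
  refine ⟨c₀, hc₀, fun Ω u hΩ hu => ?_⟩
  obtain ⟨k, hk⟩ : ∃ k, n = k + 2 := ⟨n - 2, by omega⟩
  have hkn : (n : ℝ) = k + 2 := by rw [hk]; push_cast; ring
  set c : ℝ := ((n : ℝ) - 1) / n with hc
  have hc' : c = (k + 1) / (k + 2) := by rw [hc, hkn]; ring
  have hc0 : 0 ≤ c := by rw [hc']; positivity
  have hi1 := integrableOn_map_gradient_pow hn hF hu
  have hi2 := integrableOn_fluxDeriv hn hF hΩ hu hc0 le_rfl hk
  have hi3 := integrableOn_lerayTerm_of_isTest hn hF hΩ hu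
  have hi5 := (hi1.add hi2).sub (hi3.const_mul (c ^ n))
  have hpt : ∀ᵐ x ∂(volume.restrict Ω), c₀ * F (linkField F Ω u x) ^ n ≤
      F (gradient u x) ^ n + fluxDeriv F Ω c 0 k u x / polar F x ^ n -
        c ^ n * lerayTerm F Ω u x := by
    filter_upwards [ae_restrict_mem hΩ.isOpen.measurableSet, ae_restrict_ne_zero hn Ω]
      with x hx hx0
    have hH := hF.polar_pos hx0
    have ht := ratio_pos hn hF hΩ hx0
    have ht1 := (ratio_mem hn hF hΩ hx).2
    have hX := X₁_pos ht ht1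
    have hΞ := hF.inner_gradient_polar hx0
    have hΞ1 := hF.map_gradient_polar hx0
    have hfield : linkField F Ω u x =
      gradient u x + (c * u x * lerayWeight F Ω x) • gradient (polar F) x := rfl
    set X := X₁ (polar F x / radius F Ω) with hXdef
    set H := polar F x
    set Ξ := gradient (polar F) x
    set ρ := lerayWeight F Ω x with hρdef
    have hρ : ρ = X / H := rfl
    have hρ0 : 0 < ρ := by rw [hρ]; positivity
    set a := linkField F Ω u x
    set p := inner ℝ (gradient u x) x with hp
    set s : ℝ := ((SignType.sign (u x) : SignType) : ℝ) with hs
    have hsu : s * u x = |u x| := by rw [hs, sign_mul_self]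
    have hs1 : |s| ≤ 1 := by
      rcases lt_trichotomy (u x) 0 with h | h | h
      · simp [hs, sign_neg h]
      · simp [hs, h]
      · simp [hs, sign_pos h]
    set b : E n := (-(c * u x * ρ)) • Ξ with hb
    have hba : b + a = gradient u x := by rw [hfield, hb]; module
    have hFb : F b = c * |u x| * ρ := by
      rw [hb, hF.map_smul, hΞ1, mul_one, abs_neg, abs_mul, abs_mul, abs_of_nonneg hc0,
        abs_of_pos hρ0]
    have hxa : inner ℝ x a = p + c * u x * X := by
      rw [hfield, inner_add_right, inner_smul_right, real_inner_comm, ← hp, real_inner_comm, hΞ, hρ]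
      field_simp
    -- Expansion of F(∇u)ⁿ around b = -cuρ∇F_∘ with increment a. The vector -(sign u/F_∘)x supports
    -- F at b because x·∇F_∘ = F_∘ and F(∇F_∘) = 1. The zeroth order term is cⁿ times the Leray
    -- term, and the first order term integrates to zero.
    have h := hexp a b ((-(s / H)) • x) ?_ ?_
    · rw [hba, hFb, inner_smul_left, RCLike.conj_to_real, hxa] at h
      have e1 : n * (c * |u x| * ρ) ^ (n - 1) * (-(s / H) * (p + c * u x * X)) =
          -(fluxDeriv F Ω c 0 k u x / H ^ n) := by
        have hnat : n - 1 = k + 1 := by omega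
        have habs : |u x| ^ (k + 1) * s = |u x| ^ k * u x := by
          rw [pow_succ, mul_assoc, hs, abs_mul_sign]
        have habs2 : |u x| ^ k * u x * u x = |u x| ^ (k + 2) := by
          rw [pow_add, sq_abs]; ring
        have hnc : ((k : ℝ) + 2) * c = k + 1 := by rw [hc']; field_simp
        rw [fluxDeriv, fluxCoeff, hnat, hkn, ← hXdef, hρ]
        rw [congrArg (H ^ ·) hk]
        rw [link_algebra k c X s p (u x) hH, habs, habs2, hnc]
        simp only [zero_mul, add_zero, mul_one, ← hp]
        clear_value c
        ring
      rw [e1] at h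
      have e2 : (c * |u x| * ρ) ^ n = c ^ n * lerayTerm F Ω u x := by
        rw [lerayTerm_eq, ← hρdef, mul_assoc, mul_pow]
      rw [e2] at h
      linarith
    · intro y
      rw [inner_smul_left, RCLike.conj_to_real, real_inner_comm]
      have hy := hF.abs_inner_le_polar_mul y x
      calc -(s / H) * inner ℝ y x ≤ |-(s / H) * inner ℝ y x| := le_abs_self _
        _ = |s| * (|inner ℝ y x| / H) := by
          rw [abs_mul, abs_neg, abs_div, abs_of_pos hH]; ring
        _ ≤ 1 * F y := by
          gcongr
          rw [div_le_iff₀ hH]; linarith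
        _ = F y := one_mul _
    · rw [hFb, hb, inner_smul_left, inner_smul_right, RCLike.conj_to_real, real_inner_comm, hΞ,
        ← hsu]
      field_simp
  have hi6 : IntegrableOn (fun x => F (linkField F Ω u x) ^ n) Ω := by
    refine Integrable.mono' (hi5.const_mul c₀⁻¹)
      ((hF.continuous.measurable.comp (measurable_linkField hF hu)).pow_const
        n).aestronglyMeasurable ?_
    filter_upwards [hpt] with x hx
    rw [Real.norm_of_nonneg (pow_nonneg (hF.nonneg _) n)]
    rw [← div_eq_inv_mul, le_div_iff₀ hc₀, mul_comm]
    exact hx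
  refine ⟨hi6, ?_⟩
  have key := integral_mono_ae (hi6.const_mul c₀) hi5 hpt
  have e1 : ∫ x in Ω, ((fun x => F (gradient u x) ^ n) + (fun x => fluxDeriv F Ω c 0 k u x /
      polar F x ^ n) - fun x => c ^ n * lerayTerm F Ω u x) x = lerayDiff F Ω u (gradient u) := by
    rw [integral_sub' (hi1.add hi2) (hi3.const_mul _), integral_add' hi1 hi2,
      integral_fluxDeriv hn hF hΩ hu, integral_const_mul, add_zero, lerayDiff]
  rw [integral_const_mul] at key
  exact key.trans_eq e1

theorem exists_isLinkConst (hn : 2 ≤ n) (hF : IsStronglyConvexFinsler F) :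
    ∃ σ, IsLinkConst F σ := by
  obtain ⟨c₀, hc₀, h⟩ := exists_link_bound hn hF
  -- Since σ ≥ 1 and n ≥ 1, one has 2^{n-1}σⁿ ≥ σ ≥ 1/c₀.
  set σ := max 1 c₀⁻¹ with hσ
  refine ⟨σ, le_max_left _ _, fun Ω hΩ u hu => ?_⟩
  obtain ⟨-, hle⟩ := h Ω u hΩ hu
  have hI := lerayDiff_nonneg_of_isTest hn hF hΩ hu
  have e : ∫ x in Ω, F (gradient (groundState F Ω u) x) ^ n *
        X₁ (polar F x / radius F Ω) ^ (1 - (n : ℝ)) = ∫ x in Ω, F (linkField F Ω u x) ^ n := by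
    refine integral_congr_ae ?_
    filter_upwards [ae_restrict_mem hΩ.isOpen.measurableSet, ae_restrict_ne_zero hn Ω]
      with x hx hx0 using map_gradient_groundState_pow hn hF hΩ hu hx hx0
  rw [e]
  have h1 : c₀⁻¹ ≤ 2 ^ (n - 1) * σ ^ n := by
    have h2 : σ ≤ σ ^ n := le_self_pow₀ (le_max_left _ _) (by omega)
    have h3 : (1 : ℝ) ≤ 2 ^ (n - 1) := one_le_pow₀ one_le_two
    have h4 : c₀⁻¹ ≤ σ := le_max_right _ _
    have h5 : 0 ≤ σ ^ n := by positivity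
    nlinarith
  rw [mul_comm c₀, ← le_div_iff₀ hc₀, div_eq_inv_mul] at hle
  exact hle.trans (by gcongr)

/-- Each admissibility condition is a closed condition on σ; the intersection is nonempty by
`exists_isLinkConst` and bounded below by 1. -/
theorem isLeast_sigma (hn : 2 ≤ n) (hF : IsStronglyConvexFinsler F) :
    IsLeast {σ : ℝ | IsLinkConst F σ} (sigma F) := by
  refine IsClosed.isLeast_csInf ?_ (exists_isLinkConst hn hF) ⟨1, fun σ hσ => hσ.1⟩
  have : {σ : ℝ | IsLinkConst F σ} = Set.Ici 1 ∩ ⋂ (Ω : Set (E n)) (_ : IsBoundedDomain Ω)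
      (u : E n → ℝ) (_ : IsTest 1 Ω u), {σ : ℝ |
        ∫ x in Ω, F (gradient (groundState F Ω u) x) ^ n *
          X₁ (polar F x / radius F Ω) ^ (1 - (n : ℝ)) ≤
        2 ^ (n - 1) * σ ^ n * lerayDiff F Ω u (gradient u)} := by
    ext σ
    simp only [IsLinkConst, Set.mem_ofPred_eq, Set.mem_inter_iff, Set.mem_Ici, Set.mem_iInter]
  rw [this]
  refine isClosed_Ici.inter (isClosed_iInter fun Ω => isClosed_iInter fun _ =>
    isClosed_iInter fun u => isClosed_iInter fun _ => isClosed_le continuous_const ?_)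
  fun_prop

/-- The link inequality with the smallest constant. -/
theorem integral_linkField_le (hn : 2 ≤ n) (hF : IsStronglyConvexFinsler F)
    (hΩ : IsBoundedDomain Ω) (hu : IsTest 1 Ω u) :
    ∫ x in Ω, F (linkField F Ω u x) ^ n ≤
      2 ^ (n - 1) * sigma F ^ n * lerayDiff F Ω u (gradient u) := by
  rw [← integral_congr_ae (g := fun x => F (linkField F Ω u x) ^ n)
    (f := fun x => F (gradient (groundState F Ω u) x) ^ n *
        X₁ (polar F x / radius F Ω) ^ (1 - (n : ℝ)))]
  · exact (isLeast_sigma hn hF).1.2 Ω hΩ u hu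
  · filter_upwards [ae_restrict_mem hΩ.isOpen.measurableSet, ae_restrict_ne_zero hn Ω]
      with x hx hx0 using map_gradient_groundState_pow hn hF hΩ hu hx hx0

end Test

end FinslerLeray

namespace FinslerLeray

/-! ### A Sobolev inequality with explicit constant -/

section Sobolev

variable {n : ℕ}

theorem enorm_smul_sphere (ω : Metric.sphere (0 : E n) 1) {r : ℝ} (hr : 0 < r) :
    ‖r • (ω : E n)‖ₑ = ENNReal.ofReal r := by
  rw [← ofReal_norm, norm_smul, norm_eq_of_mem_sphere, mul_one, Real.norm_of_nonneg hr.le]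

theorem omega_pos (hn : 2 ≤ n) : 0 < omega n := by
  have : Nonempty (Fin n) := ⟨⟨0, by omega⟩⟩
  exact ENNReal.toReal_pos (Metric.measure_ball_pos _ _ one_pos).ne' measure_ball_lt_top.ne

theorem ofReal_omega : ENNReal.ofReal (omega n) = volume (Metric.ball (0 : E n) 1) :=
  ENNReal.ofReal_toReal measure_ball_lt_top.ne

theorem toSphere_univ (hn : 2 ≤ n) :
    (volume : Measure (E n)).toSphere Set.univ = ENNReal.ofReal (n * omega n) := by
  rw [Measure.toSphere_apply_univ, finrank_euclideanSpace_fin, ENNReal.ofReal_mul (by positivity),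
    ENNReal.ofReal_natCast, ofReal_omega]

theorem lintegral_ball_enorm_rpow (hn : 2 ≤ n) {s ρ : ℝ} (hs : s < n) (hρ : 0 < ρ) :
    ∫⁻ y in Metric.ball (0 : E n) ρ, ‖y‖ₑ ^ (-s) =
      ENNReal.ofReal (n * omega n * (ρ ^ ((n : ℝ) - s) / (n - s))) := by
  have : Nonempty (Fin n) := ⟨⟨0, by omega⟩⟩
  have : Nontrivial (E n) := inferInstance
  rw [← lintegral_indicator Metric.isOpen_ball.measurableSet, lintegral_eq_polar]
  swap
  · exact Measurable.indicator (by fun_prop) Metric.isOpen_ball.measurableSet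
  have hω := omega_pos hn
  have hinner : ∀ ω : Metric.sphere (0 : E n) 1, ∫⁻ r in Set.Ioi (0 : ℝ),
      ENNReal.ofReal (r ^ (n - 1)) *
        (Metric.ball (0 : E n) ρ).indicator (fun y => ‖y‖ₑ ^ (-s)) (r • ω.1) =
      ENNReal.ofReal (ρ ^ ((n : ℝ) - s) / (n - s)) := by
    intro ω
    have h1 : ∀ r ∈ Set.Ioi (0 : ℝ), ENNReal.ofReal (r ^ (n - 1)) *
        (Metric.ball (0 : E n) ρ).indicator (fun y => ‖y‖ₑ ^ (-s)) (r • ω.1) =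
        (Set.Ioo 0 ρ).indicator (fun r => ENNReal.ofReal (r ^ ((n : ℝ) - 1 - s))) r := by
      intro r hr
      have hr0 : (0 : ℝ) < r := hr
      have hmem : r • ω.1 ∈ Metric.ball (0 : E n) ρ ↔ r ∈ Set.Ioo 0 ρ := by
        rw [mem_ball_zero_iff, norm_smul, norm_eq_of_mem_sphere, mul_one,
          Real.norm_of_nonneg hr0.le]
        simp [hr0]
      by_cases hb : r ∈ Set.Ioo 0 ρ
      · rw [Set.indicator_of_mem (hmem.2 hb), Set.indicator_of_mem hb, enorm_smul_sphere ω hr0,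
          ENNReal.ofReal_rpow_of_pos hr0, ← ENNReal.ofReal_mul (by positivity), ← Real.rpow_natCast,
          ← Real.rpow_add hr0, Nat.cast_sub (by omega), sub_eq_add_neg _ s, Nat.cast_one]
      · rw [Set.indicator_of_notMem (mt hmem.1 hb), Set.indicator_of_notMem hb, mul_zero]
    rw [setLIntegral_congr_fun measurableSet_Ioi h1, lintegral_indicator measurableSet_Ioo,
      Measure.restrict_restrict measurableSet_Ioo,
      Set.inter_eq_left.2 (Set.Ioo_subset_Ioi_self : Set.Ioo 0 ρ ⊆ Set.Ioi 0),
      restrict_Ioo_eq_restrict_Ioc]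
    have hexp : -1 < (n : ℝ) - 1 - s := by linarith
    have hint : IntegrableOn (fun r : ℝ => r ^ ((n : ℝ) - 1 - s)) (Set.Ioc 0 ρ) :=
      (intervalIntegrable_iff_integrableOn_Ioc_of_le hρ.le).1
        (intervalIntegral.intervalIntegrable_rpow' hexp)
    rw [← ofReal_integral_eq_lintegral_ofReal hint, ← intervalIntegral.integral_of_le hρ.le,
      integral_rpow (Or.inl hexp)]
    · have e : (n : ℝ) - 1 - s + 1 = n - s := by ring
      rw [e, Real.zero_rpow (by linarith), sub_zero]
    · filter_upwards [ae_restrict_mem measurableSet_Ioc] with r hr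
      exact Real.rpow_nonneg hr.1.le _
  simp_rw [hinner]
  rw [lintegral_const, toSphere_univ hn, mul_comm, ← ENNReal.ofReal_mul (by positivity)]

/-- Among sets of given measure, the centred ball maximizes the Riesz potential. -/
theorem lintegral_enorm_sub_rpow_le {s : ℝ} (hs0 : 0 ≤ s)
    {Ω : Set (E n)} (hΩ : MeasurableSet Ω) (x : E n) {ρ : ℝ}
    (hvol : volume Ω = volume (Metric.ball (0 : E n) ρ)) :
    ∫⁻ y in Ω, ‖y - x‖ₑ ^ (-s) ≤ ∫⁻ y in Metric.ball (0 : E n) ρ, ‖y‖ₑ ^ (-s) := by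
  have e1 : ∫⁻ y in Metric.ball (0 : E n) ρ, ‖y‖ₑ ^ (-s) =
      ∫⁻ y in Metric.ball x ρ, ‖y - x‖ₑ ^ (-s) := by
    have h := (measurePreserving_sub_right (volume : Measure (E n)) x).setLIntegral_comp_preimage
      (s := Metric.ball 0 ρ) (f := fun y => ‖y‖ₑ ^ (-s)) Metric.isOpen_ball.measurableSet
      (by fun_prop)
    rw [← h]
    congr 2
    ext y; simp [dist_eq_norm]
  have hvol' : volume Ω = volume (Metric.ball x ρ) := by
    rw [hvol, Measure.addHaar_ball_center volume x]
  rw [e1]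
  set B := Metric.ball x ρ
  have hB : MeasurableSet B := Metric.isOpen_ball.measurableSet
  -- The common part Ω ∩ B is dropped. The rests Ω \ B and B \ Ω have equal measure, and ρ^{-s}
  -- separates the values of the kernel on them.
  rw [← lintegral_inter_add_sdiff _ Ω hB, ← lintegral_inter_add_sdiff _ B hΩ, Set.inter_comm B Ω]
  refine add_le_add le_rfl ?_
  have hfin : volume (Ω ∩ B) ≠ ⊤ :=
    ne_top_of_le_ne_top measure_ball_lt_top.ne (measure_mono Set.inter_subset_right)
  have hm : volume (Ω \ B) = volume (B \ Ω) := by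
    have h1 := measure_inter_add_sdiff (μ := volume) Ω hB
    have h2 := measure_inter_add_sdiff (μ := volume) B hΩ
    rw [Set.inter_comm B Ω, ← hvol', ← h1] at h2
    exact ((ENNReal.add_right_inj hfin).1 h2).symm
  calc ∫⁻ y in Ω \ B, ‖y - x‖ₑ ^ (-s) ≤ ∫⁻ y in Ω \ B, ENNReal.ofReal ρ ^ (-s) := by
        refine setLIntegral_mono measurable_const fun y hy => ?_
        have : ENNReal.ofReal ρ ≤ ‖y - x‖ₑ := by
          rw [← ofReal_norm]
          refine ENNReal.ofReal_le_ofReal ?_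
          have := hy.2
          simpa [B, dist_eq_norm] using this
        rw [ENNReal.rpow_neg, ENNReal.rpow_neg]
        gcongr
    _ = ∫⁻ y in B \ Ω, ENNReal.ofReal ρ ^ (-s) := by
        rw [setLIntegral_const, setLIntegral_const, hm]
    _ ≤ ∫⁻ y in B \ Ω, ‖y - x‖ₑ ^ (-s) := by
        refine setLIntegral_mono (by fun_prop) fun y hy => ?_
        have : ‖y - x‖ₑ ≤ ENNReal.ofReal ρ := by
          rw [← ofReal_norm]
          refine ENNReal.ofReal_le_ofReal ?_
          have := hy.1
          simpa [B, dist_eq_norm] using (Metric.mem_ball.1 this).le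
        rw [ENNReal.rpow_neg, ENNReal.rpow_neg]
        gcongr

/-- Fundamental theorem of calculus along the ray, up to a point beyond the support. A ray meets the
origin at most once, so differentiability may fail there. -/
theorem enorm_le_lintegral_ray {w : E n → ℝ} (hw : Continuous w) (hcs : HasCompactSupport w)
    (hdiff : ∀ y, y ≠ 0 → DifferentiableAt ℝ w y) (x : E n) (ω : Metric.sphere (0 : E n) 1) :
    ‖w x‖ₑ ≤ ∫⁻ r in Set.Ioi (0 : ℝ), ‖gradient w (x + r • ω.1)‖ₑ := by
  by_cases htop : ∫⁻ r in Set.Ioi (0 : ℝ), ‖gradient w (x + r • ω.1)‖ₑ = ⊤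
  · rw [htop]; exact le_top
  have hω1 : ‖(ω : E n)‖ = 1 := norm_eq_of_mem_sphere ω
  have hω0 : (ω : E n) ≠ 0 := ne_zero_of_mem_unit_sphere ω
  obtain ⟨C, hC⟩ := hcs.isCompact.isBounded.exists_norm_le
  set M := max 0 C + ‖x‖ + 1 with hM
  have hM0 : 0 < M := by have := le_max_left 0 C; positivity
  have hwM : w (x + M • ω.1) = 0 := by
    refine image_eq_zero_of_notMem_tsupport fun h => ?_
    have h1 := hC _ h
    have h2 : ‖M • ω.1‖ ≤ ‖x + M • ω.1‖ + ‖x‖ := by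
      simpa using norm_sub_le (x + M • ω.1) x
    rw [norm_smul, hω1, mul_one, Real.norm_of_nonneg hM0.le] at h2
    have := le_max_right 0 C
    linarith
  set f' : ℝ → ℝ := fun r => inner ℝ (gradient w (x + r • ω.1)) ω.1 with hf'
  have hline : Continuous fun r : ℝ => x + r • ω.1 := by fun_prop
  have hmeas : Measurable f' :=
    ((measurable_gradient w).comp hline.measurable).inner measurable_const
  have hle : ∀ r, ‖f' r‖ₑ ≤ ‖gradient w (x + r • ω.1)‖ₑ := by
    intro r
    rw [← ofReal_norm, ← ofReal_norm]
    refine ENNReal.ofReal_le_ofReal ?_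
    have h := norm_inner_le_norm (𝕜 := ℝ) (gradient w (x + r • ω.1)) ω.1
    rwa [hω1, mul_one] at h
  have hfin : ∫⁻ r in Set.Ioc 0 M, ‖f' r‖ₑ ≤
      ∫⁻ r in Set.Ioi (0 : ℝ), ‖gradient w (x + r • ω.1)‖ₑ :=
    (lintegral_mono hle).trans (lintegral_mono_set Set.Ioc_subset_Ioi_self)
  have hint : IntervalIntegrable f' volume 0 M := by
    rw [intervalIntegrable_iff_integrableOn_Ioc_of_le hM0.le]
    exact ⟨hmeas.aestronglyMeasurable, lt_of_le_of_lt hfin (lt_top_iff_ne_top.2 htop)⟩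
  have hcount : {r : ℝ | x + r • ω.1 = 0}.Countable := by
    refine Set.Subsingleton.countable fun r hr s hs => ?_
    have : (r - s) • ω.1 = 0 := by
      have h : x + r • ω.1 = x + s • ω.1 := hr.trans hs.symm
      rw [sub_smul, sub_eq_zero]; exact add_left_cancel h
    rcases smul_eq_zero.1 this with h | h
    · linarith
    · exact absurd h hω0
  have hftc := integral_eq_of_hasDerivAt_off_countable (fun r => w (x + r • ω.1)) f' hcount
    (hw.comp hline).continuousOn (fun r hr => ?_) hint
  · rw [hwM, zero_smul, add_zero, zero_sub, intervalIntegral.integral_of_le hM0.le] at hftc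
    calc ‖w x‖ₑ = ‖∫ r in Set.Ioc 0 M, f' r‖ₑ := by rw [hftc, enorm_neg]
      _ ≤ ∫⁻ r in Set.Ioc 0 M, ‖f' r‖ₑ := enorm_integral_le_lintegral_enorm _
      _ ≤ _ := hfin
  · have h1 := (hdiff _ hr.2).hasGradientAt
    rw [hasGradientAt_iff_hasFDerivAt] at h1
    have h2 : HasDerivAt (fun r : ℝ => x + r • ω.1) ω.1 r := by
      simpa using ((hasDerivAt_id r).smul_const ω.1).const_add x
    exact h1.comp_hasDerivAt r h2

/-- The potential estimate `n ωₙ |w(x)| ≤ ∫ |∇w(y)| |y - x|^{1-n} dy`. -/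
theorem enorm_le_riesz (hn : 2 ≤ n) {w : E n → ℝ} (hw : Continuous w) (hcs : HasCompactSupport w)
    (hdiff : ∀ y, y ≠ 0 → DifferentiableAt ℝ w y) (x : E n) :
    ENNReal.ofReal (n * omega n) * ‖w x‖ₑ ≤
      ∫⁻ y, ‖gradient w y‖ₑ * ‖y - x‖ₑ ^ (-((n : ℝ) - 1)) := by
  have : Nonempty (Fin n) := ⟨⟨0, by omega⟩⟩
  have : Nontrivial (E n) := inferInstance
  have hg := measurable_gradient w
  have h1 : ENNReal.ofReal (n * omega n) * ‖w x‖ₑ =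
      ∫⁻ _ : Metric.sphere (0 : E n) 1, ‖w x‖ₑ ∂(volume : Measure (E n)).toSphere := by
    rw [lintegral_const, toSphere_univ hn, mul_comm]
  have h2 : ∫⁻ y, ‖gradient w y‖ₑ * ‖y - x‖ₑ ^ (-((n : ℝ) - 1)) =
      ∫⁻ z, ‖gradient w (x + z)‖ₑ * ‖z‖ₑ ^ (-((n : ℝ) - 1)) := by
    rw [← lintegral_add_left_eq_self _ x]
    simp
  rw [h1, h2, lintegral_eq_polar (by fun_prop)]
  -- The ray bound is integrated over all directions; the kernel |z|^{1-n} cancels the Jacobian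
  -- r^{n-1}.
  refine lintegral_mono fun ω => (enorm_le_lintegral_ray hw hcs hdiff x ω).trans_eq ?_
  refine setLIntegral_congr_fun measurableSet_Ioi fun r hr => ?_
  have hr0 : (0 : ℝ) < r := hr
  rw [enorm_smul_sphere ω hr0, mul_comm ‖gradient w (x + r • ω.1)‖ₑ, ← mul_assoc,
    ENNReal.ofReal_rpow_of_pos hr0, ← ENNReal.ofReal_mul (by positivity), ← Real.rpow_natCast,
    ← Real.rpow_add hr0, Nat.cast_sub (by omega), Nat.cast_one, add_neg_cancel, Real.rpow_zero,
    ENNReal.ofReal_one, one_mul]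

/-- A Young type inequality for integral operators. -/
theorem lintegral_young {α : Type*} [MeasurableSpace α] {μ : Measure α} [SFinite μ]
    {f : α → ENNReal} {K : α → α → ENNReal} (hf : Measurable f)
    (hK : Measurable (Function.uncurry K)) {p q r : ℝ} (hp : 1 ≤ p) (hpq : p ≤ q) (hr : 0 < r)
    (hr1 : 1 / r = 1 + 1 / q - 1 / p) {A : ENNReal} (hA₁ : ∀ x, ∫⁻ y, K x y ^ r ∂μ ≤ A)
    (hA₂ : ∀ y, ∫⁻ x, K x y ^ r ∂μ ≤ A) :
    (∫⁻ x, (∫⁻ y, f y * K x y ∂μ) ^ q ∂μ) ^ (1 / q) ≤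
      A ^ (1 / r) * (∫⁻ y, f y ^ p ∂μ) ^ (1 / p) := by
  have hp0 : 0 < p := by linarith
  have hq0 : 0 < q := by linarith
  set N := ∫⁻ y, f y ^ p ∂μ
  have e2 : 0 ≤ 1 - 1 / p := by
    rw [sub_nonneg, div_le_one hp0]; exact hp
  have e3 : 0 ≤ 1 / p - 1 / q := by
    rw [sub_nonneg]; exact one_div_le_one_div_of_le hp0 hpq
  have hKx : ∀ x, Measurable (K x) := fun x => hK.comp measurable_prodMk_left
  have hpt : ∀ x, (∫⁻ y, f y * K x y ∂μ) ^ q ≤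
      (∫⁻ y, K x y ^ r * f y ^ p ∂μ) * (A ^ (q * (1 - 1 / p)) * N ^ (q * (1 / p - 1 / q))) := by
    intro x
    -- Hölder with three factors, fK = (K^r f^p)^{1/q} (K^r)^{1-1/p} (f^p)^{1/p-1/q}; the exponents
    -- sum to 1.
    have hH := ENNReal.lintegral_prod_norm_pow_le (μ := μ) (Finset.univ : Finset (Fin 3))
      (f := ![fun y => K x y ^ r * f y ^ p, fun y => K x y ^ r, fun y => f y ^ p])
      (p := ![1 / q, 1 - 1 / p, 1 / p - 1 / q]) (by
        intro i _
        have := hKx x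
        fin_cases i <;> simp <;> fun_prop)
      (by rw [Fin.sum_univ_three]; simp; ring)
      (by
        intro i _
        fin_cases i
        · exact (by positivity : 0 ≤ 1 / q)
        · exact e2
        · exact e3)
    simp only [Fin.prod_univ_three, Matrix.cons_val_zero, Matrix.cons_val_one, Matrix.cons_val] at hH
    have hlhs : ∀ y, (K x y ^ r * f y ^ p) ^ (1 / q) * (K x y ^ r) ^ (1 - 1 / p) *
        (f y ^ p) ^ (1 / p - 1 / q) = f y * K x y := by
      intro y
      rw [ENNReal.mul_rpow_of_nonneg _ _ (by positivity), ← ENNReal.rpow_mul, ← ENNReal.rpow_mul,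
        ← ENNReal.rpow_mul, ← ENNReal.rpow_mul]
      have a1 : K x y ^ (r * (1 / q)) * K x y ^ (r * (1 - 1 / p)) = K x y := by
        rw [← ENNReal.rpow_add_of_nonneg _ _ (by positivity) (by positivity), ← mul_add]
        have : r * (1 / q + (1 - 1 / p)) = 1 := by
          rw [show 1 / q + (1 - 1 / p) = 1 / r by rw [hr1]; ring]; field_simp
        rw [this, ENNReal.rpow_one]
      have a2 : f y ^ (p * (1 / q)) * f y ^ (p * (1 / p - 1 / q)) = f y := by
        rw [← ENNReal.rpow_add_of_nonneg _ _ (by positivity) (by positivity), ← mul_add]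
        have : p * (1 / q + (1 / p - 1 / q)) = 1 := by field_simp; ring
        rw [this, ENNReal.rpow_one]
      calc _ = (f y ^ (p * (1 / q)) * f y ^ (p * (1 / p - 1 / q))) *
            (K x y ^ (r * (1 / q)) * K x y ^ (r * (1 - 1 / p))) := by ring
        _ = _ := by rw [a1, a2]
    simp_rw [hlhs] at hH
    calc (∫⁻ y, f y * K x y ∂μ) ^ q ≤ ((∫⁻ y, K x y ^ r * f y ^ p ∂μ) ^ (1 / q) *
          A ^ (1 - 1 / p) * N ^ (1 / p - 1 / q)) ^ q := by
          gcongr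
          refine hH.trans ?_
          gcongr
          exact hA₁ x
      _ = _ := by
          rw [ENNReal.mul_rpow_of_nonneg _ _ hq0.le, ENNReal.mul_rpow_of_nonneg _ _ hq0.le,
            ← ENNReal.rpow_mul, ← ENNReal.rpow_mul, ← ENNReal.rpow_mul, one_div_mul_cancel hq0.ne',
            ENNReal.rpow_one, mul_assoc, mul_comm q, mul_comm q]
  set c := A ^ (q * (1 - 1 / p)) * N ^ (q * (1 / p - 1 / q)) with hc
  have hK2 : Measurable fun z : α × α => K z.1 z.2 := hK
  have hswap : ∫⁻ x, ∫⁻ y, K x y ^ r * f y ^ p ∂μ ∂μ ≤ A * N := by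
    rw [lintegral_lintegral_swap]
    · calc ∫⁻ y, ∫⁻ x, K x y ^ r * f y ^ p ∂μ ∂μ = ∫⁻ y, (∫⁻ x, K x y ^ r ∂μ) * f y ^ p ∂μ := by
            refine lintegral_congr fun y => lintegral_mul_const _ ?_
            exact (hK2.comp measurable_prodMk_right).pow_const r
        _ ≤ ∫⁻ y, A * f y ^ p ∂μ := by
            refine lintegral_mono fun y => ?_
            gcongr
            exact hA₂ y
        _ = A * N := lintegral_const_mul _ (hf.pow_const p)
    · exact ((hK2.pow_const r).mul ((hf.comp measurable_snd).pow_const p)).aemeasurable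
  have hmeas : Measurable fun x => ∫⁻ y, K x y ^ r * f y ^ p ∂μ :=
    ((hK2.pow_const r).mul ((hf.comp measurable_snd).pow_const p)).lintegral_prod_right'
  calc (∫⁻ x, (∫⁻ y, f y * K x y ∂μ) ^ q ∂μ) ^ (1 / q) ≤ (A * N * c) ^ (1 / q) := by
        gcongr
        calc ∫⁻ x, (∫⁻ y, f y * K x y ∂μ) ^ q ∂μ ≤
              ∫⁻ x, (∫⁻ y, K x y ^ r * f y ^ p ∂μ) * c ∂μ := lintegral_mono hpt
          _ = (∫⁻ x, ∫⁻ y, K x y ^ r * f y ^ p ∂μ ∂μ) * c := lintegral_mul_const _ hmeas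
          _ ≤ A * N * c := by gcongr
    _ = (A ^ (1 + q * (1 - 1 / p)) * N ^ (1 + q * (1 / p - 1 / q))) ^ (1 / q) := by
        rw [ENNReal.rpow_add_of_nonneg _ _ zero_le_one (by positivity),
          ENNReal.rpow_add_of_nonneg _ _ zero_le_one (by positivity), ENNReal.rpow_one,
          ENNReal.rpow_one, hc]
        ring_nf
    _ = _ := by
        rw [ENNReal.mul_rpow_of_nonneg _ _ (by positivity), ← ENNReal.rpow_mul, ← ENNReal.rpow_mul]
        congr 2
        · rw [hr1]; field_simp; ring
        · field_simp; ring

/-- Evaluates the constant produced by Young's inequality when ρ is the radius of the ball of volume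
V. With Q = 1 + q(n-1)/n one has r = q/Q and n - s = n/Q, so the kernel |y|^{-s} is locally
integrable. -/
theorem trudinger_constant (hn : 2 ≤ n) {q V ω r s ρ : ℝ} (hq : 0 < q) (hV : 0 < V) (hω : 0 < ω)
    (hr : r = (1 + 1 / q - 1 / n)⁻¹) (hs : s = (n - 1) * r) (hρ : ρ = (V / ω) ^ (1 / (n : ℝ))) :
    0 < r ∧ 0 ≤ s ∧ s < n ∧ (n * ω)⁻¹ * (n * ω * (ρ ^ ((n : ℝ) - s) / (n - s))) ^ (1 / r) =
      1 / n * ω ^ (-(1 / (n : ℝ))) * (1 + q * (n - 1) / n) ^ (1 - 1 / (n : ℝ) + 1 / q) *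
        V ^ (1 / q) := by
  have hn2 : (2 : ℝ) ≤ n := by exact_mod_cast hn
  have hn0 : (0 : ℝ) < n := by linarith
  set Q : ℝ := 1 + q * (n - 1) / n with hQ
  have hQ0 : 0 < Q := by
    have : 0 ≤ q * (n - 1) / n := div_nonneg (mul_nonneg hq.le (by linarith)) hn0.le
    linarith
  have hrQ : r = q / Q := by
    rw [hr, hQ]
    have h1 : 1 + 1 / q - 1 / (n : ℝ) = (1 + q * (n - 1) / n) / q := by field_simp; ring
    rw [h1, inv_div]
  have hr0 : 0 < r := by rw [hrQ]; positivity
  have hns : (n : ℝ) - s = n / Q := by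
    rw [hs, hrQ]
    have h2 : (n : ℝ) * Q = n + q * (n - 1) := by rw [hQ]; field_simp
    field_simp
    linarith
  refine ⟨hr0, by rw [hs]; exact mul_nonneg (by linarith) hr0.le, ?_, ?_⟩
  · have : 0 < (n : ℝ) / Q := by positivity
    linarith
  have e1 : n * ω * (ρ ^ ((n : ℝ) - s) / (n - s)) = ω * Q * (V / ω) ^ (1 / Q) := by
    rw [hns, hρ, ← Real.rpow_mul (by positivity)]
    have : 1 / (n : ℝ) * (n / Q) = 1 / Q := by field_simp
    rw [this]
    field_simp
  have e2 : 1 / Q * (1 / r) = 1 / q := by rw [hrQ]; field_simp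
  have e3 : 1 / r = 1 - 1 / (n : ℝ) + 1 / q := by rw [hr, one_div, inv_inv]; ring
  rw [e1, Real.mul_rpow (by positivity) (by positivity), Real.mul_rpow hω.le hQ0.le,
    ← Real.rpow_mul (by positivity), e2, Real.div_rpow hV.le hω.le, e3]
  have e4 : ω ^ (1 - 1 / (n : ℝ) + 1 / q) = ω * ω ^ (-(1 / (n : ℝ))) * ω ^ (1 / q) := by
    rw [Real.rpow_add hω, sub_eq_add_neg, Real.rpow_add hω, Real.rpow_one]
  rw [e4]
  have : 0 < ω ^ (1 / q) := by positivity
  field_simp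

/-- The Sobolev inequality `W₀^{1,n} ⊂ L^q` for bounded sets with Trudinger's growth of the constant,
for functions that may fail to be differentiable at the origin. -/
theorem eLpNorm_le_eLpNorm_gradient (hn : 2 ≤ n) {Ω : Set (E n)} (hΩ : MeasurableSet Ω)
    (hΩ0 : volume Ω ≠ 0) (hΩt : volume Ω ≠ ⊤) {w : E n → ℝ} (hw : Continuous w)
    (hcs : HasCompactSupport w) (hsub : tsupport w ⊆ Ω)
    (hdiff : ∀ y, y ≠ 0 → DifferentiableAt ℝ w y) {q : ℝ} (hq : (n : ℝ) < q) :
    eLpNorm w (ENNReal.ofReal q) (volume.restrict Ω) ≤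
      ENNReal.ofReal (1 / n * omega n ^ (-(1 / (n : ℝ))) *
        (1 + q * (n - 1) / n) ^ (1 - 1 / (n : ℝ) + 1 / q) * volume.real Ω ^ (1 / q)) *
      eLpNorm (gradient w) n (volume.restrict Ω) := by
  have : Nonempty (Fin n) := ⟨⟨0, by omega⟩⟩
  have : Nontrivial (E n) := inferInstance
  have hn2 : (2 : ℝ) ≤ n := by exact_mod_cast hn
  have hq0 : 0 < q := by linarith
  have hω := omega_pos hn
  set V := volume.real Ω with hVdef
  have hV : 0 < V := ENNReal.toReal_pos hΩ0 hΩt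
  set r : ℝ := (1 + 1 / q - 1 / n)⁻¹ with hr
  set s : ℝ := (n - 1) * r with hs
  set ρ : ℝ := (V / omega n) ^ (1 / (n : ℝ)) with hρ
  obtain ⟨hr0, hs0, hsn, hconst⟩ := trudinger_constant hn hq0 hV hω hr hs hρ
  have hρ0 : 0 < ρ := by positivity
  have hvol : volume Ω = volume (Metric.ball (0 : E n) ρ) := by
    rw [Measure.addHaar_ball_of_pos _ _ hρ0, finrank_euclideanSpace_fin, ← ofReal_omega,
      ← ENNReal.ofReal_mul (by positivity), hρ, ← Real.rpow_natCast,
      ← Real.rpow_mul (by positivity), one_div_mul_cancel (by positivity), Real.rpow_one,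
      div_mul_cancel₀ _ hω.ne', hVdef, measureReal_def, ENNReal.ofReal_toReal hΩt]
  set A := ENNReal.ofReal (n * omega n * (ρ ^ ((n : ℝ) - s) / (n - s))) with hA
  have hAx : ∀ x, ∫⁻ y in Ω, (‖y - x‖ₑ ^ (-((n : ℝ) - 1))) ^ r ≤ A := by
    intro x
    simp_rw [← ENNReal.rpow_mul, neg_mul]
    exact (lintegral_enorm_sub_rpow_le hs0 hΩ x hvol).trans_eq
      (lintegral_ball_enorm_rpow hn hsn hρ0)
  have hyoung := lintegral_young (μ := volume.restrict Ω) (f := fun y => ‖gradient w y‖ₑ)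
    (K := fun x y => ‖y - x‖ₑ ^ (-((n : ℝ) - 1))) (measurable_gradient w).enorm
    (by unfold Function.uncurry; fun_prop) (p := n) (q := q) (r := r) (by linarith) hq.le hr0
    (by rw [hr, one_div, inv_inv]) hAx (by
      intro y
      simp_rw [enorm_sub_rev y]
      exact hAx y)
  have hpt : ∀ x, ENNReal.ofReal (n * omega n) * ‖w x‖ₑ ≤
      ∫⁻ y in Ω, ‖gradient w y‖ₑ * ‖y - x‖ₑ ^ (-((n : ℝ) - 1)) := by
    intro x
    refine (enorm_le_riesz hn hw hcs hdiff x).trans_eq ?_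
    rw [← lintegral_indicator hΩ]
    refine lintegral_congr fun y => ?_
    by_cases hy : y ∈ Ω
    · rw [Set.indicator_of_mem hy]
    · rw [Set.indicator_of_notMem hy,
        gradient_eq_zero_of_notMem_tsupport fun h => hy (hsub h), enorm_zero, zero_mul]
  have hqt : ENNReal.ofReal q ≠ ⊤ := ENNReal.ofReal_ne_top
  have hqz : ENNReal.ofReal q ≠ 0 := by simpa using hq0
  rw [eLpNorm_eq_lintegral_rpow_enorm_toReal hqz hqt,
    eLpNorm_eq_lintegral_rpow_enorm_toReal (by simp; omega) (ENNReal.natCast_ne_top n),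
    ENNReal.toReal_ofReal hq0.le, ENNReal.toReal_natCast]
  set c := ENNReal.ofReal (n * omega n) with hc
  have hc0 : c ≠ 0 := (ENNReal.ofReal_pos.2 (by positivity)).ne'
  have hct : c ≠ ⊤ := ENNReal.ofReal_ne_top
  have h1 : c * (∫⁻ x in Ω, ‖w x‖ₑ ^ q) ^ (1 / q) ≤
      A ^ (1 / r) * (∫⁻ y in Ω, ‖gradient w y‖ₑ ^ (n : ℝ)) ^ (1 / (n : ℝ)) := by
    refine le_trans ?_ hyoung
    have e : c * (∫⁻ x in Ω, ‖w x‖ₑ ^ q) ^ (1 / q) = (∫⁻ x in Ω, (c * ‖w x‖ₑ) ^ q) ^ (1 / q) := by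
      simp_rw [ENNReal.mul_rpow_of_nonneg _ _ hq0.le]
      rw [lintegral_const_mul' _ _ (ENNReal.rpow_ne_top_of_nonneg hq0.le hct),
        ENNReal.mul_rpow_of_nonneg _ _ (by positivity), ← ENNReal.rpow_mul,
        mul_one_div_cancel hq0.ne', ENNReal.rpow_one]
    rw [e]
    gcongr with x
    exact hpt x
  have h2 : (∫⁻ x in Ω, ‖w x‖ₑ ^ q) ^ (1 / q) = c⁻¹ * (c * (∫⁻ x in Ω, ‖w x‖ₑ ^ q) ^ (1 / q)) := by
    rw [← mul_assoc, ENNReal.inv_mul_cancel hc0 hct, one_mul]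
  rw [h2, ← hconst, ENNReal.ofReal_mul (by positivity), mul_assoc,
    ENNReal.ofReal_inv_of_pos (by positivity), ← ENNReal.ofReal_rpow_of_nonneg
      (mul_nonneg (by positivity) (div_nonneg (by positivity) (by linarith))) (by positivity)]
  gcongr

end Sobolev

end FinslerLeray

/-! ### Gradient and L^q bounds for the weighted test function. -/

namespace FinslerLeray

theorem eLpNorm_le_of_integral_pow_le {α : Type*} [MeasurableSpace α] {μ : Measure α} {n : ℕ}
    (hn : n ≠ 0) {f : α → ℝ} (hf : ∀ᵐ x ∂μ, 0 ≤ f x) (hint : Integrable (fun x => f x ^ n) μ)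
    {C : ℝ} (hC : 0 ≤ C) (h : ∫ x, f x ^ n ∂μ ≤ C ^ n) : eLpNorm f n μ ≤ ENNReal.ofReal C := by
  have hn0 : (0 : ℝ) < n := by positivity
  rw [eLpNorm_eq_lintegral_rpow_enorm_toReal (by simpa using hn) (ENNReal.natCast_ne_top n),
    ENNReal.toReal_natCast]
  have e : ∫⁻ x, ‖f x‖ₑ ^ (n : ℝ) ∂μ = ENNReal.ofReal (∫ x, f x ^ n ∂μ) := by
    rw [ofReal_integral_eq_lintegral_ofReal hint (hf.mono fun x hx => pow_nonneg hx n)]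
    refine lintegral_congr_ae ?_
    filter_upwards [hf] with x hx
    rw [Real.enorm_of_nonneg hx, ENNReal.rpow_natCast, ENNReal.ofReal_pow hx]
  rw [e]
  calc ENNReal.ofReal (∫ x, f x ^ n ∂μ) ^ (1 / (n : ℝ)) ≤
        ENNReal.ofReal (C ^ n) ^ (1 / (n : ℝ)) := by gcongr
    _ = ENNReal.ofReal C := by
        rw [ENNReal.ofReal_pow hC, ← ENNReal.rpow_natCast, ← ENNReal.rpow_mul,
          mul_one_div_cancel hn0.ne', ENNReal.rpow_one]

theorem IsBoundedDomain.volume_ne_zero {n : ℕ} {Ω : Set (E n)} (hΩ : IsBoundedDomain Ω) :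
    volume Ω ≠ 0 :=
  (hΩ.isOpen.measure_pos volume hΩ.isConnected.nonempty).ne'

theorem IsBoundedDomain.volume_ne_top {n : ℕ} {Ω : Set (E n)} (hΩ : IsBoundedDomain Ω) :
    volume Ω ≠ ⊤ := hΩ.isBounded.measure_lt_top.ne

section Weighted

variable {n : ℕ} {F : E n → ℝ} {Ω : Set (E n)} {u : E n → ℝ} {x : E n}

theorem tsupport_weighted_subset : tsupport (weighted F Ω u) ⊆ tsupport u := by
  refine closure_mono fun x hx hux => hx ?_
  rw [weighted, hux, zero_mul]

theorem continuous_weighted (hn : 2 ≤ n) (hF : IsStronglyConvexFinsler F)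
    (hΩ : IsBoundedDomain Ω) (hu : IsTest 1 Ω u) : Continuous (weighted F Ω u) := by
  rw [continuous_iff_continuousAt]
  intro x
  by_cases hx : x ∈ tsupport u
  · have h := ratio_mem hn hF hΩ (hu.tsupport_subset hx)
    have h1 : ContinuousAt (fun x => X₂ (polar F x / radius F Ω)) x :=
      ContinuousAt.comp (g := X₂) (continuousAt_X₂ h.1 h.2)
        (hF.continuous_polar.div_const _).continuousAt
    exact hu.contDiff.continuous.continuousAt.mul (h1.rpow_const (Or.inr (by positivity)))
  · have hz : u =ᶠ[𝓝 x] fun _ => 0 := notMem_tsupport_iff_eventuallyEq.1 hx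
    refine (continuousAt_const (y := (0 : ℝ))).congr ?_
    filter_upwards [hz] with y hy
    rw [weighted, hy, zero_mul]

/-- ∇u is replaced by `linkField` at the cost of -(n-1)/n in the radial coefficient; the term
(2/n)X₂ is the derivative of the weight. -/
theorem hasGradientAt_weighted (hn : 2 ≤ n) (hF : IsStronglyConvexFinsler F)
    (hΩ : IsBoundedDomain Ω) (hu : IsTest 1 Ω u) (hx : x ∈ Ω) (hx0 : x ≠ 0) :
    HasGradientAt (weighted F Ω u) (X₂ (polar F x / radius F Ω) ^ (2 / (n : ℝ)) •
      (linkField F Ω u x + (u x * lerayWeight F Ω x * (2 / n * X₂ (polar F x / radius F Ω) -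
        ((n : ℝ) - 1) / n)) • gradient (polar F) x)) x := by
  have ht := ratio_pos hn hF hΩ hx0
  have ht1 := (ratio_mem hn hF hΩ hx).2
  have hτ := X₂_pos ht ht1
  have hH := hF.polar_pos hx0
  have h1 := HasDerivAt.comp_hasGradientAt
    (Real.hasDerivAt_rpow_const (p := 2 / (n : ℝ)) (Or.inl hτ.ne'))
    (hasGradientAt_X₂_comp hn hF hΩ hx hx0)
  have h2 : HasGradientAt (weighted F Ω u) _ x := (hu.hasGradientAt le_rfl x).mul' h1
  convert h2 using 1
  rw [linkField, Real.rpow_sub_one hτ.ne', smul_add, smul_add, smul_smul, smul_smul, smul_smul,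
    smul_smul, add_assoc, ← add_smul, add_comm]
  congr 2
  rw [lerayWeight]
  field_simp
  ring

theorem differentiableAt_weighted (hn : 2 ≤ n) (hF : IsStronglyConvexFinsler F)
    (hΩ : IsBoundedDomain Ω) (hu : IsTest 1 Ω u) (hx0 : x ≠ 0) :
    DifferentiableAt ℝ (weighted F Ω u) x := by
  by_cases hx : x ∈ tsupport u
  · exact (hasGradientAt_weighted hn hF hΩ hu (hu.tsupport_subset hx) hx0).differentiableAt
  · have hz : u =ᶠ[𝓝 x] fun _ => 0 := notMem_tsupport_iff_eventuallyEq.1 hx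
    refine (differentiableAt_const (0 : ℝ)).congr_of_eventuallyEq ?_
    filter_upwards [hz] with y hy
    rw [weighted, hy, zero_mul]

theorem norm_gradient_weighted_le (hn : 2 ≤ n) (hF : IsStronglyConvexFinsler F)
    (hΩ : IsBoundedDomain Ω) (hu : IsTest 1 Ω u) {α : ℝ} (hα : 0 < α)
    (hαF : ∀ ξ : E n, α * ‖ξ‖ ≤ F ξ) (hx : x ∈ Ω) (hx0 : x ≠ 0) :
    ‖gradient (weighted F Ω u) x‖ ≤ α⁻¹ * F (linkField F Ω u x) +
      betaTilde F * (((n : ℝ) + 1) / n) *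
        (X₂ (polar F x / radius F Ω) ^ (2 / (n : ℝ)) * (|u x| * lerayWeight F Ω x)) := by
  have hn2 : (2 : ℝ) ≤ n := by exact_mod_cast hn
  have ht := ratio_pos hn hF hΩ hx0
  have ht1 := (ratio_mem hn hF hΩ hx).2
  have hτ := X₂_pos ht ht1
  have hτ1 := X₂_le_one ht.le ht1
  have hρ := lerayWeight_nonneg hn hF hΩ hx
  have hβ := hF.norm_gradient_polar_le hx0
  rw [(hasGradientAt_weighted hn hF hΩ hu hx hx0).gradient, norm_smul,
    Real.norm_of_nonneg (by positivity)]
  set τ := X₂ (polar F x / radius F Ω)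
  set T := τ ^ (2 / (n : ℝ))
  have hT0 : 0 ≤ T := by positivity
  have hT1 : T ≤ 1 := Real.rpow_le_one hτ.le hτ1 (by positivity)
  have h1 : ‖linkField F Ω u x‖ ≤ α⁻¹ * F (linkField F Ω u x) := by
    rw [← div_eq_inv_mul, le_div_iff₀ hα, mul_comm]; exact hαF _
  -- The bound 2/n + (n-1)/n, the source of (n+1)/n in C_{n,F}.
  have h2 : |2 / n * τ - ((n : ℝ) - 1) / n| ≤ ((n : ℝ) + 1) / n := by
    rw [abs_le, div_mul_eq_mul_div, ← sub_div, ← neg_div, div_le_div_iff_of_pos_right (by positivity),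
      div_le_div_iff_of_pos_right (by positivity)]
    constructor <;> linarith
  have h3 : ‖(u x * lerayWeight F Ω x * (2 / n * τ - ((n : ℝ) - 1) / n)) • gradient (polar F) x‖ ≤
      |u x| * lerayWeight F Ω x * (((n : ℝ) + 1) / n) * betaTilde F := by
    rw [norm_smul, Real.norm_eq_abs, abs_mul, abs_mul, abs_of_nonneg hρ]
    gcongr
  have hFa := hF.nonneg (linkField F Ω u x)
  calc T * ‖_ + _‖ ≤ T * (α⁻¹ * F (linkField F Ω u x) +
        |u x| * lerayWeight F Ω x * (((n : ℝ) + 1) / n) * betaTilde F) := by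
        gcongr
        exact (norm_add_le _ _).trans (add_le_add h1 h3)
    _ = T * (α⁻¹ * F (linkField F Ω u x)) + betaTilde F * (((n : ℝ) + 1) / n) *
        (T * (|u x| * lerayWeight F Ω x)) := by ring
    _ ≤ _ := by
        exact add_le_add (mul_le_of_le_one_left (by positivity) hT1) le_rfl

theorem kappa_pos (hn : 2 ≤ n) : 0 < kappa n := by
  have hn2 : (2 : ℝ) ≤ n := by exact_mod_cast hn
  have : 0 < (n : ℝ) / (n - 1) := div_pos (by linarith) (by linarith)
  unfold kappa; positivity

theorem sigma_nonneg (hn : 2 ≤ n) (hF : IsStronglyConvexFinsler F) : 0 ≤ sigma F :=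
  zero_le_one.trans (isLeast_sigma hn hF).1.1

/-- The bracket in the definition of `constC`. -/
noncomputable def gradConst (F : E n → ℝ) (α : ℝ) : ℝ :=
  α⁻¹ * 2 ^ (((n : ℝ) - 1) / n) * sigma F +
    betaTilde F * (((n : ℝ) + 1) / n) * (n : ℝ) ^ (2 / (n : ℝ)) * kappa n ^ (1 / (n : ℝ))

/-- Minkowski on the pointwise bound: the link inequality controls `f₁` and `improved_leray`
controls `f₂`, whose n-th power carries the weight X₂². -/
theorem eLpNorm_gradient_weighted_le (hn : 2 ≤ n) (hF : IsStronglyConvexFinsler F)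
    (hΩ : IsBoundedDomain Ω) (hu : IsTest 1 Ω u) {α : ℝ} (hα : 0 < α)
    (hαF : ∀ ξ : E n, α * ‖ξ‖ ≤ F ξ) :
    eLpNorm (gradient (weighted F Ω u)) n (volume.restrict Ω) ≤
      ENNReal.ofReal (gradConst F α * lerayDiff F Ω u (gradient u) ^ (1 / (n : ℝ))) := by
  have hn2 : (2 : ℝ) ≤ n := by exact_mod_cast hn
  have hn0 : n ≠ 0 := by omega
  have hI := lerayDiff_nonneg_of_isTest hn hF hΩ hu
  have hσ := sigma_nonneg hn hF
  have hκ := kappa_pos hn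
  have hβ := IsStronglyConvexFinsler.betaTilde_nonneg F
  set I := lerayDiff F Ω u (gradient u) with hIdef
  have hroot : ∀ {y : ℝ}, 0 ≤ y → (y ^ (1 / (n : ℝ))) ^ n = y := fun hy => by
    rw [← Real.rpow_mul_natCast hy, one_div_mul_cancel (by positivity), Real.rpow_one]
  set f₁ : E n → ℝ := fun x => α⁻¹ * F (linkField F Ω u x) with hf₁
  set f₂ : E n → ℝ := fun x => betaTilde F * (((n : ℝ) + 1) / n) *
        (X₂ (polar F x / radius F Ω) ^ (2 / (n : ℝ)) * (|u x| * lerayWeight F Ω x)) with hf₂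
  have hm₁ : Measurable f₁ :=
    measurable_const.mul (hF.continuous.measurable.comp (measurable_linkField hF hu))
  have hmτ : Measurable fun x => X₂ (polar F x / radius F Ω) :=
    measurable_X₂.comp (hF.continuous_polar.measurable.div_const _)
  have hm₂ : Measurable f₂ := measurable_const.mul ((hmτ.pow_const _).mul
    ((measurable_abs.comp hu.contDiff.continuous.measurable).mul (measurable_lerayWeight hF)))
  have hle : eLpNorm (gradient (weighted F Ω u)) n (volume.restrict Ω) ≤
      eLpNorm (f₁ + f₂) n (volume.restrict Ω) := by
    refine eLpNorm_mono_ae ?_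
    filter_upwards [ae_restrict_mem hΩ.isOpen.measurableSet, ae_restrict_ne_zero hn Ω]
      with x hx hx0
    exact (norm_gradient_weighted_le hn hF hΩ hu hα hαF hx hx0).trans (le_abs_self _)
  have h₁ : eLpNorm f₁ n (volume.restrict Ω) ≤
      ENNReal.ofReal (α⁻¹ * 2 ^ (((n : ℝ) - 1) / n) * sigma F * I ^ (1 / (n : ℝ))) := by
    obtain ⟨c₀, -, hlink⟩ := exists_link_bound hn hF
    have hint := (hlink Ω u hΩ hu).1
    refine eLpNorm_le_of_integral_pow_le hn0 (Eventually.of_forall fun x =>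
      mul_nonneg (by positivity) (hF.nonneg _)) ?_ (by positivity) ?_
    · simp only [mul_pow]
      exact hint.const_mul _
    · simp only [mul_pow]
      rw [integral_const_mul, hroot hI, ← Real.rpow_mul_natCast zero_le_two,
        div_mul_cancel₀ _ (by positivity)]
      have e : (2 : ℝ) ^ ((n : ℝ) - 1) = 2 ^ (n - 1) := by
        rw [← Real.rpow_natCast, Nat.cast_sub (by omega), Nat.cast_one]
      rw [e]
      have := integral_linkField_le hn hF hΩ hu
      calc _ ≤ α⁻¹ ^ n * (2 ^ (n - 1) * sigma F ^ n * I) := by gcongr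
        _ = _ := by ring
  have h₂ : eLpNorm f₂ n (volume.restrict Ω) ≤
      ENNReal.ofReal (betaTilde F * (((n : ℝ) + 1) / n) * (n : ℝ) ^ (2 / (n : ℝ)) *
        kappa n ^ (1 / (n : ℝ)) * I ^ (1 / (n : ℝ))) := by
    have hpow : ∀ x ∈ Ω, f₂ x ^ n = (betaTilde F * (((n : ℝ) + 1) / n)) ^ n *
        (X₂ (polar F x / radius F Ω) ^ 2 * (|u x| * lerayWeight F Ω x) ^ n) := by
      intro x hx
      have h0 := ratio_mem hn hF hΩ hx
      have hτ := X₂_nonneg h0.1 h0.2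
      simp only [hf₂, mul_pow]
      rw [← Real.rpow_mul_natCast hτ, div_mul_cancel₀ _ (by positivity)]
      norm_num
    have hint := integrableOn_bounded_mul_weight hn hF hΩ hu
      (b := fun x => X₂ (polar F x / radius F Ω) ^ 2) (hmτ.pow_const 2) (by
        intro x hx
        have h0 := ratio_mem hn hF hΩ hx
        rw [abs_of_nonneg (sq_nonneg _)]
        exact pow_le_one₀ (X₂_nonneg h0.1 h0.2) (X₂_le_one h0.1 h0.2))
    have hae : (fun x => f₂ x ^ n) =ᵐ[volume.restrict Ω] fun x =>
        (betaTilde F * (((n : ℝ) + 1) / n)) ^ n *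
        (X₂ (polar F x / radius F Ω) ^ 2 * (|u x| * lerayWeight F Ω x) ^ n) := by
      filter_upwards [ae_restrict_mem hΩ.isOpen.measurableSet] with x hx using hpow x hx
    refine eLpNorm_le_of_integral_pow_le hn0 ?_ ((hint.const_mul _).congr hae.symm)
      (by positivity) ?_
    · filter_upwards [ae_restrict_mem hΩ.isOpen.measurableSet] with x hx
      have h0 := ratio_mem hn hF hΩ hx
      have hτ := X₂_nonneg h0.1 h0.2
      have hρ := lerayWeight_nonneg hn hF hΩ hx
      simp only [hf₂]
      positivity
    · rw [integral_congr_ae hae, integral_const_mul]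
      have key := improved_leray hn hF hΩ hu
      rw [← hIdef] at key
      set J := ∫ x in Ω, X₂ (polar F x / radius F Ω) ^ 2 * (|u x| * lerayWeight F Ω x) ^ n
      have hc : 0 < (((n : ℝ) - 1) / n) ^ (n - 2) :=
        pow_pos (div_pos (by linarith) (by linarith)) _
      -- n²κ_n is the reciprocal of the remainder constant in `improved_leray`.
      have hJ : J ≤ n ^ 2 * kappa n * I := by
        have e : (n : ℝ) ^ 2 * kappa n = ((((n : ℝ) - 1) / n) ^ (n - 2) / (2 * n))⁻¹ := by
          rw [kappa, ← inv_div ((n : ℝ) - 1) n, inv_pow]; field_simp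
        rw [e, ← div_eq_inv_mul, le_div_iff₀ (by positivity), mul_comm]
        exact key
      have hn2' : ((n : ℝ) ^ (2 / (n : ℝ))) ^ n = (n : ℝ) ^ 2 := by
        rw [← Real.rpow_mul_natCast (by positivity), div_mul_cancel₀ _ (by positivity)]
        norm_num
      rw [mul_pow _ (I ^ _), mul_pow _ (kappa n ^ _), mul_pow _ ((n : ℝ) ^ _), hroot hI,
        hroot hκ.le, hn2']
      calc _ ≤ (betaTilde F * (((n : ℝ) + 1) / n)) ^ n * (n ^ 2 * kappa n * I) := by gcongr
        _ = _ := by ring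
  calc _ ≤ _ := hle
    _ ≤ eLpNorm f₁ n (volume.restrict Ω) + eLpNorm f₂ n (volume.restrict Ω) :=
        eLpNorm_add_le hm₁.aestronglyMeasurable hm₂.aestronglyMeasurable
          (by exact_mod_cast (by omega : 1 ≤ n))
    _ ≤ _ := add_le_add h₁ h₂
    _ = _ := by
        rw [← ENNReal.ofReal_add (by positivity) (by positivity), gradConst, add_mul]

/-- The `L^q` estimate for test functions. -/
theorem eLpNorm_weighted_le_of_isTest (hn : 2 ≤ n) (hF : IsStronglyConvexFinsler F)
    (hΩ : IsBoundedDomain Ω) (hu : IsTest 1 Ω u) {α : ℝ} (hα : 0 < α)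
    (hαF : ∀ ξ : E n, α * ‖ξ‖ ≤ F ξ) {q : ℝ} (hq : (n : ℝ) < q) :
    eLpNorm (weighted F Ω u) (ENNReal.ofReal q) (volume.restrict Ω) ≤
      ENNReal.ofReal (constC F α * (1 + q * ((n : ℝ) - 1) / n) ^ (1 - 1 / (n : ℝ) + 1 / q) *
        volume.real Ω ^ (1 / q) * lerayDiff F Ω u (gradient u) ^ (1 / (n : ℝ))) := by
  have hn2 : (2 : ℝ) ≤ n := by exact_mod_cast hn
  have hω := omega_pos hn
  have h1 := eLpNorm_le_eLpNorm_gradient hn hΩ.isOpen.measurableSet hΩ.volume_ne_zero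
    hΩ.volume_ne_top (continuous_weighted hn hF hΩ hu)
    (hu.hasCompactSupport.of_isClosed_subset (isClosed_tsupport _) tsupport_weighted_subset)
    (tsupport_weighted_subset.trans hu.tsupport_subset)
    (fun y hy => differentiableAt_weighted hn hF hΩ hu hy) hq
  refine h1.trans ((mul_le_mul_right (eLpNorm_gradient_weighted_le hn hF hΩ hu hα hαF) _).trans_eq ?_)
  have hQ : 0 ≤ 1 + q * ((n : ℝ) - 1) / n := by
    have : 0 ≤ q * ((n : ℝ) - 1) / n :=
      div_nonneg (mul_nonneg (by linarith) (by linarith)) (by linarith)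
    linarith
  rw [← ENNReal.ofReal_mul (by positivity)]
  congr 1
  rw [constC, gradConst]
  ring

end Weighted

end FinslerLeray

/-! ### Passage from test functions to W₀^{1,n}. -/

namespace FinslerLeray

section Limit

theorem _root_.MeasureTheory.MemLp.integral_abs_pow_eq {α : Type*} [MeasurableSpace α]
    {μ : Measure α} {n : ℕ} (hn : n ≠ 0) {f : α → ℝ} (hf : MemLp f n μ) :
    ∫ x, |f x| ^ n ∂μ = (eLpNorm f n μ).toReal ^ n := by
  have h0 : 0 ≤ ∫ x, ‖f x‖ ^ n ∂μ := integral_nonneg fun x => by positivity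
  rw [hf.eLpNorm_eq_integral_rpow_norm (by simpa using hn) (ENNReal.natCast_ne_top n),
    ENNReal.toReal_natCast]
  simp_rw [Real.rpow_natCast]
  rw [ENNReal.toReal_ofReal (by positivity), ← Real.rpow_mul_natCast h0,
    inv_mul_cancel₀ (by exact_mod_cast hn), Real.rpow_one]
  simp_rw [Real.norm_eq_abs]

theorem integrable_abs_pow_of_memLp {α : Type*} [MeasurableSpace α]
    {μ : Measure α} {n : ℕ} (hn : n ≠ 0) {f : α → ℝ} (hf : MemLp f n μ) :
    Integrable (fun x => |f x| ^ n) μ := by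
  simpa only [Real.norm_eq_abs] using hf.integrable_norm_pow hn

theorem tendsto_integral_abs_pow {α : Type*} [MeasurableSpace α] {μ : Measure α} {n : ℕ}
    (hn : 1 ≤ n) {f : ℕ → α → ℝ} {g : α → ℝ} (hf : ∀ k, MemLp (f k) n μ) (hg : MemLp g n μ)
    (h : Tendsto (fun k => eLpNorm (f k - g) n μ) atTop (𝓝 0)) :
    Tendsto (fun k => ∫ x, |f k x| ^ n ∂μ) atTop (𝓝 (∫ x, |g x| ^ n ∂μ)) := by
  have : Fact (1 ≤ (n : ENNReal)) := ⟨by exact_mod_cast hn⟩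
  have h1 := ((Lp.tendsto_Lp_iff_tendsto_eLpNorm'' f hf g hg).2 h).norm.pow n
  simp_rw [Lp.norm_toLp] at h1
  rw [hg.integral_abs_pow_eq (by omega)]
  exact h1.congr fun k => ((hf k).integral_abs_pow_eq (by omega)).symm

variable {n : ℕ} {F : E n → ℝ} {Ω : Set (E n)}

theorem IsTest.sub {m : WithTop ℕ∞} {f g : E n → ℝ} (hf : IsTest m Ω f) (hg : IsTest m Ω g) :
    IsTest m Ω (f - g) where
  contDiff := hf.contDiff.sub hg.contDiff
  hasCompactSupport := hf.hasCompactSupport.sub hg.hasCompactSupport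
  tsupport_subset := (tsupport_sub f g).trans (Set.union_subset hf.tsupport_subset hg.tsupport_subset)

theorem IsTest.gradient_sub {f g : E n → ℝ} (hf : IsTest 1 Ω f) (hg : IsTest 1 Ω g) (x : E n) :
    gradient (f - g) x = gradient f x - gradient g x := by
  have h1 := hf.hasGradientAt le_rfl x
  have h2 := hg.hasGradientAt le_rfl x
  rw [hasGradientAt_iff_hasFDerivAt] at h1 h2
  have h3 : HasGradientAt (f - g) (gradient f x - gradient g x) x := by
    rw [hasGradientAt_iff_hasFDerivAt, map_sub]
    exact h1.sub h2
  exact h3.gradient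

theorem IsTest.memLp {m : WithTop ℕ∞} {f : E n → ℝ} (hf : IsTest m Ω f) (p : ENNReal) :
    MemLp f p (volume.restrict Ω) :=
  (hf.contDiff.continuous.memLp_of_hasCompactSupport hf.hasCompactSupport).restrict Ω

theorem IsTest.memLp_gradient {f : E n → ℝ} (hf : IsTest 1 Ω f) (p : ENNReal) :
    MemLp (gradient f) p (volume.restrict Ω) :=
  ((hf.continuous_gradient le_rfl).memLp_of_hasCompactSupport
    hf.hasCompactSupport_gradient).restrict Ω

theorem memLp_map (hF : IsStronglyConvexFinsler F) {G : E n → E n} {p : ENNReal}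
    (hG : MemLp G p (volume.restrict Ω)) : MemLp (fun x => F (G x)) p (volume.restrict Ω) := by
  obtain ⟨C, hC, hup⟩ := hF.exists_upper_bound
  refine MemLp.of_le_mul (c := C) hG (hF.continuous.comp_aestronglyMeasurable hG.1)
    (Eventually.of_forall fun x => ?_)
  rw [Real.norm_of_nonneg (hF.nonneg _)]
  exact hup _

/-- The Leray inequality as a norm inequality. -/
theorem exists_eLpNorm_leray (hn : 2 ≤ n) (hF : IsStronglyConvexFinsler F)
    (hΩ : IsBoundedDomain Ω) : ∃ C : NNReal, ∀ u, IsTest 1 Ω u →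
      eLpNorm (fun x => lerayWeight F Ω x * u x) n (volume.restrict Ω) ≤
        C * eLpNorm (gradient u) n (volume.restrict Ω) := by
  obtain ⟨C, hC, hup⟩ := hF.exists_upper_bound
  have hn2 : (2 : ℝ) ≤ n := by exact_mod_cast hn
  have hn0 : n ≠ 0 := by omega
  set c : ℝ := ((n : ℝ) - 1) / n with hc
  have hc0 : 0 < c := div_pos (by linarith) (by linarith)
  refine ⟨(c⁻¹).toNNReal * C.toNNReal, fun u hu => ?_⟩
  have hFu := memLp_map hF (hu.memLp_gradient (n : ENNReal))
  have h1 : eLpNorm (fun x => F (gradient u x)) n (volume.restrict Ω) ≤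
      ENNReal.ofReal C * eLpNorm (gradient u) n (volume.restrict Ω) := by
    refine eLpNorm_le_mul_eLpNorm_of_ae_le_mul (Eventually.of_forall fun x => ?_) _
    rw [Real.norm_of_nonneg (hF.nonneg _)]
    exact hup _
  set N := eLpNorm (fun x => F (gradient u x)) n (volume.restrict Ω) with hN
  have hint : ∫ x in Ω, F (gradient u x) ^ n = N.toReal ^ n := by
    rw [hN, ← hFu.integral_abs_pow_eq hn0]
    simp_rw [abs_of_nonneg (hF.nonneg _)]
  have h2 : eLpNorm (fun x => |u x| * lerayWeight F Ω x) n (volume.restrict Ω) ≤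
      ENNReal.ofReal (c⁻¹ * N.toReal) := by
    have hi := integrableOn_lerayTerm_of_isTest hn hF hΩ hu
    refine eLpNorm_le_of_integral_pow_le hn0 ?_ ?_ (by positivity) ?_
    · filter_upwards [ae_restrict_mem hΩ.isOpen.measurableSet] with x hx
      exact mul_nonneg (abs_nonneg _) (lerayWeight_nonneg hn hF hΩ hx)
    · exact hi.congr (Eventually.of_forall fun x => lerayTerm_eq u x)
    · have h := lerayDiff_nonneg_of_isTest hn hF hΩ hu
      rw [lerayDiff, hint] at h
      simp_rw [← lerayTerm_eq]
      rw [mul_pow, inv_pow, ← div_eq_inv_mul, le_div_iff₀ (by positivity), mul_comm]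
      linarith
  calc eLpNorm (fun x => lerayWeight F Ω x * u x) n (volume.restrict Ω)
      = eLpNorm (fun x => |u x| * lerayWeight F Ω x) n (volume.restrict Ω) := by
        refine eLpNorm_congr_norm_ae (Eventually.of_forall fun x => ?_)
        simp [mul_comm]
    _ ≤ ENNReal.ofReal (c⁻¹ * N.toReal) := h2
    _ = ENNReal.ofReal c⁻¹ * N := by
        rw [ENNReal.ofReal_mul (by positivity), ENNReal.ofReal_toReal hFu.2.ne]
    _ ≤ ENNReal.ofReal c⁻¹ * (ENNReal.ofReal C * eLpNorm (gradient u) n (volume.restrict Ω)) := by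
        gcongr
    _ = _ := by
        rw [← mul_assoc, ENNReal.coe_mul]; rfl

/-- The approximation data of a function in `W₀^{1,n}`, with convergence of all relevant terms. -/
theorem MemW₀.exists_approx_ae {u : E n → ℝ} {G : E n → E n} (hn : 2 ≤ n) (hu : MemW₀ Ω u G) :
    ∃ φ : ℕ → E n → ℝ, (∀ k, IsTest 1 Ω (φ k)) ∧
      (∀ᵐ x ∂(volume.restrict Ω), Tendsto (fun k => φ k x) atTop (𝓝 (u x))) ∧
      Tendsto (fun k => eLpNorm (gradient (φ k) - G) n (volume.restrict Ω)) atTop (𝓝 0) := by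
  obtain ⟨φ, hφ, h1, h2⟩ := hu.exists_approx
  have hφ1 : ∀ k, IsTest 1 Ω (φ k) := fun k => (hφ k).mono (by exact_mod_cast le_top)
  have hn0 : (n : ENNReal) ≠ 0 := by simp; omega
  -- Lⁿ convergence gives convergence in measure, hence an almost everywhere convergent subsequence.
  obtain ⟨ns, hns, hae⟩ := (tendstoInMeasure_of_tendsto_eLpNorm hn0
    (fun k => ((hφ1 k).memLp n).1) hu.memLp.1 h1).exists_seq_tendsto_ae
  exact ⟨fun k => φ (ns k), fun k => hφ1 _, hae, h2.comp hns.tendsto_atTop⟩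

/-- The Leray inequality holds for differences φ_k - φ_l; letting l → ∞ with Fatou transfers it to
φ_k - u. -/
theorem tendsto_eLpNorm_lerayWeight (hn : 2 ≤ n) (hF : IsStronglyConvexFinsler F)
    (hΩ : IsBoundedDomain Ω) {u : E n → ℝ} {G : E n → E n} {φ : ℕ → E n → ℝ}
    (hG : AEStronglyMeasurable G (volume.restrict Ω))
    (hφ : ∀ k, IsTest 1 Ω (φ k))
    (hae : ∀ᵐ x ∂(volume.restrict Ω), Tendsto (fun k => φ k x) atTop (𝓝 (u x)))
    (hgrad : Tendsto (fun k => eLpNorm (gradient (φ k) - G) n (volume.restrict Ω)) atTop (𝓝 0)) :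
    Tendsto (fun k => eLpNorm ((fun x => lerayWeight F Ω x * φ k x) -
      fun x => lerayWeight F Ω x * u x) n (volume.restrict Ω)) atTop (𝓝 0) := by
  obtain ⟨C, hC⟩ := exists_eLpNorm_leray hn hF hΩ
  have hn1 : (1 : ENNReal) ≤ n := by exact_mod_cast (by omega : 1 ≤ n)
  set a : ℕ → ENNReal := fun k => eLpNorm (gradient (φ k) - G) n (volume.restrict Ω)
  have hCt : Tendsto (fun k => (C : ENNReal) * a k) atTop (𝓝 0) := by
    simpa using ENNReal.Tendsto.const_mul hgrad (Or.inr ENNReal.coe_ne_top)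
  refine tendsto_of_tendsto_of_tendsto_of_le_of_le tendsto_const_nhds hCt (fun _ => zero_le)
    fun k => ?_
  have hdiff : ∀ l, eLpNorm (fun x => lerayWeight F Ω x * (φ k - φ l) x) n (volume.restrict Ω) ≤
      C * (a k + a l) := by
    intro l
    refine (hC _ ((hφ k).sub (hφ l))).trans ?_
    gcongr
    have e : gradient (φ k - φ l) = (gradient (φ k) - G) - (gradient (φ l) - G) := by
      ext1 x
      rw [(hφ k).gradient_sub (hφ l)]
      simp
    rw [e]
    exact eLpNorm_sub_le (((hφ k).memLp_gradient n).1.sub hG)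
      (((hφ l).memLp_gradient n).1.sub hG) hn1
  have hlim : Tendsto (fun l => (C : ENNReal) * (a k + a l)) atTop (𝓝 (C * (a k + 0))) :=
    ENNReal.Tendsto.const_mul (tendsto_const_nhds.add hgrad) (Or.inr ENNReal.coe_ne_top)
  rw [add_zero] at hlim
  refine (Lp.eLpNorm_lim_le_liminf_eLpNorm
    (f := fun l x => lerayWeight F Ω x * (φ k - φ l) x) (fun l => ?_) _ ?_).trans ?_
  · exact ((measurable_lerayWeight hF).mul
      ((hφ k).sub (hφ l)).contDiff.continuous.measurable).aestronglyMeasurable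
  · filter_upwards [hae] with x hx
    have := (tendsto_const_nhds (x := φ k x)).sub hx |>.const_mul (lerayWeight F Ω x)
    simp only [Pi.sub_apply, ← mul_sub]
    exact this
  · rw [← hlim.liminf_eq]
    exact liminf_le_liminf (Eventually.of_forall hdiff)

theorem integral_lerayTerm_eq (hn : 2 ≤ n) (hF : IsStronglyConvexFinsler F)
    (hΩ : IsBoundedDomain Ω) (u : E n → ℝ) : lerayTerm F Ω u =ᵐ[volume.restrict Ω]
      fun x => |lerayWeight F Ω x * u x| ^ n := by
  filter_upwards [ae_restrict_mem hΩ.isOpen.measurableSet] with x hx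
  rw [lerayTerm_eq, abs_mul, abs_of_nonneg (lerayWeight_nonneg hn hF hΩ hx), mul_comm]

end Limit

end FinslerLeray

theorem proposition3p2 (n : ℕ) (hn : 2 ≤ n) (F : E n → ℝ) (hF : IsStronglyConvexFinsler F) :
    IsLeast {σ : ℝ | IsLinkConst F σ} (sigma F) ∧
    ∀ α : ℝ, 0 < α → (∀ ξ : E n, α * ‖ξ‖ ≤ F ξ) →
    ∀ Ω : Set (E n), IsBoundedDomain Ω →
    ∀ (u : E n → ℝ) (G : E n → E n), MemW₀ Ω u G →
      IntegrableOn (fun x => F (G x) ^ n) Ω ∧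
      IntegrableOn (lerayTerm F Ω u) Ω ∧
      0 ≤ lerayDiff F Ω u G ∧
      ∀ q : ℝ, (n : ℝ) < q →
        MemLp (weighted F Ω u) (ENNReal.ofReal q) (volume.restrict Ω) ∧
        (eLpNorm (weighted F Ω u) (ENNReal.ofReal q) (volume.restrict Ω)).toReal ≤
          constC F α * (1 + q * ((n : ℝ) - 1) / n) ^ (1 - 1 / (n : ℝ) + 1 / q) *
            volume.real Ω ^ (1 / q) * lerayDiff F Ω u G ^ (1 / (n : ℝ)) := by
  refine ⟨isLeast_sigma hn hF, fun α hα hαF Ω hΩ u G hu => ?_⟩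
  have hn1 : 1 ≤ n := by omega
  have hn2 : (2 : ℝ) ≤ n := by exact_mod_cast hn
  obtain ⟨φ, hφ, hae, hgrad⟩ := hu.exists_approx_ae hn
  have hρlim := tendsto_eLpNorm_lerayWeight hn hF hΩ hu.memLp_grad.1 hφ hae hgrad
  have hρφ : ∀ k, MemLp (fun x => lerayWeight F Ω x * φ k x) n (volume.restrict Ω) := by
    intro k
    obtain ⟨C, hC⟩ := exists_eLpNorm_leray hn hF hΩ
    exact ⟨((measurable_lerayWeight hF).mul
      (hφ k).contDiff.continuous.measurable).aestronglyMeasurable, (hC _ (hφ k)).trans_lt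
        (ENNReal.mul_lt_top ENNReal.coe_lt_top ((hφ k).memLp_gradient n).2)⟩
  -- For some k the distance to ρφ_k is finite, and ρφ_k is in Lⁿ.
  have hρu : MemLp (fun x => lerayWeight F Ω x * u x) n (volume.restrict Ω) := by
    obtain ⟨k, hk⟩ := (hρlim.eventually (gt_mem_nhds ENNReal.zero_lt_top)).exists
    have hm : AEStronglyMeasurable (fun x => lerayWeight F Ω x * u x) (volume.restrict Ω) :=
      (measurable_lerayWeight hF).aestronglyMeasurable.mul hu.memLp.1
    have h1 : MemLp ((fun x => lerayWeight F Ω x * φ k x) -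
      fun x => lerayWeight F Ω x * u x) n (volume.restrict Ω) := ⟨(hρφ k).1.sub hm, hk⟩
    have h2 := (hρφ k).sub h1
    rwa [sub_sub_cancel] at h2
  have hFG := memLp_map hF hu.memLp_grad
  have hFφ := fun k => memLp_map hF ((hφ k).memLp_gradient (n : ENNReal))
  have hFlim : Tendsto (fun k => eLpNorm ((fun x => F (gradient (φ k) x)) - fun x => F (G x)) n
      (volume.restrict Ω)) atTop (𝓝 0) := by
    obtain ⟨C, hC, hup⟩ := hF.exists_upper_bound
    have h1 : Tendsto (fun k => ENNReal.ofReal C *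
        eLpNorm (gradient (φ k) - G) n (volume.restrict Ω)) atTop (𝓝 0) := by
      simpa using ENNReal.Tendsto.const_mul hgrad (Or.inr ENNReal.ofReal_ne_top)
    refine tendsto_of_tendsto_of_tendsto_of_le_of_le tendsto_const_nhds h1 (fun _ => zero_le)
      fun k => eLpNorm_le_mul_eLpNorm_of_ae_le_mul (Eventually.of_forall fun x => ?_) _
    exact (hF.sub_le _ _).trans (hup _)
  have e1 : ∀ H : E n → E n, (fun x => F (H x) ^ n) = fun x => |F (H x)| ^ n := fun H => by
    ext x; rw [abs_of_nonneg (hF.nonneg _)]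
  -- Both integrals become n-th powers of Lⁿ norms, hence continuous under the convergences above.
  have hdiff : ∀ (v : E n → ℝ) (H : E n → E n), lerayDiff F Ω v H =
      (∫ x in Ω, |F (H x)| ^ n) - (((n : ℝ) - 1) / n) ^ n *
        ∫ x in Ω, |lerayWeight F Ω x * v x| ^ n := fun v H => by
    rw [lerayDiff, integral_congr_ae (integral_lerayTerm_eq hn hF hΩ v), e1 H]
  have hIlim : Tendsto (fun k => lerayDiff F Ω (φ k) (gradient (φ k))) atTop
      (𝓝 (lerayDiff F Ω u G)) := by
    simp_rw [hdiff]
    exact (tendsto_integral_abs_pow hn1 hFφ hFG hFlim).sub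
      ((tendsto_integral_abs_pow hn1 hρφ hρu hρlim).const_mul _)
  have hI : 0 ≤ lerayDiff F Ω u G :=
    ge_of_tendsto' hIlim fun k => lerayDiff_nonneg_of_isTest hn hF hΩ (hφ k)
  refine ⟨?_, (integrable_abs_pow_of_memLp (by omega) hρu).congr (integral_lerayTerm_eq hn hF hΩ u).symm, hI,
    fun q hq => ?_⟩
  · rw [e1]
    exact integrable_abs_pow_of_memLp (by omega) hFG
  have hτm : Measurable fun x => X₂ (polar F x / radius F Ω) ^ (2 / (n : ℝ)) :=
    (measurable_X₂.comp (hF.continuous_polar.measurable.div_const _)).pow_const _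
  set K := constC F α * (1 + q * ((n : ℝ) - 1) / n) ^ (1 - 1 / (n : ℝ) + 1 / q) *
    volume.real Ω ^ (1 / q) with hK
  have hKlim : Tendsto (fun k => ENNReal.ofReal
      (K * lerayDiff F Ω (φ k) (gradient (φ k)) ^ (1 / (n : ℝ)))) atTop
      (𝓝 (ENNReal.ofReal (K * lerayDiff F Ω u G ^ (1 / (n : ℝ))))) :=
    ENNReal.tendsto_ofReal ((hIlim.rpow_const (Or.inr (by positivity))).const_mul K)
  have hmain : eLpNorm (weighted F Ω u) (ENNReal.ofReal q) (volume.restrict Ω) ≤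
      ENNReal.ofReal (K * lerayDiff F Ω u G ^ (1 / (n : ℝ))) := by
    -- Lower semicontinuity of the L^q norm under almost everywhere convergence; the bounds for φ_k
    -- converge because the Leray differences do.
    refine (Lp.eLpNorm_lim_le_liminf_eLpNorm (f := fun k => weighted F Ω (φ k))
      (fun k => ?_) _ ?_).trans ?_
    · exact ((hφ k).contDiff.continuous.measurable.mul hτm).aestronglyMeasurable
    · filter_upwards [hae] with x hx
      exact hx.mul_const _
    · rw [← hKlim.liminf_eq]
      exact liminf_le_liminf (Eventually.of_forall fun k =>
        eLpNorm_weighted_le_of_isTest hn hF hΩ (hφ k) hα hαF hq)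
  refine ⟨⟨hu.memLp.1.mul hτm.aestronglyMeasurable, hmain.trans_lt ENNReal.ofReal_lt_top⟩, ?_⟩
  refine ENNReal.toReal_le_of_le_ofReal ?_ hmain
  have hκ := kappa_pos hn
  have hβ := IsStronglyConvexFinsler.betaTilde_nonneg F
  have hσ := sigma_nonneg hn hF
  have hω := omega_pos hn
  have hQ : 0 ≤ 1 + q * ((n : ℝ) - 1) / n := by
    have : 0 ≤ q * ((n : ℝ) - 1) / n :=
      div_nonneg (mul_nonneg (by linarith) (by linarith)) (by linarith)
    linarith
  rw [hK, constC]
  positivity
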